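/- **Notation.** Let $k$ be an algebraically closed field of characteristic $p>0$. For a complete local $k$-algebra $A$ with residue field $k$, an *arc* on $\operatorname{Spec}A$ is a local $k$-algebra homomorphism $f^{\mathcal C}:A\to k[[X]]$ whose kernel is not the maximal ideal. Its curve is $\mathcal R^{\mathcal C}=\operatorname{Im}f^{\mathcal C}$, its support $[\mathcal C]$ is the closed subscheme of $\operatorname{Spec}A$ defined by $\operatorname{Ker}f^{\mathcal C}$, and its degree is $d_{\mathcal C}=[k((X)):\operatorname{Frac}\mathcal R^{\mathcal C}]$; $\mathcal C$ is *primitive* if $d_{\mathcal C}=1$. Put $E_{\mathcal C}=e(\mathcal R^{\mathcal C})\,d_{\mathcal C}$, where $e(\mathcal R)$ is the multiplicity of a local ring $\mathcal R$ with maximal ideal $\mathfrak m$, i.e. $\dim_k\mathcal R/\mathfrak m^n=e(\mathcal R)n+q$ for all large $n$ with $q$ constant. Let $M_{\mathcal C}$ be the least $i\ge 0$ for which the $i$-th iterated quadratic transform of $\mathcal R^{\mathcal C}$ equals its integral closure in its field of fractions. Here the quadratic transform of $\mathcal R$ is $\mathcal R[x^{-1}z\mid z\in\mathfrak m]$, where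 $x\in\mathfrak m$ is any element whose class $x+\mathfrak m^2$ is not nilpotent in $\operatorname{gr}_{\mathfrak m}\mathcal R$. If $A$ is moreover regular of dimension two, then for a height one prime $\mathfrak p=(g)$ with $F_{\mathfrak p}=\operatorname{Spec}A/\mathfrak p\ne[\mathcal C]$ put $(\mathcal C.F_{\mathfrak p})=v_X(f^{\mathcal C}(g))$, and extend by linearity to divisors not containing $[\mathcal C]$. We write $F_t$ for $F_{(t)}$. **Setting.** Let $A=k[[T,U]]$ be embedded into $A_1=k[[T_1,U]]$ as a $k$-algebra by $U\mapsto U$, $T\mapsto\xi(T_1,U)$ with $\xi\equiv T_1^p \bmod (T_1^{p+1},T_1U)$. Assume that there is an $A$-automorphism $\sigma$ of $A_1$ with $\sigma^p=1$ and $A_1^{\langle\sigma\rangle}=A$. Let $K$, $L$ be the fraction fields of $A$, $A_1$, put $\mathcal X=\operatorname{Spec}A$, and let $L=K(x)$ with $x^p-x=a\in K$. Let $R\subset\mathcal X$ be the branch locus of $\operatorname{Spec}A_1\to\mathcal X$ (the image of the support of $\Omega^1_{A_1/A}$), with components $F_1,\dots,F_s$. Assume that $R$ is a simply normal crossing divisor,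 i.e. there are regular local parameters $t,u$ of $A$ such that every $F_i$ is $F_t$ or $F_u$. Let $v_i$ be the valuation of $K$ associated with $F_i$, $m_i=-v_i(a)$, and $$R_0(\mathcal X,L/K)=\sum_{i=1}^s(m_i+1)F_i .$$ A *lifting* of an arc $\mathcal C$ on $\operatorname{Spec}A$ is an arc $\mathcal C'$ on $\operatorname{Spec}A_1$ that is the composition of the normalization $\operatorname{Spec}k[[X]]\to Z$ of an irreducible component $Z$ (with reduced structure) of $\operatorname{Spec}(k[[X]]\otimes_AA_1)$ with the projection to $\operatorname{Spec}A_1$. **Proposition 6.3.** Let $\mathcal C$ be a primitive arc on $\operatorname{Spec}A$ such that $[\mathcal C]\ne F_T$ and $[\mathcal C]$ is not a component of $R$, and let $\mathcal C'$ be a lifting of $\mathcal C$. Then $$M_{\mathcal C'}<\frac p2\,(\mathcal C.R_0(\mathcal X,L/K))\,E_{\mathcal C}+\frac p2\,M_{\mathcal C}E_{\mathcal C}^2 .$$ -/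

import Mathlib

open scoped TensorProduct

namespace Algebroid

section Curves

/-!
Algebroid curves over `k`, embedded as `k`-subalgebras `R` of a field `F`
(below always `F = k((X))`).
-/

/-- The maximal ideal of a local ring `R` (in a local ring it is the Jacobson radical; written
so that no proof of locality is needed in the definitions). -/
def maxIdeal {k F : Type*} [Field k] [Field F] [Algebra k F] (R : Subalgebra k F) : Ideal R :=
  Ideal.jacobson ⊥

/-- The multiplicity `e(R)`: the only `e` such that `dim_k (R / 𝔪 ^ n) = e n + q` for all large
`n`, with a constant `q`. -/
noncomputable def curveMultiplicity {k F : Type*} [Field k] [Field F] [Algebra k F]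
    (R : Subalgebra k F) : ℕ :=
  sInf {e : ℕ | ∃ q : ℤ, ∀ᶠ n : ℕ in Filter.atTop,
    (Module.finrank k (R ⧸ (maxIdeal R) ^ n) : ℤ) = (e : ℤ) * n + q}

/-- `x ∈ 𝔪` is a transversal parameter if the class `x + 𝔪 ^ 2` is not nilpotent in the graded
ring `gr_𝔪 R`, that is, no power `x ^ n` lies in `𝔪 ^ (n + 1)`. -/
def IsTransversal {k F : Type*} [Field k] [Field F] [Algebra k F] (R : Subalgebra k F)
    (x : R) : Prop :=
  x ∈ maxIdeal R ∧ ∀ n : ℕ, x ^ n ∉ (maxIdeal R) ^ (n + 1)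

/-- The quadratic transform `R₁ = R[z / x | z ∈ 𝔪]`, with `x` a transversal parameter. The ring
does not depend on `x`, so that one may let `x` run over all transversal parameters. -/
def quadraticTransform {k F : Type*} [Field k] [Field F] [Algebra k F] (R : Subalgebra k F) :
    Subalgebra k F :=
  Algebra.adjoin k ((R : Set F) ∪
    {w : F | ∃ x z : R, IsTransversal R x ∧ z ∈ maxIdeal R ∧ w = (z : F) / (x : F)})

/-- The integral closure of `R` in its field of fractions (the latter is realized as the
subfield of `F` generated by `R`). -/
def normalization {k F : Type*} [Field k] [Field F] [Algebra k F] (R : Subalgebra k F) : Set F :=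
  {y : F | y ∈ IntermediateField.adjoin k (R : Set F) ∧ IsIntegral R y}

/-- `M(R)`: the minimal `i` such that the `i`-th iterated quadratic transform of `R` is the
integral closure of `R`. -/
noncomputable def numTransforms {k F : Type*} [Field k] [Field F] [Algebra k F]
    (R : Subalgebra k F) : ℕ :=
  sInf {i : ℕ | ((quadraticTransform^[i] R : Subalgebra k F) : Set F) = normalization R}

end Curves

/-- An arc on `Spec A`: a `k`-morphism `Spec k[[X]] → Spec A` that maps the closed point to a
closed point and is not constant (the generic point does not go to the image of the closed
point). -/
structure Arc (k A : Type*) [Field k] [CommRing A] [Algebra k A] where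
  /-- the homomorphism of `k`-algebras `A → k[[X]]` -/
  hom : A →ₐ[k] PowerSeries k
  closed : ((IsLocalRing.maximalIdeal (PowerSeries k)).comap hom).IsMaximal
  nonconstant : RingHom.ker hom ≠ (IsLocalRing.maximalIdeal (PowerSeries k)).comap hom

namespace Arc

/-- The algebroid curve of an arc on `Spec A`, for `A` a *complete* local ring: the image of
`A → k[[X]]`, viewed inside `k((X))`, the latter being
realized as the field of fractions of `k[[X]]`. -/
noncomputable def curve {k A : Type*} [Field k] [CommRing A] [Algebra k A] (C : Arc k A) :
    Subalgebra k (FractionRing (PowerSeries k)) :=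
  ((IsScalarTower.toAlgHom k (PowerSeries k) (FractionRing (PowerSeries k))).comp C.hom).range

/-- The ideal of the support `[C]`, for `A` a complete local ring. -/
noncomputable def supportIdeal {k A : Type*} [Field k] [CommRing A] [Algebra k A] (C : Arc k A) : Ideal A :=
  RingHom.ker C.hom

/-- The degree of an arc: the degree of `k((X))` over the field of fractions of its curve. -/
noncomputable def degree {k A : Type*} [Field k] [CommRing A] [Algebra k A] (C : Arc k A) : ℕ :=
  Module.finrank (IntermediateField.adjoin k (C.curve : Set (FractionRing (PowerSeries k))))
    (FractionRing (PowerSeries k))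

/-- Primitive arcs are the arcs of degree one. -/
def IsPrimitive {k A : Type*} [Field k] [CommRing A] [Algebra k A] (C : Arc k A) : Prop :=
  C.degree = 1

/-- The multiplicity `E_C` of an arc. -/
noncomputable def E {k A : Type*} [Field k] [CommRing A] [Algebra k A] (C : Arc k A) : ℕ :=
  curveMultiplicity C.curve * C.degree

/-- The number `M_C` of an arc. -/
noncomputable def M {k A : Type*} [Field k] [CommRing A] [Algebra k A] (C : Arc k A) : ℕ :=
  numTransforms C.curve

/-- `C'` is a lifting of `C` along `Spec A₁ → Spec A`: it is the composition of the projection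
`Spec (k[[X]] ⊗[A] A₁) → Spec A₁` with the normalization of an irreducible component (with
its reduced structure) of `Spec (k[[X]] ⊗[A] A₁)`. Here `A` acts on `k[[X]]` through `C`. The
component is given by the minimal prime `ker ν`, and the last two conditions on `ν` express that
`k[[X]]` is the integral closure of the image of `ν` in its field of fractions. -/
def IsLifting {k A A₁ : Type*} [Field k] [CommRing A] [Algebra k A] [CommRing A₁]
    [Algebra k A₁] [Algebra A A₁] (C : Arc k A) (C' : Arc k A₁) : Prop :=
  letI : Algebra A (PowerSeries k) := C.hom.toRingHom.toAlgebra
  ∃ ν : (PowerSeries k ⊗[A] A₁) →+* PowerSeries k,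
    (∀ y : A₁, C'.hom y = ν (1 ⊗ₜ[A] y)) ∧
    RingHom.ker ν ∈ minimalPrimes (PowerSeries k ⊗[A] A₁) ∧
    ν.IsIntegral ∧
    ∀ f : PowerSeries k, ∃ b c, ν c ≠ 0 ∧ f * ν c = ν b

/-- The intersection number `(C . F_P)` of an arc with the prime divisor `F_P`, for `A` a
complete regular local ring of dimension two: the order of `C.hom g` where `P = (g)`. -/
noncomputable def inter {k A : Type*} [Field k] [CommRing A] [Algebra k A] (C : Arc k A)
    (P : PrimeSpectrum A) : ℕ∞ :=
  ⨅ g ∈ P.asIdeal, (C.hom g).order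

theorem inter_eq_order {k A : Type*} [Field k] [CommRing A] [Algebra k A] (C : Arc k A)
    (P : PrimeSpectrum A) (g : A) (hg : P.asIdeal = Ideal.span {g}) :
    C.inter P = (C.hom g).order := by
  apply le_antisymm
  · exact iInf₂_le g (by rw [hg]; exact Ideal.mem_span_singleton_self g)
  · refine le_iInf₂ fun h hh => ?_
    rw [hg, Ideal.mem_span_singleton] at hh
    obtain ⟨c, rfl⟩ := hh
    rw [map_mul, PowerSeries.order_mul]
    exact le_self_add

/-- The intersection number of an arc with a divisor `D = ∑ D_P F_P`, extended by linearity. It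
is meaningful when `[C]` is not a component of `D`. -/
noncomputable def interDiv {k A : Type*} [Field k] [CommRing A] [Algebra k A] (C : Arc k A)
    (D : PrimeSpectrum A → ℤ) : ℤ :=
  ∑ᶠ P : PrimeSpectrum A, D P * ((C.inter P).toNat : ℤ)

end Arc

/-- The reduced branch locus of `φ : Spec A₁ → Spec A`, i.e. `φ (Supp Ω)`, where `Ω` is the
module of relative differentials. -/
def branchLocus (A A₁ : Type*) [CommRing A] [CommRing A₁] [Algebra A A₁] :
    Set (PrimeSpectrum A) :=
  PrimeSpectrum.comap (algebraMap A A₁) '' Module.support A₁ (KaehlerDifferential A A₁)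

/-- The prime divisors contained in the branch locus. -/
def branchComponents (A A₁ : Type*) [CommRing A] [CommRing A₁] [Algebra A A₁] :
    Set (PrimeSpectrum A) :=
  {P | P.asIdeal.height = 1 ∧ P ∈ branchLocus A A₁}

/-- For `A` a two-dimensional regular local ring: a reduced divisor, given as the set of its
components, is a simply normal crossing divisor if the components are among `F_t`, `F_u` for some
regular local parameters `t`, `u`. -/
def IsSNC {A : Type*} [CommRing A] (S : Set (PrimeSpectrum A)) : Prop :=
  ∃ t u : A, (Ideal.span {t, u}).IsMaximal ∧
    ∀ P ∈ S, P.asIdeal = Ideal.span {t} ∨ P.asIdeal = Ideal.span {u}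

/-- The valuation `v_P` on the field of fractions `K` of `A` associated with the prime divisor
`F_P`: for `a = r / s` it is `length (A_P / r) - length (A_P / s)`. -/
noncomputable def primeVal {A K : Type*} [CommRing A] [Field K] [Algebra A K]
    [IsFractionRing A K] (P : PrimeSpectrum A) (a : K) : ℤ :=
  ((Ring.ord (Localization.AtPrime P.asIdeal)
      (algebraMap A _ (IsLocalization.sec (nonZeroDivisors A) a).1)).toNat : ℤ) -
  ((Ring.ord (Localization.AtPrime P.asIdeal)
      (algebraMap A _ ((IsLocalization.sec (nonZeroDivisors A) a).2 : A))).toNat : ℤ)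

open Classical in
/-- The divisor `R₀ = ∑ (m_P + 1) F_P`, the sum over the components of the branch locus, where
`m_P = - v_P(a)` and `a` is the right-hand side of an Artin-Schreier equation of the extension. -/
noncomputable def R₀ (A A₁ : Type*) {K : Type*} [CommRing A] [CommRing A₁] [Algebra A A₁]
    [Field K] [Algebra A K] [IsFractionRing A K] (a : K) : PrimeSpectrum A → ℤ :=
  fun P => if P ∈ branchComponents A A₁ then - primeVal P a + 1 else 0

end Algebroid

/-!
The bound compares conductors. For a subalgebra `S` of `k[[X]]` that contains `X ^ c k[[X]]`, a
quadratic transform at a singular point of multiplicity `e ≥ 2` lowers the exponent `c` by `e`, so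
`2 M(S) ≤ c` (`two_mul_numTransforms_le`). It remains to bound the conductor of the lifting `C'`.

The curve of an arc on `Spec k[[T, U]]` is a plane curve, and so are its quadratic transforms. If it
has multiplicity `e` and parameter `x` of order `e`, then the quadratic transform is generated over
`k[[x]]` by the powers of `y / x` of exponent less than `e`, so `x ^ (e - 1)` multiplies it into the
curve. Hence each quadratic transform contributes at most `E (E - 1)` to the conductor exponent,
which is at most `M E (E - 1)` for the primitive arc `C` (`Arc.IsPrimitive.conductorLE`).

Next, `A₁ = A[T₁]`, and `T₁` is a root of the monic polynomial `h = ∏ (Z - σ ^ i T₁)` over `A`. The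
lifting gives `φ : k[[X]] → k[[X]]` with `φ X` of order `ε ≤ p`, and with `τ` the image of `T₁`, the
theory of the different shows that `h'(τ) k[[X]]` consists of polynomials in `τ` over the image of
`φ` (`exists_derivative_mul_eq_eval₂`). So the conductor exponent of `C'` is at most
`ε M E (E - 1) + ord h'(τ)` (`conductorLE_lifting`). Every conjugate difference `σ ^ i T₁ - T₁` with
`0 < i < p` divides `D = σ T₁ - T₁`, whence `ord h'(τ) ≤ (p - 1) ord D`.

Finally `ord D ≤ (C . R₀)` (`order_le_interDiv`). The prime divisors of `D` are those lying over the
components of the branch locus. Let the prime `π` divide `D` exactly `d` times, let `t` be the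
equation of the component below it, `t ~ π ^ e`, and `m = - v_t(a)`. Then `d p ≤ e (m + 1)`
(`mul_le_of_artinSchreier`): one applies the congruence `σ y ≡ y` modulo `D` to an element `y` of
order one built from `x` and `t`, or to such a unit `y` if `p` divides `m`. As
`e ord π = ε (C . F_t)` with `ε ≤ p`, the sum of these bounds is the claim. Altogether
`2 M_{C'} ≤ p M E (E - 1) + (p - 1) (C . R₀)`, and `(C . R₀) ≥ ord D ≥ 1` makes the stated
inequality strict.
-/

namespace Algebroid

/-! ### Curves in `k[[X]]` with nonzero conductor -/

section Conductors

open PowerSeries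

variable {k : Type*} [Field k]

/-- The embedding of `k[[X]]` into its field of fractions. -/
noncomputable abbrev toFrac (k : Type*) [Field k] : k⟦X⟧ →ₐ[k] FractionRing k⟦X⟧ :=
  IsScalarTower.toAlgHom k k⟦X⟧ (FractionRing k⟦X⟧)

theorem toFrac_injective : Function.Injective (toFrac k) :=
  IsFractionRing.injective k⟦X⟧ (FractionRing k⟦X⟧)

/-- `X ^ c k[[X]] ⊆ S`: the conductor of `S` in `k[[X]]` contains `X ^ c`. -/
def ConductorLE (S : Subalgebra k k⟦X⟧) (c : ℕ) : Prop :=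
  ∀ f : k⟦X⟧, X ^ c ∣ f → f ∈ S

theorem conductorLE_zero_iff {S : Subalgebra k k⟦X⟧} : ConductorLE S 0 ↔ S = ⊤ := by
  refine ⟨fun h => ?_, fun h f _ => h ▸ Algebra.mem_top⟩
  exact eq_top_iff.2 fun f _ => h f (by simp)

/-- `x` is an element of `S` of order exactly `e ≥ 1`, the least positive order of an element
of `S`. -/
structure IsParam (S : Subalgebra k k⟦X⟧) (e : ℕ) (x : k⟦X⟧) : Prop where
  one_le : 1 ≤ e
  mem : x ∈ S
  eq_unit_mul : ∃ u : k⟦X⟧, IsUnit u ∧ x = X ^ e * u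
  dvd : ∀ z ∈ S, X ∣ z → X ^ e ∣ z

theorem exists_eq_X_pow_mul_unit {f : k⟦X⟧} (hf : f ≠ 0) :
    ∃ n : ℕ, ∃ u : k⟦X⟧, IsUnit u ∧ f = X ^ n * u := by
  obtain ⟨n, u, h⟩ := IsDiscreteValuationRing.eq_unit_mul_pow_irreducible hf
    (X_irreducible (R := k))
  exact ⟨n, u, u.isUnit, by rw [h, mul_comm]⟩

theorem X_pow_dvd_X_pow_mul_unit {m n : ℕ} {u : k⟦X⟧} (hu : IsUnit u) :
    (X : k⟦X⟧) ^ m ∣ X ^ n * u ↔ m ≤ n := by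
  rw [hu.dvd_mul_right]
  exact pow_dvd_pow_iff X_ne_zero X_irreducible.not_isUnit

theorem exists_isParam {S : Subalgebra k k⟦X⟧} {c : ℕ} (hS : ConductorLE S c) :
    ∃ e x, IsParam S e x := by
  classical
  have hex : ∃ e : ℕ, 1 ≤ e ∧ ∃ x ∈ S, ∃ u : k⟦X⟧, IsUnit u ∧ x = X ^ e * u :=
    ⟨c + 1, by omega, X ^ (c + 1), hS _ (pow_dvd_pow _ (by omega)), 1, isUnit_one, by simp⟩
  obtain ⟨h1, x, hx, hu⟩ := Nat.find_spec hex
  refine ⟨Nat.find hex, x, h1, hx, hu, fun z hz hXz => ?_⟩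
  by_cases hz0 : z = 0
  · simp [hz0]
  obtain ⟨n, v, hv, rfl⟩ := exists_eq_X_pow_mul_unit hz0
  rw [X_pow_dvd_X_pow_mul_unit hv]
  refine Nat.find_min' hex ⟨?_, _, hz, v, hv, rfl⟩
  rw [← pow_one (X : k⟦X⟧)] at hXz
  exact (X_pow_dvd_X_pow_mul_unit hv).1 (by simpa using hXz)

theorem isUnit_or_X_dvd (f : k⟦X⟧) : IsUnit f ∨ X ∣ f := by
  rw [X_dvd_iff, PowerSeries.isUnit_iff_constantCoeff, isUnit_iff_ne_zero]
  tauto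

theorem isIntegral_of_conductorLE {S : Subalgebra k k⟦X⟧} {c : ℕ} (hS : ConductorLE S c) :
    Algebra.IsIntegral S k⟦X⟧ := by
  refine ⟨fun f => ?_⟩
  have h1 : X ∣ f - algebraMap k k⟦X⟧ (constantCoeff f) := by
    rw [X_dvd_iff]; simp
  have h2 : (f - algebraMap k k⟦X⟧ (constantCoeff f)) ^ (c + 1) ∈ S :=
    hS _ ((pow_dvd_pow _ (by omega)).trans (pow_dvd_pow_of_dvd h1 (c + 1)))
  have h3 : IsIntegral S (f - algebraMap k k⟦X⟧ (constantCoeff f)) :=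
    IsIntegral.of_pow (Nat.succ_pos c) (isIntegral_algebraMap (x := (⟨_, h2⟩ : S)))
  have h4 : IsIntegral S (algebraMap k k⟦X⟧ (constantCoeff f)) :=
    isIntegral_algebraMap (x := (⟨_, S.algebraMap_mem _⟩ : S))
  simpa using h3.add h4

theorem ConductorLE.unit_inv_mem {S : Subalgebra k k⟦X⟧} {c : ℕ} (hS : ConductorLE S c)
    {u v : k⟦X⟧} (hu : u ∈ S) (huv : u * v = 1) : v ∈ S := by
  have := isIntegral_of_conductorLE hS
  have hl : IsUnit (⟨u, hu⟩ : S) := by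
    refine isUnit_of_map_unit (algebraMap S k⟦X⟧) _ ?_
    exact IsUnit.of_mul_eq_one v huv
  obtain ⟨w, hw⟩ := hl.exists_right_inv
  have : u * w.1 = 1 := congrArg Subtype.val hw
  rw [← left_inv_eq_right_inv (by rw [mul_comm]; exact this) huv]
  exact w.2

variable {S : Subalgebra k k⟦X⟧} {c e : ℕ} {x : k⟦X⟧}

theorem mem_maxIdeal_map (hS : ConductorLE S c) (r : S.map (toFrac k)) :
    r ∈ maxIdeal (S.map (toFrac k)) ↔ ∃ s ∈ S, X ∣ s ∧ toFrac k s = r := by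
  obtain ⟨r, s, hs, rfl⟩ := r
  rw [maxIdeal, Ideal.mem_jacobson_bot]
  constructor
  · intro h
    refine ⟨s, hs, ?_, rfl⟩
    by_contra hX
    have h0 : constantCoeff s ≠ 0 := by rwa [X_dvd_iff] at hX
    obtain ⟨⟨_, v, hv, rfl⟩, hw⟩ := (h (algebraMap k _ (-(constantCoeff s)⁻¹))).exists_right_inv
    have h2 : (s * algebraMap k _ (-(constantCoeff s)⁻¹) + 1) * v = 1 := by
      apply toFrac_injective
      have := congrArg Subtype.val hw
      simp only [map_mul, map_add, map_one, AlgHom.commutes]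
      exact this
    have := congrArg constantCoeff h2
    simp [h0] at this
  · rintro ⟨s', hs', hX, h⟩ ⟨_, t, ht, rfl⟩
    obtain rfl : s' = s := toFrac_injective h
    have hu : IsUnit (s' * t + 1) := by
      refine (isUnit_or_X_dvd _).resolve_right fun h => ?_
      exact X_irreducible.not_isUnit (isUnit_of_dvd_one
        ((dvd_add_right (hX.mul_right t)).1 h))
    obtain ⟨v, hv⟩ := hu.exists_right_inv
    have hvS := hS.unit_inv_mem (S.add_mem (S.mul_mem hs ht) S.one_mem) hv
    refine IsUnit.of_mul_eq_one ⟨toFrac k v, v, hvS, rfl⟩ ?_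
    apply Subtype.ext
    have := congrArg (toFrac k) hv
    simpa using! this

/-- The `n`-th power of the maximal ideal of the curve `S ⊆ k((X))`, as a subspace of `k[[X]]`. -/
noncomputable def maxPow (S : Subalgebra k k⟦X⟧) (n : ℕ) : Submodule k k⟦X⟧ :=
  ((((maxIdeal (S.map (toFrac k))) ^ n).restrictScalars k).map
    (S.map (toFrac k)).val.toLinearMap).comap (toFrac k).toLinearMap

theorem mem_maxPow {n : ℕ} {s : k⟦X⟧} :
    s ∈ maxPow S n ↔
      ∃ r ∈ (maxIdeal (S.map (toFrac k))) ^ n, (r : FractionRing k⟦X⟧) = toFrac k s :=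
  Iff.rfl

theorem maxPow_zero : maxPow S 0 = Subalgebra.toSubmodule S := by
  ext s
  rw [mem_maxPow]
  simp only [pow_zero, Ideal.one_eq_top, Submodule.mem_top, true_and, Subalgebra.mem_toSubmodule]
  constructor
  · rintro ⟨⟨_, t, ht, rfl⟩, h⟩
    rwa [← toFrac_injective h]
  · exact fun hs => ⟨⟨_, s, hs, rfl⟩, rfl⟩

theorem mul_mem_maxPow {m n : ℕ} {s t : k⟦X⟧} (hs : s ∈ maxPow S m) (ht : t ∈ maxPow S n) :
    s * t ∈ maxPow S (m + n) := by
  obtain ⟨r, hr, hrs⟩ := hs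
  obtain ⟨q, hq, hqt⟩ := ht
  refine ⟨r * q, ?_, ?_⟩
  · rw [pow_add]; exact Ideal.mul_mem_mul hr hq
  · have h1 : (r : FractionRing k⟦X⟧) = toFrac k s := hrs
    have h2 : (q : FractionRing k⟦X⟧) = toFrac k t := hqt
    change (r : FractionRing k⟦X⟧) * q = toFrac k (s * t)
    rw [h1, h2, map_mul]

theorem mem_maxPow_one (hS : ConductorLE S c) {s : k⟦X⟧} : s ∈ maxPow S 1 ↔ s ∈ S ∧ X ∣ s := by
  rw [mem_maxPow, pow_one]
  constructor
  · rintro ⟨r, hr, hrs⟩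
    obtain ⟨t, ht, hX, h⟩ := (mem_maxIdeal_map hS r).1 hr
    rw [← toFrac_injective (h.trans hrs)]
    exact ⟨ht, hX⟩
  · rintro ⟨hs, hX⟩
    exact ⟨⟨_, s, hs, rfl⟩, (mem_maxIdeal_map hS _).2 ⟨s, hs, hX, rfl⟩, rfl⟩

theorem pow_mem_maxPow {s : k⟦X⟧} (hs : s ∈ maxPow S 1) (n : ℕ) : s ^ n ∈ maxPow S n := by
  induction n with
  | zero => rw [maxPow_zero, pow_zero]; exact S.one_mem
  | succ n ih => rw [pow_succ]; exact mul_mem_maxPow ih hs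

theorem dvd_of_mem_maxPow (hS : ConductorLE S c) (hx : IsParam S e x) {n : ℕ} {s : k⟦X⟧}
    (hs : s ∈ maxPow S n) : X ^ (e * n) ∣ s := by
  have key : ∀ n : ℕ, ∀ r ∈ (maxIdeal (S.map (toFrac k))) ^ n,
      ∃ f : k⟦X⟧, (r : FractionRing k⟦X⟧) = toFrac k (X ^ (e * n) * f) := by
    intro n
    induction n with
    | zero =>
      rintro ⟨_, t, ht, rfl⟩ -
      exact ⟨t, by simp⟩
    | succ n ih =>
      intro r hr
      rw [pow_succ] at hr
      refine Submodule.mul_induction_on hr (fun a ha b hb => ?_) (fun a b ha hb => ?_)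
      · obtain ⟨f, hf⟩ := ih a ha
        obtain ⟨t, ht, hX, h⟩ := (mem_maxIdeal_map hS b).1 hb
        obtain ⟨g, rfl⟩ := hx.dvd t ht hX
        refine ⟨f * g, ?_⟩
        change (a : FractionRing k⟦X⟧) * b = _
        rw [hf, ← h, ← map_mul]
        congr 1
        ring
      · obtain ⟨f, hf⟩ := ha
        obtain ⟨g, hg⟩ := hb
        refine ⟨f + g, ?_⟩
        change (a : FractionRing k⟦X⟧) + b = _
        rw [hf, hg, ← map_add, ← mul_add]
  obtain ⟨r, hr, hrs⟩ := hs
  obtain ⟨f, hf⟩ := key n r hr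
  exact ⟨f, toFrac_injective (hrs.symm.trans hf)⟩

theorem IsParam.mem_maxPow_one (hS : ConductorLE S c) (hx : IsParam S e x) : x ∈ maxPow S 1 := by
  obtain ⟨u, -, rfl⟩ := hx.eq_unit_mul
  exact (Algebroid.mem_maxPow_one hS).2
    ⟨hx.mem, (dvd_pow_self X (by have := hx.one_le; omega)).mul_right u⟩

/-- Elements of order at least `e n + c + 1` lie in the `(n + 1)`-st power of the maximal ideal. -/
theorem mem_maxPow_succ_of_dvd (hS : ConductorLE S c) (hx : IsParam S e x) {n : ℕ} {s : k⟦X⟧}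
    (hs : X ^ (e * n + c + 1) ∣ s) : s ∈ maxPow S (n + 1) := by
  obtain ⟨g, rfl⟩ := hs
  obtain ⟨u, hu, hxu⟩ := hx.eq_unit_mul
  obtain ⟨v, hv⟩ := hu.exists_right_inv
  have h1 : X ^ (e * n + c + 1) * g = x ^ n * (X ^ (c + 1) * (v ^ n * g)) := by
    have h2 : u ^ n * v ^ n = 1 := by rw [← mul_pow, hv, one_pow]
    calc X ^ (e * n + c + 1) * g = X ^ (e * n + c + 1) * g * (u ^ n * v ^ n) := by rw [h2, mul_one]
      _ = _ := by rw [hxu]; ring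
  rw [h1]
  refine mul_mem_maxPow (pow_mem_maxPow (hx.mem_maxPow_one hS) n)
    ((mem_maxPow_one hS).2 ⟨hS _ ?_, ?_⟩)
  · exact (pow_dvd_pow _ (by omega)).mul_right _
  · exact (dvd_pow_self X (by omega)).mul_right _

/-- The transversal parameters of a curve are its elements of least positive order. -/
theorem isTransversal_iff (hS : ConductorLE S c) (hx : IsParam S e x)
    (r : S.map (toFrac k)) :
    IsTransversal (S.map (toFrac k)) r ↔ ∃ s, IsParam S e s ∧ toFrac k s = r := by
  constructor
  · rintro ⟨h1, h2⟩
    obtain ⟨s, hs, hX, hsr⟩ := (mem_maxIdeal_map hS r).1 h1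
    refine ⟨s, ⟨hx.one_le, hs, ?_, hx.dvd⟩, hsr⟩
    obtain ⟨u, hu⟩ := hx.dvd s hs hX
    refine ⟨u, (isUnit_or_X_dvd u).resolve_right ?_, hu⟩
    rintro ⟨w, rfl⟩
    -- an element of order above `e` is nilpotent in the graded ring
    apply h2 (c + 1)
    have h3 : s ^ (c + 1) ∈ maxPow S (c + 1 + 1) := by
      apply mem_maxPow_succ_of_dvd hS hx
      rw [hu]
      exact ⟨w ^ (c + 1), by ring⟩
    obtain ⟨q, hq, hqs⟩ := h3
    have : q = r ^ (c + 1) := Subtype.ext (by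
      have : (q : FractionRing k⟦X⟧) = toFrac k (s ^ (c + 1)) := hqs
      rw [this, map_pow, hsr]; rfl)
    exact this ▸ hq
  · rintro ⟨s, hs, hsr⟩
    refine ⟨(mem_maxIdeal_map hS r).2 ⟨s, hs.mem, ((mem_maxPow_one hS).1
      (hs.mem_maxPow_one hS)).2, hsr⟩, fun n hn => ?_⟩
    have h1 : s ^ n ∈ maxPow S (n + 1) := ⟨_, hn, by
      change ((r ^ n : S.map (toFrac k)) : FractionRing k⟦X⟧) = toFrac k (s ^ n)
      rw [map_pow, hsr]; rfl⟩
    obtain ⟨u, hu, hsu⟩ := hs.eq_unit_mul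
    have h2 := dvd_of_mem_maxPow hS hx h1
    rw [hsu, mul_pow, ← pow_mul, X_pow_dvd_X_pow_mul_unit (hu.pow n)] at h2
    have := hx.one_le
    nlinarith

/-- The blow-up `S[𝔪 / x]` of a subalgebra of `k[[X]]`. -/
noncomputable def blowup (S : Subalgebra k k⟦X⟧) (x : k⟦X⟧) : Subalgebra k k⟦X⟧ :=
  Algebra.adjoin k ((S : Set k⟦X⟧) ∪ {w | w * x ∈ S ∧ X ∣ w * x})

theorem le_blowup : S ≤ blowup S x :=
  fun _ hs => Algebra.subset_adjoin (Or.inl hs)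

theorem mem_blowup {w : k⟦X⟧} (h1 : w * x ∈ S) (h2 : X ∣ w * x) : w ∈ blowup S x :=
  Algebra.subset_adjoin (Or.inr ⟨h1, h2⟩)

theorem ConductorLE.blowup (hS : ConductorLE S c) (hx : IsParam S e x) :
    ConductorLE (blowup S x) (c - e) := by
  intro f hf
  obtain ⟨u, -, hxu⟩ := hx.eq_unit_mul
  have := hx.one_le
  refine mem_blowup (hS _ ?_) ?_
  · rw [hxu, ← mul_assoc]
    refine Dvd.dvd.mul_right ?_ u
    refine (pow_dvd_pow X (by omega : c ≤ (c - e) + e)).trans ?_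
    rw [pow_add]
    exact mul_dvd_mul_right hf _
  · rw [hxu]
    exact ((dvd_pow_self X (by omega)).mul_right u).mul_left f

/-- The quadratic transform is the blow-up along any element of least positive order. -/
theorem quadraticTransform_map (hS : ConductorLE S c) (hx : IsParam S e x) :
    quadraticTransform (S.map (toFrac k)) = (blowup S x).map (toFrac k) := by
  apply le_antisymm
  · refine Algebra.adjoin_le ?_
    rintro w (⟨s, hs, rfl⟩ | ⟨y, z, hy, hz, rfl⟩)
    · exact ⟨s, le_blowup hs, rfl⟩
    · obtain ⟨y', hy', hyy⟩ := (isTransversal_iff hS hx y).1 hy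
      obtain ⟨z', hz', hX, hzz⟩ := (mem_maxIdeal_map hS z).1 hz
      obtain ⟨u, hu, hxu⟩ := hx.eq_unit_mul
      obtain ⟨v, hv, hyv⟩ := hy'.eq_unit_mul
      obtain ⟨u', hu'⟩ := hu.exists_right_inv
      obtain ⟨v', hv'⟩ := hv.exists_right_inv
      obtain ⟨f, rfl⟩ := hx.dvd z' hz' hX
      have hX1 : X ∣ (X : k⟦X⟧) ^ e := dvd_pow_self X (by have := hx.one_le; omega)
      -- `z / y = (z / x) (x / y)`, and `x / y` is the inverse of the unit `y / x`
      have h1 : f * u' ∈ blowup S x := by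
        have : f * u' * x = X ^ e * f := by rw [hxu]; linear_combination (X ^ e * f) * hu'
        exact mem_blowup (this ▸ hz') (this ▸ hX)
      have h2 : v * u' ∈ blowup S x := by
        have : v * u' * x = y' := by rw [hxu, hyv]; linear_combination (X ^ e * v) * hu'
        exact mem_blowup (this ▸ hy'.mem) (this ▸ hyv ▸ hX1.mul_right v)
      have h3 : v' * u ∈ blowup S x :=
        (hS.blowup hx).unit_inv_mem h2 (by linear_combination v * v' * hu' + hv')
      refine ⟨f * u' * (v' * u), Subalgebra.mul_mem _ h1 h3, ?_⟩
      rw [← hyy, ← hzz]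
      have hy0 : toFrac k y' ≠ 0 := by
        rw [Ne, map_eq_zero_iff _ toFrac_injective, hyv]
        exact mul_ne_zero (pow_ne_zero _ X_ne_zero) hv.ne_zero
      rw [eq_div_iff hy0]
      change toFrac k _ * toFrac k y' = _
      rw [← map_mul]
      congr 1
      rw [hyv]
      linear_combination X ^ e * f * v * v' * hu' + X ^ e * f * hv'
  · rw [blowup, AlgHom.map_adjoin]
    refine Algebra.adjoin_le ?_
    rintro _ ⟨w, (hw | ⟨h1, h2⟩), rfl⟩
    · exact Algebra.subset_adjoin (Or.inl ⟨w, hw, rfl⟩)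
    · refine Algebra.subset_adjoin (Or.inr ⟨⟨toFrac k x, x, hx.mem, rfl⟩,
        ⟨toFrac k (w * x), w * x, h1, rfl⟩, (isTransversal_iff hS hx _).2 ⟨x, hx, rfl⟩,
        (mem_maxIdeal_map hS _).2 ⟨_, h1, h2, rfl⟩, ?_⟩)
      have hx0 : toFrac k x ≠ 0 := by
        obtain ⟨u, hu, hxu⟩ := hx.eq_unit_mul
        rw [Ne, map_eq_zero_iff _ toFrac_injective, hxu]
        exact mul_ne_zero (pow_ne_zero _ X_ne_zero) hu.ne_zero
      rw [eq_div_iff hx0]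
      exact (map_mul (toFrac k) w x).symm

/-- The normalization of a curve with nonzero conductor is `k[[X]]`. -/
theorem normalization_map (hS : ConductorLE S c) :
    normalization (S.map (toFrac k)) = Set.range (toFrac k) := by
  ext y
  constructor
  · rintro ⟨-, hy⟩
    have h1 : IsIntegral k⟦X⟧ y := by
      obtain ⟨P, hP, hPy⟩ := hy
      have hsub : ∀ r : S.map (toFrac k), ∃ s, toFrac k s = r := fun r => by
        obtain ⟨_, s, -, rfl⟩ := r; exact ⟨s, rfl⟩
      have hl : P.map (algebraMap (S.map (toFrac k)) (FractionRing k⟦X⟧)) ∈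
          Polynomial.lifts (algebraMap k⟦X⟧ (FractionRing k⟦X⟧)) := by
        rw [Polynomial.lifts_iff_coeff_lifts]
        intro n
        obtain ⟨s, hs⟩ := hsub (P.coeff n)
        exact ⟨s, by rw [Polynomial.coeff_map]; exact hs⟩
      obtain ⟨Q, hQ, -, hQm⟩ := Polynomial.lifts_and_natDegree_eq_and_monic hl (hP.map _)
      refine ⟨Q, hQm, ?_⟩
      rw [← Polynomial.eval_map, hQ, Polynomial.eval_map]
      exact hPy
    obtain ⟨f, hf⟩ := IsIntegrallyClosed.isIntegral_iff.1 h1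
    exact ⟨f, hf⟩
  · rintro ⟨f, rfl⟩
    refine ⟨?_, ?_⟩
    · have hmem : ∀ s ∈ S, toFrac k s ∈
          IntermediateField.adjoin k
            ((S.map (toFrac k) : Subalgebra k _) : Set (FractionRing k⟦X⟧)) :=
        fun s hs => IntermediateField.subset_adjoin _ _ ⟨s, hs, rfl⟩
      have h1 := hmem _ (hS (X ^ c) dvd_rfl)
      have h2 := hmem _ (hS (X ^ c * f) (dvd_mul_right _ _))
      have h3 := div_mem h2 h1
      have h0 : toFrac k (X ^ c) ≠ 0 := by
        rw [Ne, map_eq_zero_iff _ toFrac_injective]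
        exact pow_ne_zero _ X_ne_zero
      rwa [map_mul, mul_div_cancel_left₀ _ h0] at h3
    · have := isIntegral_of_conductorLE hS
      obtain ⟨P, hP, hPf⟩ := Algebra.IsIntegral.isIntegral (R := S) f
      let g : S →+* S.map (toFrac k) :=
        ((toFrac k).toRingHom.comp (algebraMap S k⟦X⟧)).codRestrict (S.map (toFrac k)).toSubring
          (fun s => ⟨s.1, s.2, rfl⟩)
      refine ⟨P.map g, hP.map g, ?_⟩
      rw [Polynomial.eval₂_map]
      have : (algebraMap (S.map (toFrac k)) (FractionRing k⟦X⟧)).comp g =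
        (toFrac k).toRingHom.comp (algebraMap S k⟦X⟧) := rfl
      rw [this]
      have h2 := congrArg (toFrac k) hPf
      rw [map_zero] at h2
      rw [← h2]
      exact (Polynomial.hom_eval₂ P (algebraMap S k⟦X⟧) (toFrac k).toRingHom f).symm

end Conductors

/-! ### Quadratic transforms and the conductor -/

section NumTransforms

open PowerSeries

variable {k : Type*} [Field k] {S : Subalgebra k k⟦X⟧} {c e : ℕ} {x : k⟦X⟧}

/-- A curve that contains an element of order one is smooth. -/
theorem eq_top_of_isParam_one (hS : ConductorLE S c) (hx : IsParam S 1 x) : S = ⊤ := by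
  rw [← conductorLE_zero_iff]
  induction c with
  | zero => exact hS
  | succ j ih =>
    refine ih fun f hf => ?_
    obtain ⟨g, rfl⟩ := hf
    obtain ⟨u, hu, hxu⟩ := hx.eq_unit_mul
    have hu0 : constantCoeff u ≠ 0 := by
      rwa [PowerSeries.isUnit_iff_constantCoeff, isUnit_iff_ne_zero] at hu
    set a : k := constantCoeff g / constantCoeff u ^ j with ha
    have h1 : X ∣ g - algebraMap k k⟦X⟧ a * u ^ j := by
      rw [X_dvd_iff]
      simp [ha, hu0]
    have h2 : X ^ j * g - algebraMap k k⟦X⟧ a * x ^ j ∈ S := by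
      apply hS
      rw [hxu, pow_one, mul_pow, pow_succ]
      have : X ^ j * g - algebraMap k k⟦X⟧ a * (X ^ j * u ^ j) =
        X ^ j * (g - algebraMap k k⟦X⟧ a * u ^ j) := by ring
      rw [this]
      exact mul_dvd_mul_left _ h1
    simpa using S.add_mem h2 (S.mul_mem (S.algebraMap_mem a) (S.pow_mem hx.mem j))

/-- If `X ^ c k[[X]] ⊆ S`, then at most `c / 2` quadratic transforms resolve `S`: blowing up a
singular point of multiplicity `e ≥ 2` lowers the exponent `c` by `e`. -/
theorem exists_iterate_quadraticTransform_eq (hS : ConductorLE S c) :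
    ∃ i : ℕ, 2 * i ≤ c ∧
      quadraticTransform^[i] (S.map (toFrac k)) = (⊤ : Subalgebra k k⟦X⟧).map (toFrac k) := by
  induction c using Nat.strong_induction_on generalizing S with
  | _ c ih =>
    by_cases htop : S = ⊤
    · exact ⟨0, by omega, by rw [htop]; rfl⟩
    obtain ⟨e, x, hx⟩ := exists_isParam hS
    have h1 : e ≠ 1 := fun h => htop (eq_top_of_isParam_one hS (h ▸ hx))
    have h2 := hx.one_le
    have hc : c ≠ 0 := fun h => htop (conductorLE_zero_iff.1 (h ▸ hS))
    have h3 : e ≤ c := by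
      have := hx.dvd _ (hS (X ^ c) dvd_rfl) (dvd_pow_self X hc)
      exact (pow_dvd_pow_iff X_ne_zero X_irreducible.not_isUnit).1 this
    obtain ⟨i, hi, hi'⟩ := ih (c - e) (by omega) (hS.blowup hx)
    refine ⟨i + 1, by omega, ?_⟩
    rw [Function.iterate_succ_apply, quadraticTransform_map hS hx, hi']

theorem coe_map_top : (((⊤ : Subalgebra k k⟦X⟧).map (toFrac k) : Subalgebra k _) :
    Set (FractionRing k⟦X⟧)) = Set.range (toFrac k) := by
  simp

theorem two_mul_numTransforms_le (hS : ConductorLE S c) :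
    2 * numTransforms (S.map (toFrac k)) ≤ c := by
  obtain ⟨i, hi, h⟩ := exists_iterate_quadraticTransform_eq hS
  have : numTransforms (S.map (toFrac k)) ≤ i := by
    refine Nat.sInf_le ?_
    rw [Set.mem_ofPred_eq, h, normalization_map hS, coe_map_top]
  omega

theorem iterate_numTransforms (hS : ConductorLE S c) :
    quadraticTransform^[numTransforms (S.map (toFrac k))] (S.map (toFrac k)) =
      (⊤ : Subalgebra k k⟦X⟧).map (toFrac k) := by
  obtain ⟨i, -, h⟩ := exists_iterate_quadraticTransform_eq hS
  have h1 : ((quadraticTransform^[numTransforms (S.map (toFrac k))] (S.map (toFrac k)) :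
      Subalgebra k (FractionRing k⟦X⟧)) : Set _) = normalization (S.map (toFrac k)) :=
    Nat.sInf_mem (s := {i : ℕ | ((quadraticTransform^[i] (S.map (toFrac k)) :
      Subalgebra k (FractionRing k⟦X⟧)) : Set _) = normalization (S.map (toFrac k))})
      ⟨i, by rw [Set.mem_ofPred_eq, h, normalization_map hS, coe_map_top]⟩
  rw [normalization_map hS, ← coe_map_top] at h1
  exact SetLike.coe_injective h1

end NumTransforms

/-! ### Generators over a ring of power series -/

section Spanning

open PowerSeries

/-- Let `α : R[[X]] → B` be a homomorphism such that `B` is separated for the `α X`-adic topology.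
If every element of `B` is, modulo `α X`, a combination of the `s i` with coefficients in `R`, then
the `s i` generate `B` over `R[[X]]`. -/
theorem exists_eq_sum_of_mod_X {R B ι : Type*} [CommRing R] [CommRing B] [Fintype ι]
    (α : R⟦X⟧ →+* B) (s : ι → B) (hsep : ∀ b : B, (∀ n : ℕ, α X ^ n ∣ b) → b = 0)
    (hs : ∀ b : B, ∃ (r : ι → R) (b' : B), b = ∑ i, α (C (r i)) * s i + α X * b') (b : B) :
    ∃ q : ι → R⟦X⟧, b = ∑ i, α (q i) * s i := by
  choose r next h using hs
  -- the coefficients of `q` come from dividing by `α X` again and again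
  let Q : B → ι → R⟦X⟧ := fun y i => PowerSeries.mk fun n => r (next^[n] y) i
  have hQ : ∀ y i, Q y i = C (r y i) + X * Q (next y) i := by
    intro y i
    ext n
    cases n with
    | zero => simp [Q]
    | succ n => simp [Q, coeff_succ_X_mul]
  have step : ∀ y, y - ∑ i, α (Q y i) * s i =
      α X * (next y - ∑ i, α (Q (next y) i) * s i) := by
    intro y
    simp only [hQ y, map_add, map_mul, add_mul, Finset.sum_add_distrib, mul_assoc, mul_sub,
      Finset.mul_sum]
    nth_rewrite 1 [h y]
    abel
  refine ⟨Q b, sub_eq_zero.1 (hsep _ fun n => ⟨next^[n] b - ∑ i, α (Q (next^[n] b) i) * s i, ?_⟩)⟩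
  induction n with
  | zero => simp
  | succ n ih =>
    rw [ih, step, pow_succ, mul_assoc, Function.iterate_succ_apply']

variable {k : Type*} [Field k]

theorem eq_zero_of_forall_X_pow_dvd {f : k⟦X⟧} (h : ∀ n : ℕ, X ^ n ∣ f) : f = 0 := by
  ext n
  exact X_pow_dvd_iff.1 (h (n + 1)) n (Nat.lt_succ_self n)

/-- If `φ X` has order `e ≥ 1`, then `1, X, …, X ^ (e - 1)` generate `k[[X]]` over the image
of `φ`. -/
theorem exists_eq_sum_map_mul_X_pow (φ : k⟦X⟧ →ₐ[k] k⟦X⟧) {e : ℕ} (he : 1 ≤ e) {u : k⟦X⟧}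
    (hu : IsUnit u) (hφ : φ X = X ^ e * u) (f : k⟦X⟧) :
    ∃ q : Fin e → k⟦X⟧, f = ∑ i, φ (q i) * X ^ (i : ℕ) := by
  refine exists_eq_sum_of_mod_X (φ : k⟦X⟧ →+* k⟦X⟧) (fun i : Fin e => X ^ (i : ℕ)) ?_ ?_ f
  · intro b hb
    refine eq_zero_of_forall_X_pow_dvd fun n => (pow_dvd_pow X ?_).trans
      (((dvd_mul_right (X ^ (e * n)) (u ^ n)).trans (Eq.dvd ?_)).trans (hb n))
    · exact Nat.le_mul_of_pos_left n he
    · rw [RingHom.coe_coe, hφ]; ring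
  · intro b
    obtain ⟨v, hv⟩ := hu.exists_right_inv
    have h1 : X ^ e ∣ b - ∑ i : Fin e, algebraMap k k⟦X⟧ (coeff (i : ℕ) b) * X ^ (i : ℕ) := by
      rw [X_pow_dvd_iff]
      intro m hm
      simp only [map_sub, map_sum, sub_eq_zero, PowerSeries.algebraMap_apply,
        Algebra.algebraMap_self_apply, coeff_C_mul, coeff_X_pow]
      rw [Finset.sum_eq_single (⟨m, hm⟩ : Fin e)]
      · simp
      · intro i _ hi
        rw [if_neg (fun h => hi (Fin.ext h.symm)), mul_zero]
      · simp
    obtain ⟨g, hg⟩ := h1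
    refine ⟨fun i => coeff (i : ℕ) b, v * g, ?_⟩
    have h2 : ∀ a : k, (φ : k⟦X⟧ →+* k⟦X⟧) (C a) = algebraMap k k⟦X⟧ a := fun a => φ.commutes a
    simp only [h2]
    rw [RingHom.coe_coe, hφ]
    linear_combination hg - X ^ e * g * hv

end Spanning

/-! ### Plane curves -/

section Planar

open PowerSeries

variable {k : Type*} [Field k] {S : Subalgebra k k⟦X⟧} {c e : ℕ} {x : k⟦X⟧}

/-- Every `w` is a root of a monic polynomial of degree `e` over `k[[x]]`, where `x = φ X` has
order `e`: the characteristic polynomial of the multiplication by `w`. -/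
theorem exists_pow_eq_sum_map_mul_pow (φ : k⟦X⟧ →ₐ[k] k⟦X⟧) (he : 1 ≤ e) {u : k⟦X⟧}
    (hu : IsUnit u) (hφ : φ X = X ^ e * u) (w : k⟦X⟧) :
    ∃ a : Fin e → k⟦X⟧, w ^ e = ∑ i, φ (a i) * w ^ (i : ℕ) := by
  choose m hm using fun i : Fin e => exists_eq_sum_map_mul_X_pow φ he hu hφ (w * X ^ (i : ℕ))
  let N : Matrix (Fin e) (Fin e) k⟦X⟧ := Matrix.of m
  have h1 : (Matrix.scalar (Fin e) w - N.map (φ : k⟦X⟧ →+* k⟦X⟧)).det = 0 := by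
    rw [← Matrix.exists_mulVec_eq_zero_iff]
    refine ⟨fun j => X ^ (j : ℕ), fun h => ?_, ?_⟩
    · have := congrFun h ⟨0, he⟩
      simp at this
    · rw [Matrix.sub_mulVec, sub_eq_zero]
      ext1 i
      simp only [Matrix.scalar_apply, Matrix.mulVec_diagonal]
      rw [hm i]
      rfl
  have h2 : Polynomial.eval₂ (φ : k⟦X⟧ →+* k⟦X⟧) w N.charpoly = 0 := by
    rw [← Polynomial.eval_map, ← Matrix.charpoly_map, Matrix.eval_charpoly]
    exact h1
  have h3 := N.charpoly_monic.as_sum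
  rw [Matrix.charpoly_natDegree_eq_dim, Fintype.card_fin] at h3
  rw [h3, Polynomial.eval₂_add, Polynomial.eval₂_finsetSum, Polynomial.eval₂_X_pow] at h2
  refine ⟨fun i => - N.charpoly.coeff i, ?_⟩
  rw [eq_neg_of_add_eq_zero_left h2, ← Finset.sum_neg_distrib, Finset.sum_range]
  refine Finset.sum_congr rfl fun i _ => ?_
  simp

/-- The closure of a subalgebra of `k[[X]]` for the `X`-adic topology. -/
def adicClosure (T : Subalgebra k k⟦X⟧) : Subalgebra k k⟦X⟧ where
  carrier := {f | ∀ n : ℕ, ∃ q ∈ T, X ^ n ∣ f - q}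
  mul_mem' := by
    intro f g hf hg n
    obtain ⟨q, hq, a, ha⟩ := hf n
    obtain ⟨r, hr, b, hb⟩ := hg n
    exact ⟨q * r, T.mul_mem hq hr, a * g + q * b, by linear_combination g * ha + q * hb⟩
  add_mem' := by
    intro f g hf hg n
    obtain ⟨q, hq, a, ha⟩ := hf n
    obtain ⟨r, hr, b, hb⟩ := hg n
    exact ⟨q + r, T.add_mem hq hr, a + b, by linear_combination ha + hb⟩
  algebraMap_mem' := fun a n => ⟨_, T.algebraMap_mem a, by simp⟩

theorem adicClosure_mono {T T' : Subalgebra k k⟦X⟧} (h : T ≤ T') :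
    adicClosure T ≤ adicClosure T' := fun f hf n => by
  obtain ⟨q, hq, hd⟩ := hf n
  exact ⟨q, h hq, hd⟩

/-- `S` is a plane curve: its maximal ideal is (topologically) generated by two elements. -/
def IsPlanar (S : Subalgebra k k⟦X⟧) : Prop :=
  ∃ x ∈ S, ∃ y ∈ S, X ∣ x ∧ X ∣ y ∧ S ≤ adicClosure (Algebra.adjoin k {x, y})

/-- If `x` and `y` are divisible by `z`, then every element of `k[x, y]` is a constant plus `z`
times an element of an algebra `T` containing `x`, `y` and the quotients. -/
theorem exists_eq_add_mul_of_mem_adjoin {T : Subalgebra k k⟦X⟧} {x y z a b : k⟦X⟧} (hz : z ∈ T)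
    (ha : a ∈ T) (hb : b ∈ T) (hx : x = z * a) (hy : y = z * b) {q : k⟦X⟧}
    (hq : q ∈ Algebra.adjoin k {x, y}) :
    ∃ (r : k) (q' : k⟦X⟧), q' ∈ T ∧ q = algebraMap k _ r + z * q' := by
  induction hq using Algebra.adjoin_induction with
  | mem f hf =>
    rcases hf with rfl | rfl
    · exact ⟨0, a, ha, by simp [hx]⟩
    · exact ⟨0, b, hb, by simp [hy]⟩
  | algebraMap r => exact ⟨r, 0, T.zero_mem, by simp⟩
  | add f g _ _ hf hg =>
    obtain ⟨r, q, hq, rfl⟩ := hf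
    obtain ⟨r', q', hq', rfl⟩ := hg
    exact ⟨r + r', q + q', T.add_mem hq hq', by rw [map_add]; ring⟩
  | mul f g _ _ hf hg =>
    obtain ⟨r, q, hq, rfl⟩ := hf
    obtain ⟨r', q', hq', rfl⟩ := hg
    refine ⟨r * r', algebraMap k _ r * q' + algebraMap k _ r' * q + z * (q * q'), ?_, ?_⟩
    · exact T.add_mem (T.add_mem (T.mul_mem (T.algebraMap_mem _) hq')
        (T.mul_mem (T.algebraMap_mem _) hq)) (T.mul_mem hz (T.mul_mem hq hq'))
    · rw [map_mul]; ring

theorem algebraMap_eq_zero_of_X_dvd {r : k} (h : X ∣ algebraMap k k⟦X⟧ r) :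
    algebraMap k k⟦X⟧ r = 0 := by
  rw [X_dvd_iff] at h
  have : r = 0 := by simpa using h
  rw [this, map_zero]

/-- One of the two generators of a plane curve has the least order. -/
theorem IsPlanar.exists_isParam (hP : IsPlanar S) (hS : ConductorLE S c) :
    ∃ e x, IsParam S e x ∧ ∃ y ∈ S, X ∣ y ∧ S ≤ adicClosure (Algebra.adjoin k {x, y}) := by
  obtain ⟨e, x₀, h0⟩ := Algebroid.exists_isParam hS
  obtain ⟨x, hx, y, hy, hXx, hXy, hle⟩ := hP
  have key : ∀ x ∈ S, X ∣ x → ¬ X ^ (e + 1) ∣ x → IsParam S e x := by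
    intro x hx hXx hne
    obtain ⟨u, hu⟩ := h0.dvd x hx hXx
    refine ⟨h0.one_le, hx, ⟨u, (isUnit_or_X_dvd u).resolve_right ?_, hu⟩, h0.dvd⟩
    rintro ⟨v, rfl⟩
    exact hne ⟨v, by rw [hu]; ring⟩
  by_cases h1 : X ^ (e + 1) ∣ x
  · by_cases h2 : X ^ (e + 1) ∣ y
    · exfalso
      obtain ⟨a, ha⟩ := h1
      obtain ⟨b, hb⟩ := h2
      obtain ⟨q, hq, g, hg⟩ := hle h0.mem (e + 1)
      obtain ⟨r, q', -, rfl⟩ := exists_eq_add_mul_of_mem_adjoin (T := ⊤) Algebra.mem_top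
        Algebra.mem_top Algebra.mem_top ha hb hq
      obtain ⟨u, hu, hxu⟩ := h0.eq_unit_mul
      have h3 : x₀ = algebraMap k _ r + X ^ (e + 1) * (q' + g) := by linear_combination hg
      have h4 : algebraMap k k⟦X⟧ r = 0 := by
        apply algebraMap_eq_zero_of_X_dvd
        have h5 : algebraMap k k⟦X⟧ r = X ^ e * (u - X * (q' + g)) := by
          linear_combination hxu - h3
        rw [h5]
        exact (dvd_pow_self X (by have := h0.one_le; omega)).mul_right _
      rw [h4, zero_add, hxu] at h3
      have := (X_pow_dvd_X_pow_mul_unit hu).1 ⟨_, h3⟩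
      omega
    · exact ⟨e, y, key y hy hXy h2, x, hx, hXx, by rwa [Set.pair_comm]⟩
  · exact ⟨e, x, key x hx hXx h1, y, hy, hXy, hle⟩

/-- The blow-up of the plane curve `k[[x, y]]` is `k[[x, y / x]]`. -/
theorem blowup_le_adicClosure {w : k⟦X⟧} (hx : IsParam S e x)
    (hle : S ≤ adicClosure (Algebra.adjoin k {x, x * w})) :
    blowup S x ≤ adicClosure (Algebra.adjoin k {x, w}) := by
  have hxm : x ∈ Algebra.adjoin k {x, w} := Algebra.subset_adjoin (by simp)
  have hwm : w ∈ Algebra.adjoin k {x, w} := Algebra.subset_adjoin (by simp)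
  have hsub : Algebra.adjoin k {x, x * w} ≤ Algebra.adjoin k {x, w} := by
    refine Algebra.adjoin_le ?_
    rintro _ (rfl | rfl)
    · exact hxm
    · exact Subalgebra.mul_mem _ hxm hwm
  refine Algebra.adjoin_le ?_
  rintro f (hf | ⟨h1, h2⟩)
  · exact adicClosure_mono hsub (hle hf)
  · intro n
    obtain ⟨q, hq, g, hg⟩ := hle h1 (n + e)
    obtain ⟨r, q', hq', rfl⟩ := exists_eq_add_mul_of_mem_adjoin hxm
      (Subalgebra.one_mem _) hwm (mul_one x).symm rfl hq
    obtain ⟨u, hu, hxu⟩ := hx.eq_unit_mul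
    have he := hx.one_le
    have h3 : algebraMap k k⟦X⟧ r = 0 := by
      apply algebraMap_eq_zero_of_X_dvd
      have h4 : algebraMap k k⟦X⟧ r = f * x - (X ^ e * (u * q') + X ^ (n + e) * g) := by
        linear_combination (-1 : k⟦X⟧) * hg - q' * hxu
      rw [h4]
      refine dvd_sub h2 (dvd_add ?_ ?_)
      · exact (dvd_pow_self X (by omega)).mul_right _
      · exact (dvd_pow_self X (by omega)).mul_right _
    refine ⟨q', hq', ?_⟩
    have h5 : X ^ e * (u * (f - q')) = X ^ e * (X ^ n * g) := by
      rw [h3, zero_add, hxu] at hg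
      rw [pow_add] at hg
      linear_combination hg
    have h6 := mul_left_cancel₀ (pow_ne_zero e X_ne_zero) h5
    exact (hu.dvd_mul_left).1 ⟨g, h6⟩

/-- The blow-up of a plane curve is a plane curve. -/
theorem IsPlanar.blowup {w : k⟦X⟧} (hx : IsParam S e x) (hy : x * w ∈ S) (hXy : X ∣ x * w)
    (hle : S ≤ adicClosure (Algebra.adjoin k {x, x * w})) : IsPlanar (blowup S x) := by
  have hXx : X ∣ x := by
    obtain ⟨u, -, rfl⟩ := hx.eq_unit_mul
    exact (dvd_pow_self X (by have := hx.one_le; omega)).mul_right _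
  have hw : w ∈ Algebroid.blowup S x := mem_blowup (by rwa [mul_comm]) (by rwa [mul_comm])
  refine ⟨x, le_blowup hx.mem, w - algebraMap k _ (constantCoeff w),
    Subalgebra.sub_mem _ hw (Subalgebra.algebraMap_mem _ _), hXx, ?_, ?_⟩
  · rw [X_dvd_iff]; simp
  · refine (blowup_le_adicClosure hx hle).trans (adicClosure_mono (Algebra.adjoin_le ?_))
    rintro f (hf | hf)
    · rw [hf]; exact Algebra.subset_adjoin (by simp)
    · rw [Set.mem_singleton_iff.1 hf]
      have h1 : w - algebraMap k _ (constantCoeff w) ∈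
        Algebra.adjoin k {x, w - algebraMap k k⟦X⟧ (constantCoeff w)} :=
        Algebra.subset_adjoin (by simp)
      simpa using Subalgebra.add_mem _ h1
        (Subalgebra.algebraMap_mem (Algebra.adjoin k {x, w - algebraMap k k⟦X⟧ (constantCoeff w)})
          (constantCoeff w))

/-- For a plane curve of multiplicity `e`, the blow-up is generated over `k[[x]]` by
`1, …, (y / x) ^ (e - 1)`, so `x ^ (e - 1)` multiplies it into the curve. -/
theorem pow_mul_mem_of_mem_blowup (hS : ConductorLE S c) {w : k⟦X⟧} (hx : IsParam S e x)
    (hy : x * w ∈ S) (hle : S ≤ adicClosure (Algebra.adjoin k {x, x * w})) {f : k⟦X⟧}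
    (hf : f ∈ blowup S x) : x ^ (e - 1) * f ∈ S := by
  obtain ⟨u, hu, hxu⟩ := hx.eq_unit_mul
  have he := hx.one_le
  have hx0 : constantCoeff x = 0 := by
    rw [← X_dvd_iff, hxu]
    exact (dvd_pow_self X (by omega)).mul_right _
  let φ : k⟦X⟧ →ₐ[k] k⟦X⟧ := PowerSeries.substAlgHom (HasSubst.of_constantCoeff_zero' hx0)
  have hφ : φ X = x := PowerSeries.substAlgHom_X _
  have hφS : ∀ a, φ a ∈ S := by
    intro a
    have h1 : φ a = φ (trunc c a : Polynomial k) +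
        x ^ c * φ (PowerSeries.mk fun i => coeff (i + c) a) := by
      rw [← hφ, ← map_pow, ← map_mul, ← map_add]
      congr 1
      rw [add_comm]
      exact eq_X_pow_mul_shift_add_trunc c a
    rw [h1]
    refine S.add_mem ?_ (hS _ ?_)
    · have : φ (trunc c a : Polynomial k) = Polynomial.aeval x (trunc c a) :=
        PowerSeries.substAlgHom_coe _ _
      rw [this]
      exact Algebra.adjoin_le (by simpa using hx.mem) (Polynomial.aeval_mem_adjoin_singleton k x)
    · refine Dvd.dvd.mul_right ?_ _
      rw [hxu, mul_pow, ← pow_mul]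
      exact (pow_dvd_pow X (Nat.le_mul_of_pos_left c he)).mul_right _
  obtain ⟨a, ha⟩ := exists_pow_eq_sum_map_mul_pow φ he hu (hφ.trans hxu) w
  -- `V` is the `k[[x]]`-module generated by `1, …, w ^ (e - 1)`
  let V : Submodule φ.range k⟦X⟧ := Submodule.span φ.range (Set.range fun i : Fin e => w ^ (i : ℕ))
  have hφV : ∀ (b : k⟦X⟧), ∀ v ∈ V, φ b * v ∈ V := fun b v hv =>
    V.smul_mem (⟨φ b, b, rfl⟩ : φ.range) hv
  have hwV : ∀ v ∈ V, w * v ∈ V := by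
    intro v hv
    refine Submodule.span_induction ?_ (by simp) ?_ ?_ hv
    · rintro _ ⟨i, rfl⟩
      change w * w ^ (i : ℕ) ∈ V
      rw [← pow_succ']
      by_cases hi : (i : ℕ) + 1 < e
      · exact Submodule.subset_span ⟨⟨i + 1, hi⟩, rfl⟩
      · have : (i : ℕ) + 1 = e := by omega
        rw [this, ha]
        exact V.sum_mem fun j _ => hφV _ _ (Submodule.subset_span ⟨j, rfl⟩)
    · intro v v' _ _ h h'
      rw [mul_add]; exact V.add_mem h h'
    · rintro ⟨r, hr⟩ v _ h
      have : w * ((⟨r, hr⟩ : φ.range) • v) = (⟨r, hr⟩ : φ.range) • (w * v) := by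
        rw [mul_smul_comm]
      rw [this]
      exact V.smul_mem _ h
  have hadj : ∀ q ∈ Algebra.adjoin k {x, w}, ∀ v ∈ V, q * v ∈ V := by
    intro q hq
    induction hq using Algebra.adjoin_induction with
    | mem f hf =>
      rcases hf with rfl | rfl
      · intro v hv
        rw [← hφ]
        exact hφV _ v hv
      · exact hwV
    | algebraMap r =>
      intro v hv
      rw [← φ.commutes]
      exact hφV _ v hv
    | add f g _ _ hf hg =>
      intro v hv
      rw [add_mul]
      exact V.add_mem (hf v hv) (hg v hv)
    | mul f g _ _ hf hg =>
      intro v hv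
      rw [mul_assoc]
      exact hf _ (hg v hv)
  have hVS : ∀ v ∈ V, x ^ (e - 1) * v ∈ S := by
    intro v hv
    refine Submodule.span_induction ?_ (by simp) ?_ ?_ hv
    · rintro _ ⟨i, rfl⟩
      have : x ^ (e - 1) * w ^ (i : ℕ) = x ^ (e - 1 - i) * (x * w) ^ (i : ℕ) := by
        rw [mul_pow, ← mul_assoc, ← pow_add]
        congr 2
        omega
      change x ^ (e - 1) * w ^ (i : ℕ) ∈ S
      rw [this]
      exact S.mul_mem (S.pow_mem hx.mem _) (S.pow_mem hy _)
    · intro v v' _ _ h h'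
      rw [mul_add]; exact S.add_mem h h'
    · rintro ⟨_, b, rfl⟩ v _ h
      have : x ^ (e - 1) * ((⟨φ b, b, rfl⟩ : φ.range) • v) = φ b * (x ^ (e - 1) * v) := by
        change x ^ (e - 1) * (φ b * v) = _
        ring
      exact this ▸ S.mul_mem (hφS b) h
  obtain ⟨q, hq, hd⟩ := blowup_le_adicClosure hx hle hf c
  have h1 : (1 : k⟦X⟧) ∈ V := Submodule.subset_span ⟨⟨0, he⟩, by simp⟩
  have h2 := hVS _ (hadj q hq 1 h1)
  have h3 : x ^ (e - 1) * (f - q) ∈ S := hS _ (hd.mul_left _)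
  have h4 : x ^ (e - 1) * f = x ^ (e - 1) * (f - q) + x ^ (e - 1) * (q * 1) := by ring
  rw [h4]
  exact S.add_mem h3 h2

/-- The conductor exponent of a plane curve of multiplicity at most `E` grows by at most
`E (E - 1)` for each quadratic transform needed to resolve it. -/
theorem IsPlanar.conductorLE_of_iterate (i : ℕ) {E : ℕ} (hP : IsPlanar S)
    (hS : ConductorLE S c) (hx : IsParam S e x) (hE : e ≤ E)
    (h : quadraticTransform^[i] (S.map (toFrac k)) = (⊤ : Subalgebra k k⟦X⟧).map (toFrac k)) :
    ConductorLE S (i * (E * (E - 1))) := by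
  induction i generalizing S c e x with
  | zero =>
    rw [Nat.zero_mul, conductorLE_zero_iff]
    exact Subalgebra.map_injective toFrac_injective h
  | succ i ih =>
    obtain ⟨e', x', hx', y, hy, hXy, hle⟩ := hP.exists_isParam hS
    have hee : e' ≤ e := by
      obtain ⟨u, hu, hxu⟩ := hx.eq_unit_mul
      have h1 := hx'.dvd x hx.mem (by
        rw [hxu]; exact (dvd_pow_self X (by have := hx.one_le; omega)).mul_right _)
      rw [hxu] at h1
      exact (X_pow_dvd_X_pow_mul_unit hu).1 h1
    obtain ⟨u, hu, hxu⟩ := hx'.eq_unit_mul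
    obtain ⟨w, rfl⟩ : ∃ w, y = x' * w := by
      obtain ⟨g, hg⟩ := hx'.dvd y hy hXy
      obtain ⟨v, hv⟩ := hu.exists_right_inv
      exact ⟨v * g, by rw [hg, hxu]; linear_combination (-X ^ e' * g) * hv⟩
    rw [Function.iterate_succ_apply, quadraticTransform_map hS hx'] at h
    have hS1 := hS.blowup hx'
    obtain ⟨e₁, x₁, hx₁⟩ := Algebroid.exists_isParam hS1
    have he1 : e₁ ≤ e' := by
      have h1 := hx₁.dvd x' (le_blowup hx'.mem) (by
        rw [hxu]; exact (dvd_pow_self X (by have := hx'.one_le; omega)).mul_right _)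
      rw [hxu] at h1
      exact (X_pow_dvd_X_pow_mul_unit hu).1 h1
    have h2 := ih (IsPlanar.blowup hx' hy hXy hle) hS1 hx₁ (by omega) h
    intro f hf
    obtain ⟨v, hv⟩ := (hu.pow (e' - 1)).exists_right_inv
    obtain ⟨g, rfl⟩ := hf
    have h3 : e' * (e' - 1) ≤ E * (E - 1) := Nat.mul_le_mul (by omega) (by omega)
    obtain ⟨d, hd⟩ := Nat.exists_eq_add_of_le h3
    have h4 : X ^ (i * (E * (E - 1)) + d) * (v * g) ∈ Algebroid.blowup S x' := by
      refine h2 _ ?_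
      rw [pow_add, mul_assoc]
      exact dvd_mul_right _ _
    have h5 := pow_mul_mem_of_mem_blowup hS hx' hy hle h4
    convert h5 using 1
    rw [hxu, mul_pow, ← pow_mul, add_mul, one_mul, hd]
    linear_combination (-X ^ (i * (e' * (e' - 1) + d) + (e' * (e' - 1) + d)) * g) * hv

end Planar

/-! ### The multiplicity of a curve -/

section Hilbert

open PowerSeries

theorem finrank_quotient_comap_add {k M V : Type*} [Field k] [AddCommGroup M] [Module k M]
    [AddCommGroup V] [Module k V] (f : M →ₗ[k] V) (W : Submodule k V)
    [FiniteDimensional k (V ⧸ W)] :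
    Module.finrank k (M ⧸ W.comap f) + Module.finrank k (V ⧸ (W ⊔ LinearMap.range f)) =
      Module.finrank k (V ⧸ W) := by
  have h1 : LinearMap.ker (W.mkQ.comp f) = W.comap f := by
    rw [LinearMap.ker_comp, Submodule.ker_mkQ]
  have h2 : LinearMap.range (W.mkQ.comp f) = (LinearMap.range f).map W.mkQ :=
    LinearMap.range_comp _ _
  rw [← h1, (W.mkQ.comp f).quotKerEquivRange.finrank_eq, h2,
    ← (Submodule.quotientQuotientEquivQuotientSup W (LinearMap.range f)).finrank_eq, add_comm]
  exact Submodule.finrank_quotient_add_finrank _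

variable {k : Type*} [Field k] {S : Subalgebra k k⟦X⟧} {c e : ℕ} {x : k⟦X⟧}

/-- The first `n` coefficients of a power series. -/
noncomputable def firstCoeffs (k : Type*) [Field k] (n : ℕ) : k⟦X⟧ →ₗ[k] (Fin n → k) :=
  LinearMap.pi fun i => coeff (R := k) (i : ℕ)

theorem mem_ker_firstCoeffs {n : ℕ} {f : k⟦X⟧} :
    f ∈ LinearMap.ker (firstCoeffs k n) ↔ X ^ n ∣ f := by
  rw [LinearMap.mem_ker, X_pow_dvd_iff, funext_iff]
  exact ⟨fun h m hm => h ⟨m, hm⟩, fun h i => h i i.2⟩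

theorem firstCoeffs_surjective (n : ℕ) : Function.Surjective (firstCoeffs k n) := by
  intro v
  refine ⟨PowerSeries.mk fun i => if h : i < n then v ⟨i, h⟩ else 0, ?_⟩
  ext i
  simp [firstCoeffs]

theorem finrank_quotient_ker_firstCoeffs (n : ℕ) :
    Module.finrank k (k⟦X⟧ ⧸ LinearMap.ker (firstCoeffs k n)) = n := by
  rw [((firstCoeffs k n).quotKerEquivOfSurjective (firstCoeffs_surjective n)).finrank_eq]
  simp

theorem finiteDimensional_quotient {W : Submodule k k⟦X⟧} {n : ℕ}
    (h : LinearMap.ker (firstCoeffs k n) ≤ W) : FiniteDimensional k (k⟦X⟧ ⧸ W) := by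
  have : FiniteDimensional k (k⟦X⟧ ⧸ LinearMap.ker (firstCoeffs k n)) :=
    Module.Finite.equiv
      ((firstCoeffs k n).quotKerEquivOfSurjective (firstCoeffs_surjective n)).symm
  exact Module.Finite.of_surjective (Submodule.factor h) (Submodule.factor_surjective h)

theorem maxPow_le (n : ℕ) : maxPow S n ≤ Subalgebra.toSubmodule S := by
  rintro s ⟨⟨_, t, ht, rfl⟩, -, h⟩
  rw [← toFrac_injective h]
  exact ht

theorem finrank_quotient_maxIdeal_pow (n : ℕ)
    [FiniteDimensional k (k⟦X⟧ ⧸ maxPow S n)] :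
    Module.finrank k (S.map (toFrac k) ⧸ (maxIdeal (S.map (toFrac k))) ^ n) +
      Module.finrank k (k⟦X⟧ ⧸ Subalgebra.toSubmodule S) =
      Module.finrank k (k⟦X⟧ ⧸ maxPow S n) := by
  have h1 := finrank_quotient_comap_add S.val.toLinearMap (maxPow S n)
  have h2 : LinearMap.range S.val.toLinearMap = Subalgebra.toSubmodule S := by
    ext f; simp
  rw [h2, sup_eq_right.2 (maxPow_le n)] at h1
  rw [← h1]
  congr 1
  let I := (maxIdeal (S.map (toFrac k))) ^ n
  let g : S →ₗ[k] (S.map (toFrac k) ⧸ I) :=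
    (Ideal.Quotient.mkₐ k I).toLinearMap.comp
      ((S.equivMapOfInjective (toFrac k) toFrac_injective).toLinearMap)
  have hg : Function.Surjective g :=
    (Ideal.Quotient.mkₐ_surjective k I).comp
      (S.equivMapOfInjective (toFrac k) toFrac_injective).surjective
  have hk : LinearMap.ker g = (maxPow S n).comap S.val.toLinearMap := by
    ext s
    rw [LinearMap.mem_ker, Submodule.mem_comap]
    change Ideal.Quotient.mk I (S.equivMapOfInjective (toFrac k) toFrac_injective s) = 0 ↔ _
    rw [Ideal.Quotient.eq_zero_iff_mem]
    constructor
    · exact fun h => ⟨_, h, rfl⟩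
    · rintro ⟨r, hr, h⟩
      have : r = S.equivMapOfInjective (toFrac k) toFrac_injective s := Subtype.ext h
      exact this ▸ hr
  rw [← hk]
  exact ((g.quotKerEquivOfSurjective hg).finrank_eq).symm

/-- The multiplicity of a curve is the least positive order of its elements. -/
theorem curveMultiplicity_map (hS : ConductorLE S c) (hx : IsParam S e x) :
    curveMultiplicity (S.map (toFrac k)) = e := by
  obtain ⟨u, hu, hxu⟩ := hx.eq_unit_mul
  -- `V n = x ^ (-n) 𝔪 ^ n` is an increasing sequence of subspaces of finite codimension
  let V : ℕ → Submodule k k⟦X⟧ := fun n => (maxPow S n).comap (LinearMap.mulLeft k (x ^ n))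
  have hfin : ∀ n, FiniteDimensional k (k⟦X⟧ ⧸ maxPow S n) := by
    intro n
    cases n with
    | zero =>
      refine finiteDimensional_quotient (n := c) fun f hf => ?_
      rw [maxPow_zero]
      exact hS _ (mem_ker_firstCoeffs.1 hf)
    | succ n =>
      exact finiteDimensional_quotient fun f hf =>
        mem_maxPow_succ_of_dvd hS hx (mem_ker_firstCoeffs.1 hf)
  have hV : ∀ n, V n ≤ V (n + 1) := by
    intro n f hf
    change x ^ (n + 1) * f ∈ maxPow S (n + 1)
    rw [pow_succ, mul_right_comm]
    exact mul_mem_maxPow hf (hx.mem_maxPow_one hS)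
  have hfinV : ∀ n, FiniteDimensional k (k⟦X⟧ ⧸ V n) := by
    intro n
    have h0 : FiniteDimensional k (k⟦X⟧ ⧸ V 0) := by
      refine finiteDimensional_quotient (n := c) fun f hf => ?_
      change x ^ 0 * f ∈ maxPow S 0
      rw [pow_zero, one_mul, maxPow_zero]
      exact hS _ (mem_ker_firstCoeffs.1 hf)
    have h : V 0 ≤ V n := monotone_nat_of_le_succ hV (Nat.zero_le n)
    exact Module.Finite.of_surjective (Submodule.factor h) (Submodule.factor_surjective h)
  have hanti : Antitone fun n => Module.finrank k (k⟦X⟧ ⧸ V n) := by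
    refine antitone_nat_of_succ_le fun n => ?_
    exact LinearMap.finrank_le_finrank_of_surjective (Submodule.factor_surjective (hV n))
  obtain ⟨d, n₀, hd⟩ : ∃ d n₀, ∀ n ≥ n₀, Module.finrank k (k⟦X⟧ ⧸ V n) = d := by
    obtain ⟨n₀, hn₀⟩ := WellFounded.has_min (wellFounded_lt (α := ℕ))
      (Set.range fun n => Module.finrank k (k⟦X⟧ ⧸ V n)) ⟨_, 0, rfl⟩
    obtain ⟨⟨m, hm⟩, hmin⟩ := hn₀
    refine ⟨n₀, m, fun n hn => le_antisymm (hm ▸ hanti hn) ?_⟩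
    exact not_lt.1 (hmin _ ⟨n, rfl⟩)
  have hrange : ∀ n, LinearMap.range (LinearMap.mulLeft k (x ^ n)) =
      LinearMap.ker (firstCoeffs k (e * n)) := by
    intro n
    ext f
    rw [mem_ker_firstCoeffs]
    constructor
    · rintro ⟨g, rfl⟩
      exact ⟨u ^ n * g, by rw [LinearMap.mulLeft_apply, hxu]; ring⟩
    · rintro ⟨g, rfl⟩
      obtain ⟨v, hv⟩ := (hu.pow n).exists_right_inv
      refine ⟨v * g, ?_⟩
      rw [LinearMap.mulLeft_apply, hxu]
      linear_combination X ^ (e * n) * g * hv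
  have hH : ∀ n ≥ n₀, Module.finrank k (S.map (toFrac k) ⧸ (maxIdeal (S.map (toFrac k))) ^ n) +
      Module.finrank k (k⟦X⟧ ⧸ Subalgebra.toSubmodule S) = d + e * n := by
    intro n hn
    have := hfin n
    rw [finrank_quotient_maxIdeal_pow n,
      ← finrank_quotient_comap_add (LinearMap.mulLeft k (x ^ n)) (maxPow S n), hrange,
      sup_eq_right.2 (fun s hs => mem_ker_firstCoeffs.2 (dvd_of_mem_maxPow hS hx hs)),
      finrank_quotient_ker_firstCoeffs]
    congr 1
    exact hd n hn
  have hset : {e' : ℕ | ∃ q : ℤ, ∀ᶠ n : ℕ in Filter.atTop,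
      (Module.finrank k (S.map (toFrac k) ⧸ (maxIdeal (S.map (toFrac k))) ^ n) : ℤ) =
        (e' : ℤ) * n + q} = {e} := by
    ext e'
    rw [Set.mem_ofPred_eq, Set.mem_singleton_iff]
    constructor
    · rintro ⟨q, hq⟩
      obtain ⟨n₁, hn₁⟩ := Filter.eventually_atTop.1 hq
      have h1 := hn₁ (max n₀ n₁) (le_max_right _ _)
      have h2 := hn₁ (max n₀ n₁ + 1) (by omega)
      have h3 := hH (max n₀ n₁) (le_max_left _ _)
      have h4 := hH (max n₀ n₁ + 1) (by omega)
      zify at h3 h4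
      have : (e' : ℤ) = e := by push_cast at *; linarith
      exact_mod_cast this
    · rintro rfl
      refine ⟨(d : ℤ) - Module.finrank k (k⟦X⟧ ⧸ Subalgebra.toSubmodule S),
        Filter.eventually_atTop.2 ⟨n₀, fun n hn => ?_⟩⟩
      have := hH n hn
      zify at this
      linarith
  unfold curveMultiplicity
  rw [hset, csInf_singleton]

/-- The conductor exponent of a plane curve is at most `M e (e - 1)`, where `e` is its
multiplicity and `M` the number of quadratic transforms needed to resolve it. -/
theorem IsPlanar.conductorLE (hP : IsPlanar S) (hS : ConductorLE S c) :
    ConductorLE S (numTransforms (S.map (toFrac k)) *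
      (curveMultiplicity (S.map (toFrac k)) * (curveMultiplicity (S.map (toFrac k)) - 1))) := by
  obtain ⟨e, x, hx⟩ := Algebroid.exists_isParam hS
  exact hP.conductorLE_of_iterate _ hS hx (curveMultiplicity_map hS hx).ge
    (iterate_numTransforms hS)

end Hilbert

/-! ### The ring `k[[T, U]]` -/

section TwoVariables

open PowerSeries

/-- The ring of power series in `T = X 0` and `U = X 1` is `k[[T]][[U]]`. -/
theorem exists_algEquiv {k A : Type*} [Field k] [CommRing A] [Algebra k A]
    (e : MvPowerSeries (Fin 2) k ≃ₐ[k] A) :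
    ∃ θ : k⟦X⟧⟦X⟧ ≃ₐ[k] A, θ X = e (MvPowerSeries.X 1) ∧ θ (C X) = e (MvPowerSeries.X 0) := by
  let e1 : MvPowerSeries (Fin 2) k ≃ₐ[k] MvPowerSeries (Fin 2) k :=
    MvPowerSeries.renameEquiv k (Equiv.swap 0 1)
  let e2 : MvPowerSeries (Fin 2) k ≃ₐ[k] PowerSeries (MvPowerSeries (Fin 1) k) :=
    MvPowerSeries.finSuccEquiv k 1
  let e3 : MvPowerSeries (Fin 1) k ≃ₐ[k] k⟦X⟧ :=
    MvPowerSeries.renameEquiv k (Equiv.ofUnique (Fin 1) Unit)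
  have e3X : e3 (MvPowerSeries.X 0) = X := MvPowerSeries.rename_X (R := k) _ 0
  let e4 : PowerSeries (MvPowerSeries (Fin 1) k) ≃ₐ[k] k⟦X⟧⟦X⟧ :=
    AlgEquiv.ofAlgHom (PowerSeries.mapAlgHom e3.toAlgHom) (PowerSeries.mapAlgHom e3.symm.toAlgHom)
      (by
        refine AlgHom.ext fun f => PowerSeries.ext fun n => ?_
        rw [AlgHom.comp_apply, mapAlgHom_apply, mapAlgHom_apply, coeff_map, coeff_map]
        exact e3.apply_symm_apply _)
      (by
        refine AlgHom.ext fun f => PowerSeries.ext fun n => ?_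
        rw [AlgHom.comp_apply, mapAlgHom_apply, mapAlgHom_apply, coeff_map, coeff_map]
        exact e3.symm_apply_apply _)
  have e4ap : ∀ f, e4 f = f.map (e3.toAlgHom : MvPowerSeries (Fin 1) k →+* k⟦X⟧) := fun f => rfl
  have h1 : ((e1.trans e2).trans e4) (MvPowerSeries.X 1) = X := by
    have : e1 (MvPowerSeries.X 1) = MvPowerSeries.X 0 := by
      simp [e1]
    rw [AlgEquiv.trans_apply, AlgEquiv.trans_apply, this, e4ap,
      show e2 (MvPowerSeries.X 0) = X from MvPowerSeries.finSuccEquiv_X_zero, map_X]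
  have h0 : ((e1.trans e2).trans e4) (MvPowerSeries.X 0) = C X := by
    have : e1 (MvPowerSeries.X 0) = MvPowerSeries.X 1 := by
      simp [e1]
    rw [AlgEquiv.trans_apply, AlgEquiv.trans_apply, this, e4ap,
      show e2 (MvPowerSeries.X 1) = C (MvPowerSeries.X 0) from
        MvPowerSeries.finSuccEquiv_X_succ 0, map_C]
    exact congrArg _ e3X
  refine ⟨((e1.trans e2).trans e4).symm.trans e, ?_, ?_⟩
  · rw [← h1]; simp
  · rw [← h0]; simp

variable {k A : Type*} [Field k] [CommRing A] [Algebra k A]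

theorem isDomain_of_equiv (θ : k⟦X⟧⟦X⟧ ≃ₐ[k] A) : IsDomain A :=
  θ.symm.toMulEquiv.isDomain _

theorem isLocalRing_of_equiv (θ : k⟦X⟧⟦X⟧ ≃ₐ[k] A) : IsLocalRing A :=
  θ.toRingEquiv.isLocalRing

theorem isNoetherianRing_of_equiv (θ : k⟦X⟧⟦X⟧ ≃ₐ[k] A) : IsNoetherianRing A :=
  isNoetherianRing_of_ringEquiv _ θ.toRingEquiv

theorem ufd_of_equiv (θ : k⟦X⟧⟦X⟧ ≃ₐ[k] A) [IsDomain A] : UniqueFactorizationMonoid A :=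
  θ.toMulEquiv.uniqueFactorizationMonoid inferInstance

theorem exists_eq_add_mul_add_mul (θ : k⟦X⟧⟦X⟧ ≃ₐ[k] A) (a : A) :
    ∃ (r : k) (a₁ a₂ : A), a = algebraMap k A r + θ (C X) * a₁ + θ X * a₂ := by
  have h : ∀ f : k⟦X⟧⟦X⟧, ∃ (r : k) (g : k⟦X⟧) (h : k⟦X⟧⟦X⟧),
      f = algebraMap k _ r + C X * C g + X * h := by
    intro f
    refine ⟨constantCoeff (constantCoeff f),
      PowerSeries.mk fun p => coeff (p + 1) (constantCoeff f),
      PowerSeries.mk fun p => coeff (p + 1) f, ?_⟩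
    have h1 := f.eq_X_mul_shift_add_const
    have h2 := (constantCoeff f).eq_X_mul_shift_add_const
    have h3 : algebraMap k k⟦X⟧⟦X⟧ (constantCoeff (constantCoeff f)) =
      C (C (constantCoeff (constantCoeff f))) := by
      rw [PowerSeries.algebraMap_apply, PowerSeries.algebraMap_apply]; rfl
    rw [h3]
    have h4 := congrArg (C (R := k⟦X⟧)) h2
    rw [map_add, map_mul] at h4
    linear_combination h1 + h4
  obtain ⟨r, g, h, hf⟩ := h (θ.symm a)
  refine ⟨r, θ (C g), θ h, ?_⟩
  rw [← θ.commutes, ← map_mul θ, ← map_mul θ, ← map_add θ, ← map_add θ, ← hf, θ.apply_symm_apply]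

theorem maximalIdeal_eq_span (θ : k⟦X⟧⟦X⟧ ≃ₐ[k] A) [IsLocalRing A] :
    IsLocalRing.maximalIdeal A = Ideal.span {θ (C X), θ X} := by
  have hT : θ (C X) ∈ IsLocalRing.maximalIdeal A := by
    rw [IsLocalRing.mem_maximalIdeal, mem_nonunits_iff, MulEquiv.isUnit_map θ]
    intro h
    have := (h.map (constantCoeff (R := k⟦X⟧))).map (constantCoeff (R := k))
    simp at this
  have hU : θ X ∈ IsLocalRing.maximalIdeal A := by
    rw [IsLocalRing.mem_maximalIdeal, mem_nonunits_iff, MulEquiv.isUnit_map θ]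
    exact X_prime.not_isUnit
  apply le_antisymm
  · intro a ha
    obtain ⟨r, a₁, a₂, rfl⟩ := exists_eq_add_mul_add_mul θ a
    rw [Ideal.mem_span_pair]
    have h1 : algebraMap k A r ∈ IsLocalRing.maximalIdeal A := by
      have := Ideal.sub_mem _ (Ideal.sub_mem _ ha (Ideal.mul_mem_right a₁ _ hT))
        (Ideal.mul_mem_right a₂ _ hU)
      convert this using 1
      ring
    have h2 : r = 0 := by
      by_contra hr
      exact (IsLocalRing.mem_maximalIdeal _).1 h1 ((isUnit_iff_ne_zero.2 hr).map _)
    exact ⟨a₁, a₂, by rw [h2, map_zero]; ring⟩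
  · rw [Ideal.span_le]
    rintro _ (rfl | rfl)
    · exact hT
    · exact hU

/-- Every non-maximal prime ideal of `k[[X, Y]]` is principal. -/
theorem exists_eq_span_singleton (θ : k⟦X⟧⟦X⟧ ≃ₐ[k] A) [IsLocalRing A] (P : Ideal A)
    [hP : P.IsPrime] (hne : P ≠ IsLocalRing.maximalIdeal A) : ∃ g, P = Ideal.span {g} := by
  let Q : Ideal k⟦X⟧⟦X⟧ := P.comap θ
  have hPQ : P = Q.map θ := by
    rw [Ideal.map_comap_of_surjective θ θ.surjective]
  suffices ∃ g, Q = Ideal.span {g} by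
    obtain ⟨g, hg⟩ := this
    exact ⟨θ g, by rw [hPQ, hg, Ideal.map_span, Set.image_singleton]⟩
  have hQ : Q.IsPrime := Ideal.comap_isPrime _ _
  by_cases hX : X ∈ Q
  · refine ⟨X, le_antisymm (fun f hf => ?_) ((Ideal.span_singleton_le_iff_mem _).2 hX)⟩
    by_contra hfX
    rw [Ideal.mem_span_singleton] at hfX
    -- `f` is congruent modulo `X` to `Y ^ n` times a unit, so `Y` lies in `Q`
    have h0 : constantCoeff f ≠ 0 := by rwa [X_dvd_iff] at hfX
    obtain ⟨n, u, hu, hfu⟩ := exists_eq_X_pow_mul_unit h0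
    have h1 : C (constantCoeff f) ∈ Q := by
      have h2 := f.eq_X_mul_shift_add_const
      have h3 : C (constantCoeff f) = f - X * PowerSeries.mk fun p => coeff (p + 1) f := by
        linear_combination (-1 : k⟦X⟧⟦X⟧) * h2
      rw [h3]
      exact Q.sub_mem hf (Q.mul_mem_right _ hX)
    rw [hfu, map_mul, map_pow] at h1
    have h2 : C X ∈ Q := by
      rcases hQ.mem_or_mem h1 with h | h
      · exact hQ.mem_of_pow_mem _ h
      · exact (hQ.ne_top (Ideal.eq_top_of_isUnit_mem _ h (hu.map _))).elim
    apply hne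
    have hle : IsLocalRing.maximalIdeal A ≤ P := by
      rw [maximalIdeal_eq_span θ, Ideal.span_le]
      rintro _ (rfl | rfl)
      · exact h2
      · exact hX
    exact le_antisymm (IsLocalRing.le_maximalIdeal hP.ne_top) hle
  · obtain ⟨g, h⟩ := (IsPrincipalIdealRing.principal (Q.map (constantCoeff (R := k⟦X⟧)))).principal
    obtain ⟨s, hs, -, hc⟩ := exist_eq_span_eq_ncard_of_X_notMem hX h.symm (Set.finite_singleton _)
    simp only [Set.ncard_singleton, Set.ncard_eq_one] at hc
    obtain ⟨a, rfl⟩ := hc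
    exact ⟨a, hs⟩

end TwoVariables

/-! ### Curves of arcs -/

section Arcs

open PowerSeries

variable {k A : Type*} [Field k] [CommRing A] [Algebra k A]

theorem Arc.curve_eq (C : Arc k A) : C.curve = C.hom.range.map (toFrac k) :=
  AlgHom.range_comp _ _

theorem Arc.X_dvd_of_mem_maximalIdeal [IsLocalRing A] (C : Arc k A) {a : A}
    (ha : a ∈ IsLocalRing.maximalIdeal A) : X ∣ C.hom a := by
  rw [← IsLocalRing.eq_maximalIdeal C.closed, Ideal.mem_comap, maximalIdeal_eq_span_X,
    Ideal.mem_span_singleton] at ha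
  exact ha

theorem Arc.exists_ne_zero [IsLocalRing A] (C : Arc k A) :
    ∃ a ∈ IsLocalRing.maximalIdeal A, C.hom a ≠ 0 := by
  by_contra! h
  refine C.nonconstant (le_antisymm ?_ ?_)
  · intro a ha
    rw [Ideal.mem_comap, (RingHom.mem_ker).1 ha]
    exact Ideal.zero_mem _
  · rw [IsLocalRing.eq_maximalIdeal C.closed]
    exact fun a ha => h a ha

/-- Substitution of an element `a` of the maximal ideal of `k[[T, U]]` into power series. -/
theorem exists_subst {A : Type*} [CommRing A] [Algebra k A] [IsLocalRing A]
    (e : MvPowerSeries (Fin 2) k ≃ₐ[k] A) {a : A} (ha : a ∈ IsLocalRing.maximalIdeal A) :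
    ∃ ψ : k⟦X⟧ →ₐ[k] A, ψ X = a := by
  have h0 : MvPowerSeries.constantCoeff (e.symm a) = 0 := by
    by_contra h
    have h1 : IsUnit (e.symm a) := MvPowerSeries.isUnit_iff_constantCoeff.2 (isUnit_iff_ne_zero.2 h)
    exact (IsLocalRing.mem_maximalIdeal _).1 ha (by simpa using h1.map e)
  refine ⟨e.toAlgHom.comp (PowerSeries.substAlgHom (HasSubst.of_constantCoeff_zero h0)), ?_⟩
  rw [AlgHom.comp_apply, PowerSeries.substAlgHom_X]
  exact e.apply_symm_apply a

/-- The curve of a primitive arc has a nonzero conductor. -/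
theorem Arc.IsPrimitive.exists_conductorLE [IsLocalRing A] {C : Arc k A} (hC : C.IsPrimitive)
    (e : MvPowerSeries (Fin 2) k ≃ₐ[k] A) : ∃ c, ConductorLE C.hom.range c := by
  obtain ⟨a, ha, ha0⟩ := C.exists_ne_zero
  obtain ⟨ψ, hψ⟩ := exists_subst e ha
  obtain ⟨n, u, hu, hau⟩ := exists_eq_X_pow_mul_unit ha0
  have hn : 1 ≤ n := by
    by_contra h
    obtain rfl : n = 0 := by omega
    have h1 := C.X_dvd_of_mem_maximalIdeal ha
    rw [hau, pow_zero, one_mul] at h1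
    exact X_irreducible.not_isUnit (isUnit_of_dvd_unit h1 hu)
  let φ : k⟦X⟧ →ₐ[k] k⟦X⟧ := C.hom.comp ψ
  have hφ : φ X = X ^ n * u := by rw [AlgHom.comp_apply, hψ, hau]
  have hfrac : ∀ f : k⟦X⟧, f ≠ 0 → ∃ s ∈ C.hom.range, s ≠ 0 ∧ s * f ∈ C.hom.range := by
    intro f hf
    have h1 : toFrac k f ∈ IntermediateField.adjoin k (C.curve : Set (FractionRing k⟦X⟧)) := by
      have : IntermediateField.adjoin k (C.curve : Set (FractionRing k⟦X⟧)) = ⊤ :=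
        IntermediateField.finrank_eq_one_iff_eq_top.1 hC
      rw [this]; exact IntermediateField.mem_top
    rw [IntermediateField.mem_adjoin_iff_div, Algebra.adjoin_eq, C.curve_eq] at h1
    obtain ⟨_, ⟨r, hr, rfl⟩, _, ⟨s, hs, rfl⟩, h⟩ := h1
    have hs0 : s ≠ 0 := by
      rintro rfl
      have : toFrac k f = 0 := by rw [h]; simp
      exact hf (toFrac_injective (this.trans (map_zero _).symm))
    refine ⟨s, hs, hs0, ?_⟩
    have h2 : s * f = r := by
      apply toFrac_injective
      have h3 : toFrac k s ≠ 0 := by rwa [Ne, map_eq_zero_iff _ toFrac_injective]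
      rw [map_mul, h]
      exact mul_div_cancel₀ _ h3
    rw [h2]
    exact hr
  -- `k[[X]]` is generated by `1, …, X ^ (n - 1)` over the image of `k[[a]]`, so a common
  -- denominator of these powers lies in the conductor
  choose s hs hs0 hsX using fun i : Fin n => hfrac (X ^ (i : ℕ)) (pow_ne_zero _ X_ne_zero)
  obtain ⟨c, v, hv, hcv⟩ := exists_eq_X_pow_mul_unit (Finset.prod_ne_zero_iff.2 fun i _ => hs0 i :
    ∏ i, s i ≠ 0)
  obtain ⟨v', hv'⟩ := hv.exists_right_inv
  refine ⟨c, ?_⟩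
  rintro _ ⟨g, rfl⟩
  obtain ⟨q, hq⟩ := exists_eq_sum_map_mul_X_pow φ hn hu hφ (v' * g)
  have h1 : X ^ c * g = ∑ i, φ (q i) * ((∏ j, s j) * X ^ (i : ℕ)) := by
    have h2 : X ^ c * g = (∏ j, s j) * (v' * g) := by
      rw [hcv]; linear_combination (-X ^ c * g) * hv'
    rw [h2, hq, Finset.mul_sum]
    exact Finset.sum_congr rfl fun i _ => by ring
  rw [h1]
  refine Subalgebra.sum_mem _ fun i _ => Subalgebra.mul_mem _ ⟨ψ (q i), rfl⟩ ?_
  classical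
  rw [← Finset.mul_prod_erase _ _ (Finset.mem_univ i), mul_right_comm]
  exact Subalgebra.mul_mem _ (hsX i) (Subalgebra.prod_mem _ fun j _ => hs j)

/-- The images of `T` and `U` generate the curve of an arc topologically. -/
theorem Arc.isPlanar [IsLocalRing A] (C : Arc k A) (θ : k⟦X⟧⟦X⟧ ≃ₐ[k] A) :
    IsPlanar C.hom.range := by
  have hmem : ∀ y ∈ ({θ (PowerSeries.C X), θ X} : Set A), X ∣ C.hom y := fun y hy =>
    C.X_dvd_of_mem_maximalIdeal (by
      rw [maximalIdeal_eq_span θ]; exact Ideal.subset_span hy)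
  refine ⟨_, ⟨θ (PowerSeries.C X), rfl⟩, _, ⟨θ X, rfl⟩, hmem _ (by simp), hmem _ (by simp), ?_⟩
  rintro _ ⟨a, rfl⟩ n
  induction n generalizing a with
  | zero => exact ⟨0, Subalgebra.zero_mem _, by simp⟩
  | succ n ih =>
    obtain ⟨r, a₁, a₂, rfl⟩ := exists_eq_add_mul_add_mul θ a
    obtain ⟨q₁, hq₁, g₁, hg₁⟩ := ih a₁
    obtain ⟨q₂, hq₂, g₂, hg₂⟩ := ih a₂
    obtain ⟨x, hx⟩ := hmem (θ (PowerSeries.C X)) (by simp)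
    obtain ⟨y, hy⟩ := hmem (θ X) (by simp)
    refine ⟨algebraMap k _ r + C.hom (θ (PowerSeries.C X)) * q₁ + C.hom (θ X) * q₂, ?_,
      x * g₁ + y * g₂, ?_⟩
    · refine Subalgebra.add_mem _ (Subalgebra.add_mem _ (Subalgebra.algebraMap_mem _ _)
        (Subalgebra.mul_mem _ (Algebra.subset_adjoin (by simp)) hq₁))
        (Subalgebra.mul_mem _ (Algebra.subset_adjoin (by simp)) hq₂)
    · change C.hom (algebraMap k A r + θ (PowerSeries.C X) * a₁ + θ X * a₂) - _ = _
      change C.hom a₁ - q₁ = _ at hg₁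
      change C.hom a₂ - q₂ = _ at hg₂
      rw [map_add, map_add, map_mul, map_mul, AlgHom.commutes]
      linear_combination C.hom (θ (PowerSeries.C X)) * hg₁ + C.hom (θ X) * hg₂ +
        X ^ n * g₁ * hx + X ^ n * g₂ * hy

/-- The conductor exponent of the curve of a primitive arc on `Spec k[[T, U]]` is at most
`M E (E - 1)`. -/
theorem Arc.IsPrimitive.conductorLE [IsLocalRing A] {C : Arc k A} (hC : C.IsPrimitive)
    (e : MvPowerSeries (Fin 2) k ≃ₐ[k] A) : ConductorLE C.hom.range (C.M * (C.E * (C.E - 1))) := by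
  obtain ⟨c, hc⟩ := hC.exists_conductorLE e
  obtain ⟨θ, -, -⟩ := exists_algEquiv e
  have h1 := (C.isPlanar θ).conductorLE hc
  rw [← C.curve_eq] at h1
  have h2 : C.E = curveMultiplicity C.curve := by
    rw [Arc.E, show C.degree = 1 from hC, mul_one]
  rw [h2]
  exact h1

theorem Arc.IsPrimitive.one_le_E [IsLocalRing A] {C : Arc k A} (hC : C.IsPrimitive)
    (e : MvPowerSeries (Fin 2) k ≃ₐ[k] A) : 1 ≤ C.E := by
  obtain ⟨c, hc⟩ := hC.exists_conductorLE e
  obtain ⟨n, x, hx⟩ := Algebroid.exists_isParam hc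
  rw [Arc.E, show C.degree = 1 from hC, mul_one, C.curve_eq, curveMultiplicity_map hc hx]
  exact hx.one_le

end Arcs

/-! ### `k[[T₁, U]]` as a module over `k[[T, U]]` -/

section Generators

open PowerSeries

variable {k A A₁ : Type*} [Field k] [CommRing A] [Algebra k A] [CommRing A₁] [Algebra k A₁]
  [Algebra A A₁] {p : ℕ}

/-- Reduction modulo `U` of the element `T ∈ k[[T₁, U]]`. -/
theorem exists_constantCoeff_eq (θ : k⟦X⟧⟦X⟧ ≃ₐ[k] A) (θ₁ : k⟦X⟧⟦X⟧ ≃ₐ[k] A₁)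
    (hT : algebraMap A A₁ (θ (C X)) - θ₁ (C X) ^ p ∈
      Ideal.span {θ₁ (C X) ^ (p + 1), θ₁ (C X) * θ₁ X}) :
    ∃ u : k⟦X⟧, IsUnit u ∧
      constantCoeff (θ₁.symm (algebraMap A A₁ (θ (C X)))) = X ^ p * u := by
  obtain ⟨a, b, h⟩ := Ideal.mem_span_pair.1 hT
  refine ⟨1 + X * constantCoeff (θ₁.symm a), ?_, ?_⟩
  · rw [PowerSeries.isUnit_iff_constantCoeff]
    simp
  · have h1 : algebraMap A A₁ (θ (C X)) = θ₁ (C X) ^ p + a * θ₁ (C X) ^ (p + 1) +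
        b * (θ₁ (C X) * θ₁ X) := by linear_combination -h
    rw [h1]
    simp only [map_add, map_mul, map_pow, AlgEquiv.symm_apply_apply, constantCoeff_X,
      constantCoeff_C]
    ring

/-- `k[[T₁, U]]` is generated by `1, T₁, …, T₁ ^ (p - 1)` as a module over `k[[T, U]]`. -/
theorem exists_eq_sum_algebraMap_mul_pow [IsScalarTower k A A₁] (θ : k⟦X⟧⟦X⟧ ≃ₐ[k] A)
    (θ₁ : k⟦X⟧⟦X⟧ ≃ₐ[k] A₁)
    (hp : 1 ≤ p) (hU : algebraMap A A₁ (θ X) = θ₁ X)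
    (hT : algebraMap A A₁ (θ (C X)) - θ₁ (C X) ^ p ∈
      Ideal.span {θ₁ (C X) ^ (p + 1), θ₁ (C X) * θ₁ X}) (y : A₁) :
    ∃ q : Fin p → A, y = ∑ i, algebraMap A A₁ (q i) * θ₁ (C X) ^ (i : ℕ) := by
  obtain ⟨u, hu, hTu⟩ := exists_constantCoeff_eq θ θ₁ hT
  let α : k⟦X⟧⟦X⟧ →+* A₁ := (algebraMap A A₁).comp (θ : k⟦X⟧⟦X⟧ →+* A)
  have hα : ∀ f, α f = algebraMap A A₁ (θ f) := fun f => rfl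
  let φ : k⟦X⟧ →ₐ[k] k⟦X⟧ :=
    { ((constantCoeff (R := k⟦X⟧)).comp (θ₁.symm : A₁ →+* k⟦X⟧⟦X⟧)).comp (α.comp C) with
      commutes' := fun r => by
        change constantCoeff (θ₁.symm (algebraMap A A₁ (θ (C (algebraMap k k⟦X⟧ r))))) = _
        rw [← PowerSeries.algebraMap_apply, θ.commutes, ← IsScalarTower.algebraMap_apply,
          θ₁.symm.commutes, PowerSeries.algebraMap_apply, constantCoeff_C] }
  have hφ : ∀ f, φ f = constantCoeff (θ₁.symm (α (C f))) := fun f => rfl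
  suffices h : ∃ q : Fin p → k⟦X⟧⟦X⟧, y = ∑ i, α (q i) * θ₁ (C X) ^ (i : ℕ) by
    obtain ⟨q, hq⟩ := h
    exact ⟨fun i => θ (q i), hq⟩
  refine exists_eq_sum_of_mod_X α (fun i : Fin p => θ₁ (C X) ^ (i : ℕ)) ?_ ?_ y
  · intro b hb
    have h1 : θ₁.symm b = 0 := by
      ext1 n
      obtain ⟨c, hc⟩ := hb (n + 1)
      have h2 : θ₁.symm b = X ^ (n + 1) * θ₁.symm c := by
        rw [hc, map_mul, map_pow, hα, hU, θ₁.symm_apply_apply]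
      exact X_pow_dvd_iff.1 ⟨_, h2⟩ n (Nat.lt_succ_self n)
    simpa using h1
  · intro b
    obtain ⟨r, hr⟩ := exists_eq_sum_map_mul_X_pow φ hp hu hTu (constantCoeff (θ₁.symm b))
    have h1 : X ∣ θ₁.symm (b - ∑ i, α (C (r i)) * θ₁ (C X) ^ (i : ℕ)) := by
      rw [X_dvd_iff, map_sub, map_sub, sub_eq_zero, hr, map_sum, map_sum]
      refine Finset.sum_congr rfl fun i _ => ?_
      rw [map_mul, map_mul, map_pow, map_pow, θ₁.symm_apply_apply, constantCoeff_C, hφ]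
    obtain ⟨g, hg⟩ := h1
    refine ⟨r, θ₁ g, ?_⟩
    have h2 := congrArg θ₁ hg
    rw [θ₁.apply_symm_apply, map_mul] at h2
    rw [hα X, hU, ← h2]
    ring

/-- `T₁` does not belong to `k[[T, U]]`. -/
theorem not_mem_range_algebraMap [IsScalarTower k A A₁] (θ : k⟦X⟧⟦X⟧ ≃ₐ[k] A)
    (θ₁ : k⟦X⟧⟦X⟧ ≃ₐ[k] A₁)
    (hp : 2 ≤ p) (hU : algebraMap A A₁ (θ X) = θ₁ X)
    (hT : algebraMap A A₁ (θ (C X)) - θ₁ (C X) ^ p ∈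
      Ideal.span {θ₁ (C X) ^ (p + 1), θ₁ (C X) * θ₁ X}) :
    θ₁ (C X) ∉ Set.range (algebraMap A A₁) := by
  rintro ⟨a, ha⟩
  obtain ⟨u, hu, hTu⟩ := exists_constantCoeff_eq θ θ₁ hT
  obtain ⟨r, a₁, a₂, rfl⟩ := exists_eq_add_mul_add_mul θ a
  have h1 := congrArg (fun y => constantCoeff (θ₁.symm y)) ha
  simp only [map_add, map_mul, θ₁.symm_apply_apply, constantCoeff_C] at h1
  rw [hTu, hU, θ₁.symm_apply_apply, constantCoeff_X, zero_mul, add_zero,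
    ← IsScalarTower.algebraMap_apply, θ₁.symm.commutes, PowerSeries.algebraMap_apply,
    constantCoeff_C] at h1
  have h2 : algebraMap k k⟦X⟧ r = 0 := by
    apply algebraMap_eq_zero_of_X_dvd
    have : algebraMap k k⟦X⟧ r =
        X - X ^ p * u * constantCoeff (θ₁.symm (algebraMap A A₁ a₁)) := by
      linear_combination h1
    rw [this]
    refine dvd_sub dvd_rfl ?_
    rw [mul_assoc]
    exact (dvd_pow_self X (by omega)).mul_right _
  rw [h2, zero_add] at h1
  have h3 : (X : k⟦X⟧) ^ 2 ∣ (X : k⟦X⟧) ^ 1 * 1 := by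
    have h4 := (pow_dvd_pow (X : k⟦X⟧) hp).mul_right
      (u * constantCoeff (θ₁.symm (algebraMap A A₁ a₁)))
    rw [← mul_assoc, h1] at h4
    simpa using h4
  have := (X_pow_dvd_X_pow_mul_unit (k := k) isUnit_one).1 h3
  omega

end Generators

/-! ### Cyclic actions on monogenic extensions -/

section CyclicAction

variable {A B : Type*} [CommRing A] [CommRing B] [Algebra A B]

/-- If `b` generates `B` over `A`, then `s b - b` generates the ideal of all `s y - y`. -/
theorem dvd_sub_of_generators {n : ℕ} {b : B}
    (hgen : ∀ y : B, ∃ q : Fin n → A, y = ∑ i, algebraMap A B (q i) * b ^ (i : ℕ))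
    (s : B ≃ₐ[A] B) (y : B) : s b - b ∣ s y - y := by
  obtain ⟨q, rfl⟩ := hgen y
  rw [map_sum, ← Finset.sum_sub_distrib]
  refine Finset.dvd_sum fun i _ => ?_
  rw [map_mul, AlgEquiv.commutes, map_pow, ← mul_sub]
  exact (sub_dvd_pow_sub_pow _ _ _).mul_left _

theorem dvd_pow_apply_sub {s : B ≃ₐ[A] B} {d : B} (h : ∀ y, d ∣ s y - y) (n : ℕ) (y : B) :
    d ∣ (s ^ n) y - y := by
  induction n with
  | zero => simp
  | succ n ih =>
    have : (s ^ (n + 1)) y - y = (s ((s ^ n) y) - (s ^ n) y) + ((s ^ n) y - y) := by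
      rw [pow_succ', AlgEquiv.mul_apply]; ring
    rw [this]
    exact dvd_add (h _) ih

/-- All `σ ^ i b - b` with `0 < i < p` divide `σ b - b`. -/
theorem pow_apply_sub_dvd {p n : ℕ} (hp : p.Prime) {b : B}
    (hgen : ∀ y : B, ∃ q : Fin n → A, y = ∑ i, algebraMap A B (q i) * b ^ (i : ℕ))
    {σ : B ≃ₐ[A] B} (hσ : σ ^ p = 1) {i : ℕ} (h0 : i ≠ 0) (hi : i < p) :
    (σ ^ i) b - b ∣ σ b - b := by
  have hcop : Nat.Coprime i p :=
    Nat.Coprime.symm (Nat.coprime_of_lt_prime h0 hi hp)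
  obtain ⟨j, hj⟩ := Nat.exists_mul_mod_eq_one_of_coprime hcop hp.one_lt
  have h1 : (σ ^ i) ^ j = σ := by
    rw [← pow_mul]
    nth_rewrite 2 [← pow_one σ]
    rw [← Nat.div_add_mod (i * j) p, hj.2, pow_add, pow_mul, hσ, one_pow, one_mul]
  have := dvd_pow_apply_sub (dvd_sub_of_generators hgen (σ ^ i)) j b
  rwa [h1] at this

open Polynomial in
/-- The polynomial `∏ (Z - σ ^ i b)` has coefficients in `A`, and its derivative at `b` divides
`(σ b - b) ^ (p - 1)`. -/
theorem exists_monic_polynomial [IsDomain B] {p n : ℕ} (hp : p.Prime) {b : B}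
    (hgen : ∀ y : B, ∃ q : Fin n → A, y = ∑ i, algebraMap A B (q i) * b ^ (i : ℕ))
    {σ : B ≃ₐ[A] B} (hσ : σ ^ p = 1)
    (hfix : ∀ y : B, σ y = y → y ∈ Set.range (algebraMap A B)) [Nontrivial A] :
    ∃ h : A[X], h.Monic ∧ h.natDegree = p ∧ aeval b h = 0 ∧
      aeval b (derivative h) ∣ (σ b - b) ^ (p - 1) := by
  let F : ℕ → B[X] := fun i => X - C ((σ ^ i) b)
  let H : B[X] := ∏ i ∈ Finset.range p, F i
  have hHm : H.Monic := monic_prod_of_monic _ _ fun i _ => monic_X_sub_C _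
  have hfixH : H.map (σ : B →+* B) = H := by
    have h1 : H.map (σ : B →+* B) = ∏ i ∈ Finset.range p, F (i + 1) := by
      rw [Polynomial.map_prod]
      refine Finset.prod_congr rfl fun i _ => ?_
      rw [Polynomial.map_sub, map_X, map_C]
      change X - C (σ ((σ ^ i) b)) = X - C ((σ ^ (i + 1)) b)
      rw [pow_succ', AlgEquiv.mul_apply]
    have h2 : (∏ i ∈ Finset.range p, F (i + 1)) * F 0 = H * F p := by
      rw [← Finset.prod_range_succ', Finset.prod_range_succ]
    have h3 : F p = F 0 := by
      change X - C ((σ ^ p) b) = X - C ((σ ^ 0) b)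
      rw [hσ, pow_zero]
    rw [h3] at h2
    rw [h1]
    exact mul_right_cancel₀ (monic_X_sub_C _).ne_zero h2
  have hl : H ∈ Polynomial.lifts (algebraMap A B) := by
    rw [Polynomial.lifts_iff_coeff_lifts]
    intro i
    apply hfix
    nth_rewrite 2 [← hfixH]
    rw [coeff_map]
    rfl
  obtain ⟨h, hh, hdeg, hm⟩ := Polynomial.lifts_and_natDegree_eq_and_monic hl hHm
  have hHdeg : H.natDegree = p := by
    rw [natDegree_prod_of_monic _ _ fun i _ => monic_X_sub_C _]
    simp [F]
  have hsplit : H = (X - C b) * ∏ i ∈ Finset.range (p - 1), F (i + 1) := by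
    have : H = ∏ i ∈ Finset.range (p - 1 + 1), F i := by
      rw [Nat.sub_add_cancel hp.one_le]
    rw [this, Finset.prod_range_succ', mul_comm]
    rfl
  refine ⟨h, hm, by rw [← hHdeg, hdeg], ?_, ?_⟩
  · rw [← eval_map_algebraMap, hh, hsplit]
    simp
  · rw [← eval_map_algebraMap, ← derivative_map, hh, hsplit, derivative_mul]
    simp only [derivative_sub, derivative_X, derivative_C, sub_zero, one_mul, eval_add, eval_mul,
      eval_sub, eval_X, eval_C, sub_self, zero_mul, add_zero, eval_prod]
    have hcard : (σ b - b) ^ (p - 1) = ∏ _i ∈ Finset.range (p - 1), (σ b - b) := by simp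
    rw [hcard]
    refine Finset.prod_dvd_prod_of_dvd _ _ fun i hi => ?_
    have hlt := Finset.mem_range.1 hi
    have := pow_apply_sub_dvd hp hgen hσ (Nat.succ_ne_zero i) (by omega)
    simp only [F, eval_sub, eval_X, eval_C]
    rw [← neg_sub, neg_dvd]
    exact this

/-- Divisibility in the ring of invariants can be tested upstairs. -/
theorem dvd_of_algebraMap_dvd [IsDomain B] (hinj : Function.Injective (algebraMap A B))
    {σ : B ≃ₐ[A] B} (hfix : ∀ y : B, σ y = y → y ∈ Set.range (algebraMap A B)) {r s : A}
    (h : algebraMap A B r ∣ algebraMap A B s) : r ∣ s := by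
  obtain ⟨y, hy⟩ := h
  by_cases hr : r = 0
  · rw [hr, map_zero, zero_mul, ← map_zero (algebraMap A B)] at hy
    rw [hinj hy]; exact dvd_zero _
  · have h1 : σ y = y := by
      have h2 := congrArg σ hy
      rw [map_mul, AlgEquiv.commutes, AlgEquiv.commutes, hy] at h2
      have h0 : algebraMap A B r ≠ 0 := by rwa [Ne, map_eq_zero_iff _ hinj]
      exact (mul_left_cancel₀ h0 h2).symm
    obtain ⟨a, rfl⟩ := hfix y h1
    exact ⟨a, hinj (by rw [hy, map_mul])⟩

/-- A prime element `π` that divides all `σ y - y` lies over a principal prime `(t)` of `A`, and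
`t` is associated to a power `π ^ e` with `1 ≤ e ≤ p`. -/
theorem exists_prime_comap [IsDomain A] [UniqueFactorizationMonoid A] [IsDomain B]
    (hinj : Function.Injective (algebraMap A B)) {p : ℕ} {σ : B ≃ₐ[A] B} (hσ : σ ^ p = 1)
    (hp : 1 ≤ p) (hfix : ∀ y : B, σ y = y → y ∈ Set.range (algebraMap A B)) {π : B} (hπ : Prime π)
    (hd : ∀ y, π ∣ σ y - y) :
    ∃ (t : A) (e : ℕ), Prime t ∧ 1 ≤ e ∧ e ≤ p ∧ Associated (algebraMap A B t) (π ^ e) ∧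
      (Ideal.span {π}).comap (algebraMap A B) = Ideal.span {t} := by
  have hass : ∀ i : ℕ, Associated ((σ ^ i) π) π := fun i => by
    have h1 : π ∣ (σ ^ i) π := by
      have := dvd_add (dvd_pow_apply_sub hd i π) (dvd_refl π)
      simpa using this
    have h2 : Prime ((σ ^ i) π) := (MulEquiv.prime_iff (σ ^ i)).2 hπ
    exact (hπ.associated_of_dvd h2 h1).symm
  -- the norm of `π` is an element of `A` divisible by `π`
  let N : B := ∏ i ∈ Finset.range p, (σ ^ i) π
  have hN : Associated N (π ^ p) := by
    have : π ^ p = ∏ _i ∈ Finset.range p, π := by simp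
    rw [this]
    exact Associated.prod _ _ _ fun i _ => hass i
  have hNfix : σ N = N := by
    have h1 : σ N = ∏ i ∈ Finset.range p, (σ ^ (i + 1)) π := by
      rw [map_prod]
      refine Finset.prod_congr rfl fun i _ => ?_
      rw [pow_succ', AlgEquiv.mul_apply]
    have h2 : (∏ i ∈ Finset.range p, (σ ^ (i + 1)) π) * (σ ^ 0) π = N * (σ ^ p) π := by
      rw [← Finset.prod_range_succ' (fun i => (σ ^ i) π),
        Finset.prod_range_succ (fun i => (σ ^ i) π)]
    rw [hσ, pow_zero] at h2
    rw [h1]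
    exact mul_right_cancel₀ (by simpa using hπ.ne_zero) h2
  obtain ⟨n, hn⟩ := hfix N hNfix
  have hn0 : n ≠ 0 := by
    rintro rfl
    rw [map_zero] at hn
    exact pow_ne_zero p hπ.ne_zero ((hn ▸ hN).eq_zero_iff.1 rfl)
  have hπn : π ∣ algebraMap A B n := by
    rw [hn]
    exact (dvd_pow_self π (by omega)).trans hN.symm.dvd
  have hprime : ∀ m : A, m ≠ 0 → π ∣ algebraMap A B m →
      ∃ t, Prime t ∧ t ∣ m ∧ π ∣ algebraMap A B t := by
    intro m
    refine UniqueFactorizationMonoid.induction_on_prime m (fun h => (h rfl).elim) ?_ ?_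
    · intro u hu _ h
      exact (hπ.not_isUnit (isUnit_of_dvd_unit h (hu.map _))).elim
    · intro a t ha ht ih _ h
      rw [map_mul] at h
      rcases hπ.dvd_or_dvd h with h | h
      · exact ⟨t, ht, dvd_mul_right _ _, h⟩
      · obtain ⟨t', ht', h1, h2⟩ := ih ha h
        exact ⟨t', ht', h1.mul_left _, h2⟩
  obtain ⟨t, ht, htn, hπt⟩ := hprime n hn0 hπn
  have h1 : algebraMap A B t ∣ π ^ p := ((map_dvd _ htn).trans (hn ▸ dvd_rfl)).trans hN.dvd
  obtain ⟨e, he, hte⟩ := (dvd_prime_pow hπ p).1 h1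
  have he1 : 1 ≤ e := by
    by_contra h
    obtain rfl : e = 0 := by omega
    rw [pow_zero] at hte
    exact hπ.not_isUnit (isUnit_of_dvd_one (hπt.trans hte.dvd))
  refine ⟨t, e, ht, he1, he, hte, le_antisymm (fun s hs => ?_) ?_⟩
  · rw [Ideal.mem_comap, Ideal.mem_span_singleton] at hs
    rw [Ideal.mem_span_singleton]
    refine ht.dvd_of_dvd_pow (n := e) (dvd_of_algebraMap_dvd hinj hfix ?_)
    rw [map_pow]
    exact hte.dvd.trans (pow_dvd_pow_of_dvd hs e)
  · rw [Ideal.span_singleton_le_iff_mem, Ideal.mem_comap, Ideal.mem_span_singleton]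
    exact hπt

end CyclicAction

/-! ### Orders along a prime element -/

section PrimeOrder

variable {B L : Type*} [CommRing B] [Field L] [Algebra B L] {π : B}

/-- The `π`-adic order of `z ∈ L = Frac B` is at least `n`, for a prime element `π` of `B`. -/
def OrdGE (π : B) (z : L) (n : ℤ) : Prop :=
  ∃ b c : B, ¬ π ∣ c ∧ z * algebraMap B L c = algebraMap B L π ^ n * algebraMap B L b

/-- The `π`-adic order of `z ∈ L = Frac B` is equal to `n`, for a prime element `π` of `B`. -/
def OrdEq (π : B) (z : L) (n : ℤ) : Prop :=
  ∃ b c : B, ¬ π ∣ b ∧ ¬ π ∣ c ∧ z * algebraMap B L c = algebraMap B L π ^ n * algebraMap B L b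

theorem algebraMap_ne_zero_of_ne [IsFractionRing B L]
    {b : B} (hb : b ≠ 0) : algebraMap B L b ≠ 0 := by
  rwa [Ne, map_eq_zero_iff _ (IsFractionRing.injective B L)]

theorem algebraMap_ne_zero_of_not_dvd [IsFractionRing B L]
    {b : B} (hb : ¬ π ∣ b) : algebraMap B L b ≠ 0 :=
  algebraMap_ne_zero_of_ne fun h => hb (h ▸ dvd_zero π)

theorem OrdEq.ordGE {z : L} {n : ℤ} (h : OrdEq π z n) : OrdGE π z n := by
  obtain ⟨b, c, -, hc, h⟩ := h
  exact ⟨b, c, hc, h⟩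

theorem OrdEq.ne_zero [IsFractionRing B L]
    (hπ : Prime π) {z : L} {n : ℤ} (h : OrdEq π z n) : z ≠ 0 := by
  rintro rfl
  obtain ⟨b, c, hb, hc, h⟩ := h
  rw [zero_mul] at h
  exact mul_ne_zero (zpow_ne_zero n (algebraMap_ne_zero_of_ne hπ.ne_zero))
    (algebraMap_ne_zero_of_not_dvd hb) h.symm

theorem OrdGE.mul [IsFractionRing B L]
    (hπ : Prime π) {z z' : L} {n n' : ℤ} (h : OrdGE π z n) (h' : OrdGE π z' n') :
    OrdGE π (z * z') (n + n') := by
  obtain ⟨b, c, hc, h⟩ := h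
  obtain ⟨b', c', hc', h'⟩ := h'
  refine ⟨b * b', c * c', fun hd => (hπ.dvd_or_dvd hd).elim hc hc', ?_⟩
  rw [map_mul, map_mul, zpow_add₀ (algebraMap_ne_zero_of_ne hπ.ne_zero)]
  linear_combination z' * algebraMap B L c' * h +
    algebraMap B L π ^ n * algebraMap B L b * h'

theorem OrdEq.mul [IsFractionRing B L]
    (hπ : Prime π) {z z' : L} {n n' : ℤ} (h : OrdEq π z n) (h' : OrdEq π z' n') :
    OrdEq π (z * z') (n + n') := by
  obtain ⟨b, c, hb, hc, h⟩ := h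
  obtain ⟨b', c', hb', hc', h'⟩ := h'
  refine ⟨b * b', c * c', fun hd => (hπ.dvd_or_dvd hd).elim hb hb',
    fun hd => (hπ.dvd_or_dvd hd).elim hc hc', ?_⟩
  rw [map_mul, map_mul, zpow_add₀ (algebraMap_ne_zero_of_ne hπ.ne_zero)]
  linear_combination z' * algebraMap B L c' * h +
    algebraMap B L π ^ n * algebraMap B L b * h'

theorem ordEq_one (hπ : Prime π) : OrdEq π (1 : L) 0 :=
  ⟨1, 1, fun h => hπ.not_isUnit (isUnit_of_dvd_one h),
    fun h => hπ.not_isUnit (isUnit_of_dvd_one h), by simp⟩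

theorem OrdEq.pow [IsFractionRing B L] (hπ : Prime π) {z : L} {n : ℤ} (h : OrdEq π z n) (m : ℕ) :
    OrdEq π (z ^ m) (m * n) := by
  induction m with
  | zero => simpa using ordEq_one hπ
  | succ m ih =>
    rw [pow_succ]
    convert ih.mul hπ h using 1
    push_cast; ring

theorem OrdEq.inv [IsFractionRing B L]
    (hπ : Prime π) {z : L} {n : ℤ} (h : OrdEq π z n) : OrdEq π z⁻¹ (-n) := by
  have hz := h.ne_zero hπ
  obtain ⟨b, c, hb, hc, h⟩ := h
  refine ⟨c, b, hc, hb, ?_⟩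
  have h0 : algebraMap B L π ^ n ≠ 0 := zpow_ne_zero n (algebraMap_ne_zero_of_ne hπ.ne_zero)
  rw [zpow_neg, inv_mul_eq_iff_eq_mul₀ hz, eq_comm]
  field_simp
  linear_combination h

theorem OrdEq.zpow [IsFractionRing B L] (hπ : Prime π) {z : L} {n : ℤ} (h : OrdEq π z n) (m : ℤ) :
    OrdEq π (z ^ m) (m * n) := by
  cases m with
  | ofNat m => simpa using h.pow hπ m
  | negSucc m =>
    rw [zpow_negSucc]
    have := (h.pow hπ (m + 1)).inv hπ
    convert this using 1
    rw [Int.negSucc_eq]; push_cast; ring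

theorem OrdGE.add (hπ : Prime π) {z z' : L} {n : ℤ} (h : OrdGE π z n) (h' : OrdGE π z' n) :
    OrdGE π (z + z') n := by
  obtain ⟨b, c, hc, h⟩ := h
  obtain ⟨b', c', hc', h'⟩ := h'
  refine ⟨b * c' + b' * c, c * c', fun hd => (hπ.dvd_or_dvd hd).elim hc hc', ?_⟩
  simp only [map_add, map_mul]
  linear_combination algebraMap B L c' * h + algebraMap B L c * h'

theorem OrdEq.le_of_ordGE [IsFractionRing B L]
    (hπ : Prime π) {z : L} {m n : ℤ} (h : OrdEq π z m) (h' : OrdGE π z n) :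
    n ≤ m := by
  by_contra! hlt
  obtain ⟨b, c, hb, hc, h⟩ := h
  obtain ⟨b', c', hc', h'⟩ := h'
  obtain ⟨d, hd⟩ := Int.eq_ofNat_of_zero_le (by omega : 0 ≤ n - m - 1)
  have hn : n = m + ((d + 1 : ℕ) : ℤ) := by push_cast; omega
  have hπ0 : algebraMap B L π ≠ 0 := algebraMap_ne_zero_of_ne hπ.ne_zero
  rw [hn, zpow_add₀ hπ0, zpow_natCast] at h'
  have h1 : algebraMap B L (b * c') = algebraMap B L (π ^ (d + 1) * b' * c) := by
    simp only [map_mul, map_pow]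
    apply mul_left_cancel₀ (zpow_ne_zero m hπ0)
    linear_combination -algebraMap B L c' * h + algebraMap B L c * h'
  have h2 := IsFractionRing.injective B L h1
  have h3 : π ∣ b * c' := by
    rw [h2, mul_assoc]
    exact (dvd_pow_self π (Nat.succ_ne_zero d)).mul_right _
  exact (hπ.dvd_or_dvd h3).elim hb hc'

theorem OrdEq.unique [IsFractionRing B L]
    (hπ : Prime π) {z : L} {m n : ℤ} (h : OrdEq π z m) (h' : OrdEq π z n) :
    m = n :=
  le_antisymm (h'.le_of_ordGE hπ h.ordGE) (h.le_of_ordGE hπ h'.ordGE)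

theorem OrdEq.add_of_lt [IsFractionRing B L]
    (hπ : Prime π) {z z' : L} {m n : ℤ} (h : OrdEq π z m) (h' : OrdGE π z' n)
    (hmn : m < n) : OrdEq π (z + z') m := by
  obtain ⟨b, c, hb, hc, h⟩ := h
  obtain ⟨b', c', hc', h'⟩ := h'
  obtain ⟨d, hd⟩ := Int.eq_ofNat_of_zero_le (by omega : 0 ≤ n - m - 1)
  have hn : n = m + ((d + 1 : ℕ) : ℤ) := by push_cast; omega
  rw [hn, zpow_add₀ (algebraMap_ne_zero_of_ne hπ.ne_zero), zpow_natCast] at h'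
  refine ⟨b * c' + π ^ (d + 1) * b' * c, c * c', fun hd => ?_,
    fun hd => (hπ.dvd_or_dvd hd).elim hc hc', ?_⟩
  · have h1 : π ∣ π ^ (d + 1) * b' * c := by
      rw [mul_assoc]
      exact (dvd_pow_self π (Nat.succ_ne_zero d)).mul_right _
    exact (hπ.dvd_or_dvd ((dvd_add_left h1).1 hd)).elim hb hc'
  · simp only [map_add, map_mul, map_pow]
    linear_combination algebraMap B L c' * h + algebraMap B L c * h'

theorem ordEq_of_associated {b : B} (hπ : Prime π) {e : ℕ} (h : Associated b (π ^ e)) :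
    OrdEq π (algebraMap B L b) e := by
  obtain ⟨u, hu⟩ := h
  have hn : ∀ v : Bˣ, ¬ π ∣ (v : B) := fun v hv => hπ.not_isUnit (isUnit_of_dvd_unit hv v.isUnit)
  refine ⟨1, u, fun h => hπ.not_isUnit (isUnit_of_dvd_one h), hn u, ?_⟩
  rw [← map_mul, hu]
  simp

theorem ordEq_of_not_dvd {b : B} (hπ : Prime π) (h : ¬ π ∣ b) : OrdEq π (algebraMap B L b) 0 :=
  ⟨b, 1, h, fun h => hπ.not_isUnit (isUnit_of_dvd_one h), by simp⟩

theorem exists_ordEq [IsFractionRing B L]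
    [IsDomain B] [WfDvdMonoid B] (hπ : Prime π) {z : L} (hz : z ≠ 0) :
    ∃ n, OrdEq π z n := by
  have key : ∀ b : B, b ≠ 0 → ∃ n, OrdEq π (algebraMap B L b) n := by
    intro b hb
    obtain ⟨n, b', hb', rfl⟩ :=
      WfDvdMonoid.max_power_factor hb hπ.irreducible
    have h1 : OrdEq π (algebraMap B L (π ^ n)) n :=
      ordEq_of_associated hπ (Associated.refl _)
    rw [map_mul]
    exact ⟨_, h1.mul hπ (ordEq_of_not_dvd hπ hb')⟩
  obtain ⟨b, c, hc, rfl⟩ := IsFractionRing.div_surjective (A := B) z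
  have hb : b ≠ 0 := by rintro rfl; simp at hz
  obtain ⟨n, hn⟩ := key b hb
  obtain ⟨m, hm⟩ := key c (nonZeroDivisors.ne_zero hc)
  rw [div_eq_mul_inv]
  exact ⟨_, hn.mul hπ (hm.inv hπ)⟩

/-- If an automorphism `s` satisfies `s y ≡ y` modulo `D` on `B`, where `π ^ d ∣ D`, then it
satisfies this congruence modulo `π ^ d` on the local ring of `π`. -/
theorem OrdGE.map_sub (hπ : Prime π) {s : B ≃+* B} {sL : L →+* L}
    (hs : ∀ b, sL (algebraMap B L b) = algebraMap B L (s b)) {d : ℕ} (hd0 : d ≠ 0)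
    (hd : ∀ b, π ^ d ∣ s b - b) {z : L} (hz : OrdGE π z 0) : OrdGE π (sL z - z) d := by
  obtain ⟨b, c, hc, h⟩ := hz
  rw [zpow_zero, one_mul] at h
  have hsc : ¬ π ∣ s c := fun h' => hc (by
    have := dvd_sub h' ((dvd_pow_self π hd0).trans (hd c))
    simpa using this)
  obtain ⟨f, hf⟩ := hd b
  obtain ⟨g, hg⟩ := hd c
  refine ⟨f * c - b * g, s c * c, fun h => (hπ.dvd_or_dvd h).elim hsc hc, ?_⟩
  have h1 := congrArg sL h
  rw [map_mul, hs, hs] at h1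
  have hf' := congrArg (algebraMap B L) hf
  have hg' := congrArg (algebraMap B L) hg
  simp only [_root_.map_sub, map_mul, map_pow] at hf' hg'
  rw [zpow_natCast]
  simp only [_root_.map_sub, map_mul]
  linear_combination algebraMap B L c * h1 - algebraMap B L (s c) * h +
    algebraMap B L c * hf' - algebraMap B L b * hg'

/-- `(1 + z) ^ r = 1 + r z + O(z ^ 2)`. -/
theorem exists_one_add_pow_eq [IsFractionRing B L]
    (hπ : Prime π) {z : L} (hz : OrdGE π z 0) (r : ℕ) :
    ∃ w, OrdGE π w 0 ∧ (1 + z) ^ r = 1 + r * z + z ^ 2 * w := by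
  have hnat : ∀ r : ℕ, OrdGE π (r : L) 0 := fun r =>
    ⟨r, 1, fun h => hπ.not_isUnit (isUnit_of_dvd_one h), by simp⟩
  induction r with
  | zero => exact ⟨0, by simpa using hnat 0, by simp⟩
  | succ r ih =>
    obtain ⟨w, hw, h⟩ := ih
    refine ⟨r + w + z * w, ((hnat r).add hπ hw).add hπ (by simpa using hz.mul hπ hw), ?_⟩
    rw [pow_succ, h]
    push_cast
    ring

end PrimeOrder

/-! ### The valuation of a prime divisor -/

section PrimeVal

variable {A : Type*} [CommRing A] [IsDomain A]

theorem ord_localization_eq {t b : A} (ht : Prime t) {P : Ideal A} [P.IsPrime]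
    (hP : P = Ideal.span {t}) (hb : ¬ t ∣ b) (i : ℕ) :
    Ring.ord (Localization.AtPrime P) (algebraMap A _ (t ^ i * b)) = i := by
  have hinj : Function.Injective (algebraMap A (Localization.AtPrime P)) :=
    IsLocalization.injective _ P.primeCompl_le_nonZeroDivisors
  have : IsDomain (Localization.AtPrime P) :=
    IsLocalization.isDomain_of_le_nonZeroDivisors _ P.primeCompl_le_nonZeroDivisors
  have hu : IsUnit (algebraMap A (Localization.AtPrime P) b) :=
    IsLocalization.map_units _ (⟨b, fun h => hb (by
      rwa [hP, SetLike.mem_coe, Ideal.mem_span_singleton] at h)⟩ : P.primeCompl)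
  have ht0 : algebraMap A (Localization.AtPrime P) t ≠ 0 := by
    rw [Ne, map_eq_zero_iff _ hinj]; exact ht.ne_zero
  have hmax : Ideal.span {algebraMap A (Localization.AtPrime P) t} =
      IsLocalRing.maximalIdeal (Localization.AtPrime P) := by
    rw [← Set.image_singleton, ← Ideal.map_span, ← hP, Localization.AtPrime.map_eq_maximalIdeal]
  have h1 : Ring.ord (Localization.AtPrime P) (algebraMap A _ t) = 1 := by
    rw [Ring.ord, Module.length_eq_one_iff, isSimpleModule_iff_isCoatom, hmax,
      ← Ideal.isMaximal_def]
    infer_instance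
  rw [map_mul, Ring.ord_mul_of_isUnit_right hu, map_pow,
    Ring.ord_pow (mem_nonZeroDivisors_of_ne_zero ht0), h1]
  simp

/-- The valuation `primeVal` is the order along a generator of the prime ideal. -/
theorem ordEq_primeVal {K : Type*} [Field K] [Algebra A K] [IsFractionRing A K] [WfDvdMonoid A]
    {t : A} (ht : Prime t) {P : PrimeSpectrum A} (hP : P.asIdeal = Ideal.span {t}) {a : K}
    (ha : a ≠ 0) : OrdEq t a (primeVal P a) := by
  have hspec := IsLocalization.sec_spec (nonZeroDivisors A) a
  set r := (IsLocalization.sec (nonZeroDivisors A) a).1 with hr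
  set s : A := ((IsLocalization.sec (nonZeroDivisors A) a).2 : A) with hs
  have hs0 : s ≠ 0 := nonZeroDivisors.ne_zero (IsLocalization.sec (nonZeroDivisors A) a).2.2
  have hr0 : r ≠ 0 := by
    intro h
    rw [h, map_zero] at hspec
    exact mul_ne_zero ha (algebraMap_ne_zero_of_ne hs0) hspec
  obtain ⟨i, r', hr', hri⟩ := WfDvdMonoid.max_power_factor hr0 ht.irreducible
  obtain ⟨j, s', hs', hsj⟩ := WfDvdMonoid.max_power_factor hs0 ht.irreducible
  have hval : primeVal P a = (i : ℤ) - j := by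
    unfold primeVal
    rw [← hr, ← hs, hri, hsj, ord_localization_eq ht hP hr', ord_localization_eq ht hP hs']
    simp
  rw [hval]
  refine ⟨r', s', hr', hs', ?_⟩
  have ht0 : algebraMap A K t ≠ 0 := algebraMap_ne_zero_of_ne ht.ne_zero
  rw [hri, hsj, map_mul, map_mul, map_pow, map_pow] at hspec
  rw [zpow_sub₀ ht0, zpow_natCast, zpow_natCast]
  field_simp
  linear_combination hspec

end PrimeVal

/-! ### Local bounds for Artin–Schreier extensions -/

section ArtinSchreier

variable {A B K L : Type*} [CommRing A] [CommRing B] [Algebra A B]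
  [Field K] [Algebra A K] [Field L] [Algebra B L] [IsFractionRing B L]
  [Algebra K L] [Algebra A L] [IsScalarTower A K L] [IsScalarTower A B L]

/-- Orders along `π` are `e` times orders along the prime element `t` below it. -/
theorem OrdEq.map {t : A} {π : B} (hπ : Prime π) {e : ℕ}
    (hte : Associated (algebraMap A B t) (π ^ e))
    (hcomap : (Ideal.span {π}).comap (algebraMap A B) = Ideal.span {t}) {a : K} {n : ℤ}
    (h : OrdEq t a n) : OrdEq π (algebraMap K L a) (e * n) := by
  obtain ⟨b, c, hb, hc, h⟩ := h
  have hnd : ∀ b : A, ¬ t ∣ b → ¬ π ∣ algebraMap A B b := fun b hb h => hb (by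
    rwa [← Ideal.mem_span_singleton, ← hcomap, Ideal.mem_comap, Ideal.mem_span_singleton])
  have h1 := congrArg (algebraMap K L) h
  simp only [map_mul, map_zpow₀, ← IsScalarTower.algebraMap_apply A K L] at h1
  simp only [IsScalarTower.algebraMap_apply A B L] at h1
  have hc' := hnd c hc
  have h2 := ((ordEq_of_associated (L := L) hπ hte).zpow hπ n).mul hπ
    (ordEq_of_not_dvd (L := L) hπ (hnd b hb))
  have h3 := h2.mul hπ ((ordEq_of_not_dvd (L := L) hπ hc').inv hπ)
  rw [← h1, mul_assoc, mul_inv_cancel₀ (algebraMap_ne_zero_of_not_dvd hc'), mul_one] at h3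
  convert h3 using 1
  ring

/-- The extension of an automorphism to the field of fractions. -/
theorem exists_ringHom_extension [IsFractionRing A K] (σ : B ≃ₐ[A] B) :
    ∃ sL : L →+* L, (∀ b, sL (algebraMap B L b) = algebraMap B L (σ b)) ∧
      ∀ a : K, sL (algebraMap K L a) = algebraMap K L a := by
  let sL : L ≃+* L := IsFractionRing.ringEquivOfRingEquiv (A := B) (B := B) σ.toRingEquiv
  have hs : ∀ b, sL (algebraMap B L b) = algebraMap B L (σ b) := fun b =>
    IsFractionRing.ringEquivOfRingEquiv_algebraMap _ b
  have hsA : ∀ r : A, sL (algebraMap K L (algebraMap A K r)) =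
      algebraMap K L (algebraMap A K r) := by
    intro r
    rw [← IsScalarTower.algebraMap_apply A K L, IsScalarTower.algebraMap_apply A B L, hs,
      AlgEquiv.commutes]
  refine ⟨sL, hs, fun a => ?_⟩
  obtain ⟨r, s, -, rfl⟩ := IsFractionRing.div_surjective (A := A) a
  change sL _ = _
  rw [map_div₀, map_div₀, hsA, hsA]

/-- The local bound for the different of an Artin–Schreier extension. If `π ^ d` divides all
`σ y - y` and `t` is associated to `π ^ e`, then `d p ≤ e (m + 1)` with `m = - v_t(a)`. -/
theorem mul_le_of_artinSchreier [IsFractionRing A K] [IsDomain B] [WfDvdMonoid B] {p : ℕ}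
    (hp : p.Prime) [CharP L p] (hpu : ∀ r : ℕ, ¬ p ∣ r → IsUnit (r : B))
    {σ : B ≃ₐ[A] B} (hσ : σ ≠ 1) {a : K} {x : L} (hx : x ^ p - x = algebraMap K L a)
    (hgen : IntermediateField.adjoin K {x} = ⊤) {t : A} {π : B} (hπ : Prime π) {e : ℕ}
    (he1 : 1 ≤ e) (hep : e ≤ p) (hte : Associated (algebraMap A B t) (π ^ e))
    (hcomap : (Ideal.span {π}).comap (algebraMap A B) = Ideal.span {t}) {d : ℕ} (hd0 : d ≠ 0)
    (hd : ∀ b, π ^ d ∣ σ b - b) {v : ℤ} (hv : a ≠ 0 → OrdEq t a v) :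
    (d : ℤ) * p ≤ e * (-v + 1) := by
  have : Fact p.Prime := ⟨hp⟩
  obtain ⟨sL, hsB, hsK⟩ := exists_ringHom_extension (K := K) (L := L) σ
  have hp0 : (p : ℤ) ≠ 0 := by exact_mod_cast hp.ne_zero
  have hp1 : (1 : ℤ) < p := by exact_mod_cast hp.one_lt
  -- `j = σ x - x` is a nonzero element of the prime field
  set j : L := sL x - x with hj
  have hjp : j ^ p = j := by
    have h1 := congrArg sL hx
    rw [map_sub, map_pow, hsK, ← hx] at h1
    rw [hj, sub_pow_char]
    linear_combination h1
  have hj0 : j ≠ 0 := by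
    intro h0
    apply hσ
    have hsx : sL x = x := sub_eq_zero.1 h0
    let sK : L →ₐ[K] L := { sL with commutes' := hsK }
    have hid : sK = AlgHom.id K L := by
      refine AlgHom.ext fun z => ?_
      have hz : z ∈ IntermediateField.adjoin K {x} := by rw [hgen]; exact IntermediateField.mem_top
      induction hz using IntermediateField.adjoin_induction with
      | mem y hy => rw [Set.mem_singleton_iff.1 hy]; exact hsx
      | algebraMap r => exact hsK r
      | add y z _ _ h1 h2 => rw [map_add, h1, h2, map_add]
      | inv y _ h1 => rw [map_inv₀, h1, map_inv₀]
      | mul y z _ _ h1 h2 => rw [map_mul, h1, h2, map_mul]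
    ext b
    apply IsFractionRing.injective B L
    rw [← hsB]
    exact DFunLike.congr_fun hid _
  have hjord : OrdEq π j 0 := by
    obtain ⟨n, hn⟩ := exists_ordEq hπ hj0
    have h1 := hn.pow hπ p
    rw [hjp] at h1
    have h2 := hn.unique hπ h1
    have h3 : ((p : ℤ) - 1) * n = 0 := by linear_combination -h2
    have h4 : n = 0 := (mul_eq_zero.1 h3).resolve_left (by omega)
    exact h4 ▸ hn
  have hsub : ∀ z : L, OrdGE π z 0 → OrdGE π (sL z - z) d := fun z hz =>
    hz.map_sub hπ (s := σ.toRingEquiv) hsB hd0 hd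
  -- `x` has a pole along `π`, of order `e m / p`
  have hx0 : x ≠ 0 := by
    rintro rfl
    exact hj0 (by simp [hj])
  obtain ⟨n, hn⟩ := exists_ordEq hπ hx0
  have hneg : n < 0 := by
    by_contra! h
    have hx1 : OrdGE π x 0 := by
      obtain ⟨b, c, hb, hc, h1⟩ := hn
      obtain ⟨n', rfl⟩ := Int.eq_ofNat_of_zero_le h
      exact ⟨π ^ n' * b, c, hc, by rw [h1]; simp⟩
    have := hjord.le_of_ordGE hπ (hsub x hx1)
    omega
  have hneg' : OrdGE π (-x) n := by
    obtain ⟨b, c, -, hc, h1⟩ := hn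
    exact ⟨-b, c, hc, by rw [map_neg]; linear_combination -h1⟩
  have hord : OrdEq π (algebraMap K L a) (p * n) := by
    rw [← hx, sub_eq_add_neg]
    exact (hn.pow hπ p).add_of_lt hπ hneg' (by nlinarith)
  have ha0 : a ≠ 0 := by
    rintro rfl
    exact hord.ne_zero hπ (map_zero _)
  have hpn : (p : ℤ) * n = e * v :=
    hord.unique hπ ((hv ha0).map hπ hte hcomap)
  have htord : OrdEq π (algebraMap B L (algebraMap A B t)) e := ordEq_of_associated hπ hte
  have hts : ∀ s : ℤ, sL (algebraMap B L (algebraMap A B t) ^ s) =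
      algebraMap B L (algebraMap A B t) ^ s := fun s => by
    rw [map_zpow₀, hsB, AlgEquiv.commutes]
  have he0 : (1 : ℤ) ≤ e := by exact_mod_cast he1
  by_cases hdiv : (p : ℤ) ∣ v
  · -- `y = x t ^ (m / p)` is a unit at `π`, and `σ y - y = j t ^ (m / p)`
    obtain ⟨w, hw⟩ := hdiv
    have hnw : n = e * w := by
      apply mul_left_cancel₀ hp0
      rw [hpn, hw]; ring
    have h1 : OrdEq π (x * algebraMap B L (algebraMap A B t) ^ (-w)) 0 := by
      convert hn.mul hπ (htord.zpow hπ (-w)) using 1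
      rw [hnw]; ring
    have h2 := hsub _ h1.ordGE
    have h3 : sL (x * algebraMap B L (algebraMap A B t) ^ (-w)) -
        x * algebraMap B L (algebraMap A B t) ^ (-w) =
        j * algebraMap B L (algebraMap A B t) ^ (-w) := by
      rw [map_mul, hts, hj]; ring
    rw [h3] at h2
    have h4 := (hjord.mul hπ (htord.zpow hπ (-w))).le_of_ordGE hπ h2
    rw [hw]
    nlinarith
  · -- `e = p`; `y = x ^ r t ^ s` with `r v + s p = 1` has order one at `π`
    have hpe : (p : ℤ) ∣ e := by
      have h1 : (p : ℤ) ∣ e * v := ⟨n, hpn.symm⟩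
      exact ((Nat.prime_iff_prime_int.1 hp).dvd_or_dvd h1).resolve_right hdiv
    obtain rfl : e = p := le_antisymm hep (Nat.le_of_dvd (by omega) (Int.natCast_dvd_natCast.1 hpe))
    have hnv : n = v := mul_left_cancel₀ hp0 hpn
    subst hnv
    obtain ⟨α, β, hαβ⟩ : IsCoprime (e : ℤ) n :=
      ((Nat.prime_iff_prime_int.1 hp).coprime_iff_not_dvd).2 hdiv
    obtain ⟨r, hr⟩ := Int.eq_ofNat_of_zero_le (Int.emod_nonneg β hp0)
    have hβ := Int.emod_add_mul_ediv β e
    rw [hr] at hβ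
    set s : ℤ := α + (β / e) * n with hs
    have hrs : (r : ℤ) * n + s * e = 1 := by
      rw [hs]
      linear_combination hαβ + n * hβ
    have hr : ¬ e ∣ r := by
      rintro ⟨q, rfl⟩
      have : (e : ℤ) ∣ 1 := ⟨q * n + s, by rw [← hrs]; push_cast; ring⟩
      have := Int.le_of_dvd one_pos this
      omega
    have h1 : OrdEq π (x ^ r * algebraMap B L (algebraMap A B t) ^ s) 1 := by
      convert (hn.pow hπ r).mul hπ (htord.zpow hπ s) using 1
      exact hrs.symm
    have hz : OrdEq π (j * x⁻¹) (-n) := by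
      convert hjord.mul hπ (hn.inv hπ) using 1
      ring
    have hz0 : OrdGE π (j * x⁻¹) 0 := by
      obtain ⟨n', hn'⟩ := Int.eq_ofNat_of_zero_le (by omega : 0 ≤ -n)
      obtain ⟨b, c, hb, hc, h⟩ := hz
      exact ⟨π ^ n' * b, c, hc, by rw [h, hn']; simp⟩
    obtain ⟨w, hw, hpow⟩ := exists_one_add_pow_eq hπ hz0 r
    have hint : OrdGE π (x ^ r * algebraMap B L (algebraMap A B t) ^ s) 0 := by
      obtain ⟨b, c, hb, hc, h⟩ := h1
      exact ⟨π * b, c, hc, by rw [h]; simp⟩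
    have h2 := hsub _ hint
    have hsx : sL x = x * (1 + j * x⁻¹) := by
      rw [hj]; field_simp; ring
    have h3 : sL (x ^ r * algebraMap B L (algebraMap A B t) ^ s) -
        x ^ r * algebraMap B L (algebraMap A B t) ^ s =
        x ^ r * algebraMap B L (algebraMap A B t) ^ s *
          (j * x⁻¹ * (r + j * x⁻¹ * w)) := by
      rw [map_mul, hts, map_pow, hsx, mul_pow, hpow]
      ring
    have hrord : OrdEq π (r : L) 0 := by
      have hu := hpu r hr
      have := ordEq_of_not_dvd (L := L) hπ
        (fun h => hπ.not_isUnit (isUnit_of_dvd_unit h hu))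
      simpa using this
    have h4 : OrdEq π ((r : L) + j * x⁻¹ * w) 0 := by
      refine hrord.add_of_lt hπ (hz.ordGE.mul hπ hw) (by omega)
    rw [h3] at h2
    have h5 := (h1.mul hπ (hz.mul hπ h4)).le_of_ordGE hπ h2
    nlinarith

end ArtinSchreier

/-! ### The branch locus -/

section Branch

variable {A B : Type*} [CommRing A] [CommRing B] [Algebra A B] {n : ℕ} {b : B}

/-- The differential of a generator generates the module of differentials. -/
theorem span_D_eq_top
    (hgen : ∀ y : B, ∃ q : Fin n → A, y = ∑ i, algebraMap A B (q i) * b ^ (i : ℕ)) :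
    Submodule.span B {KaehlerDifferential.D A B b} = ⊤ := by
  rw [eq_top_iff, ← KaehlerDifferential.span_range_derivation, Submodule.span_le]
  rintro _ ⟨y, rfl⟩
  obtain ⟨q, rfl⟩ := hgen y
  rw [map_sum]
  refine Submodule.sum_mem _ fun i _ => ?_
  rw [Derivation.leibniz, Derivation.leibniz_pow, Derivation.map_algebraMap, smul_zero, add_zero]
  exact Submodule.smul_mem _ _ (Submodule.smul_of_tower_mem _ _ (Submodule.smul_mem _ _
    (Submodule.subset_span rfl)))

/-- `y ↦ (σ y - y) / D` induces a derivation modulo every divisor of `D`. -/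
theorem exists_derivation [IsDomain B] {σ : B ≃ₐ[A] B} {D π : B} (hD : D ≠ 0) (hπ : π ∣ D)
    (hd : ∀ y, D ∣ σ y - y) :
    ∃ δ : Derivation A B (B ⧸ Ideal.span {π}), ∀ y q, σ y - y = D * q →
      δ y = Ideal.Quotient.mk _ q := by
  choose q hq using hd
  have huniq : ∀ y r, σ y - y = D * r → q y = r := fun y r h =>
    mul_left_cancel₀ hD ((hq y).symm.trans h)
  let l : B →ₗ[A] B :=
    { toFun := q
      map_add' := fun y z => huniq _ _ (by rw [map_add, mul_add, ← hq, ← hq]; ring)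
      map_smul' := fun r y => huniq _ _ (by
        rw [map_smul, ← smul_sub, hq, RingHom.id_apply, mul_smul_comm]) }
  let m : B →ₗ[A] (B ⧸ Ideal.span {π}) := (Ideal.Quotient.mkₐ A (Ideal.span {π})).toLinearMap
  refine ⟨Derivation.mk' (m ∘ₗ l) fun y z => ?_, fun y r h => ?_⟩
  · change Ideal.Quotient.mk _ (q (y * z)) =
      y • Ideal.Quotient.mk _ (q z) + z • Ideal.Quotient.mk _ (q y)
    have h1 : q (y * z) = y * q z + z * q y + D * (q y * q z) := by
      apply huniq
      have h2 := hq y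
      have h3 := hq z
      rw [map_mul]
      have h4 : σ y = y + D * q y := by rw [← h2]; ring
      have h5 : σ z = z + D * q z := by rw [← h3]; ring
      rw [h4, h5]; ring
    have h6 : Ideal.Quotient.mk (Ideal.span {π}) D = 0 :=
      Ideal.Quotient.eq_zero_iff_mem.2 (Ideal.mem_span_singleton.2 hπ)
    rw [h1, map_add, map_add, map_mul _ D, h6, zero_mul, add_zero]
    rfl
  · change Ideal.Quotient.mk _ (q y) = _
    rw [huniq y r h]

theorem height_span_singleton_eq_one [IsDomain A] [IsNoetherianRing A] {t : A} (ht : Prime t) :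
    (Ideal.span {t}).height = 1 := by
  have hp : (Ideal.span {t}).IsPrime := (Ideal.span_singleton_prime ht.ne_zero).2 ht
  apply le_antisymm
  · refine Ideal.height_le_one_of_isPrincipal_of_mem_minimalPrimes (Ideal.span {t}) _ ?_
    rw [Ideal.minimalPrimes_eq_subsingleton_self]
    rfl
  · have hlt : (⊥ : Ideal A) < Ideal.span {t} := by
      rw [bot_lt_iff_ne_bot, Ne, Ideal.span_singleton_eq_bot]
      exact ht.ne_zero
    have := Ideal.height_add_one_le_of_lt_of_isPrime hlt
    exact le_trans (by simp) this

open Polynomial in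
/-- The components of the branch locus are the images of the prime divisors of `D = σ b - b`. -/
theorem mem_branchComponents_iff [IsDomain A] [IsNoetherianRing A] [UniqueFactorizationMonoid A]
    [IsDomain B] [UniqueFactorizationMonoid B] (hinj : Function.Injective (algebraMap A B))
    {p : ℕ} (hp : p.Prime)
    (hgen : ∀ y : B, ∃ q : Fin n → A, y = ∑ i, algebraMap A B (q i) * b ^ (i : ℕ))
    {σ : B ≃ₐ[A] B} (hσ : σ ^ p = 1)
    (hfix : ∀ y : B, σ y = y → y ∈ Set.range (algebraMap A B)) (hD : σ b - b ≠ 0)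
    (P : PrimeSpectrum A) :
    P ∈ branchComponents A B ↔ ∃ π : B, Prime π ∧ π ∣ σ b - b ∧
      P.asIdeal = (Ideal.span {π}).comap (algebraMap A B) := by
  have hd := dvd_sub_of_generators hgen σ
  constructor
  · rintro ⟨hP, Q, hQ, rfl⟩
    -- `h'(b)` annihilates the differentials and divides a power of `σ b - b`
    obtain ⟨h, -, -, h0, hdvd⟩ := exists_monic_polynomial hp hgen hσ hfix
    have h1 : aeval b (derivative h) ∈ Q.asIdeal := by
      rw [Module.mem_support_iff_of_span_eq_top (span_D_eq_top hgen)] at hQ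
      obtain ⟨_, rfl, hQ⟩ := hQ
      apply hQ
      rw [Submodule.mem_annihilator_span_singleton, ← Derivation.map_aeval, h0, map_zero]
    have h2 : σ b - b ∈ Q.asIdeal :=
      Q.isPrime.mem_of_pow_mem _ (Q.asIdeal.mem_of_dvd hdvd h1)
    have h3 : ∀ m : B, m ≠ 0 → m ∈ Q.asIdeal → ∃ π, Prime π ∧ π ∣ m ∧ π ∈ Q.asIdeal := by
      intro m
      refine UniqueFactorizationMonoid.induction_on_prime m (fun h => (h rfl).elim) ?_ ?_
      · intro u hu _ h
        exact (Q.isPrime.ne_top (Ideal.eq_top_of_isUnit_mem _ h hu)).elim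
      · intro a t ha ht ih _ h
        rcases Q.isPrime.mem_or_mem h with h | h
        · exact ⟨t, ht, dvd_mul_right _ _, h⟩
        · obtain ⟨t', ht', h1, h2⟩ := ih ha h
          exact ⟨t', ht', h1.mul_left _, h2⟩
    obtain ⟨π, hπ, hπD, hπQ⟩ := h3 _ hD h2
    refine ⟨π, hπ, hπD, ?_⟩
    obtain ⟨t, e, ht, -, -, -, hcomap⟩ := exists_prime_comap hinj hσ hp.one_le hfix hπ
      (fun y => hπD.trans (hd y))
    have hle : (Ideal.span {π}).comap (algebraMap A B) ≤ Q.asIdeal.comap (algebraMap A B) :=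
      Ideal.comap_mono ((Ideal.span_singleton_le_iff_mem _).2 hπQ)
    rw [PrimeSpectrum.comap_asIdeal] at hP ⊢
    rw [hcomap] at hle ⊢
    by_contra hne
    have hp : (Ideal.span {t}).IsPrime := (Ideal.span_singleton_prime ht.ne_zero).2 ht
    have := Ideal.height_add_one_le_of_lt_of_isPrime (lt_of_le_of_ne hle (Ne.symm hne))
    rw [hP, height_span_singleton_eq_one ht] at this
    exact absurd this (by decide)
  · rintro ⟨π, hπ, hπD, hP⟩
    obtain ⟨t, e, ht, -, -, -, hcomap⟩ := exists_prime_comap hinj hσ hp.one_le hfix hπ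
      (fun y => hπD.trans (hd y))
    refine ⟨by rw [hP, hcomap, height_span_singleton_eq_one ht], ?_⟩
    have hprime : (Ideal.span {π}).IsPrime := (Ideal.span_singleton_prime hπ.ne_zero).2 hπ
    refine ⟨⟨Ideal.span {π}, hprime⟩, ?_, PrimeSpectrum.ext hP.symm⟩
    -- the derivation induced by `y ↦ (σ y - y) / D` maps `b` to `1`, so the annihilator of the
    -- differential of `b` lies in `(π)`
    obtain ⟨δ, hδ⟩ := exists_derivation hD hπD hd
    rw [Module.mem_support_iff_exists_annihilator]
    refine ⟨KaehlerDifferential.D A B b, fun r hr => ?_⟩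
    rw [Submodule.mem_annihilator_span_singleton] at hr
    have h1 := congrArg δ.liftKaehlerDifferential hr
    rw [map_smul, Derivation.liftKaehlerDifferential_comp_D, map_zero,
      hδ b 1 (by rw [mul_one])] at h1
    change Ideal.Quotient.mk _ (r * 1) = 0 at h1
    rwa [mul_one, Ideal.Quotient.eq_zero_iff_mem] at h1

end Branch

/-! ### The order of `σ T₁ - T₁` along a lifting -/

section OrderBound

open PowerSeries

theorem order_X_pow_mul_unit {k : Type*} [Field k] {n : ℕ} {u : k⟦X⟧} (hu : IsUnit u) :
    (X ^ n * u : k⟦X⟧).order = ((n : ℕ) : ℕ∞) := by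
  rw [order_mul, order_X_pow, order_zero_of_unit hu, add_zero]

/-- A homomorphism `φ` of `k[[X]]` multiplies orders by the order `ε` of `φ X`. -/
theorem order_map {k : Type*} [Field k] {φ : k⟦X⟧ →ₐ[k] k⟦X⟧} {ε : ℕ} {u : k⟦X⟧}
    (hu : IsUnit u) (hφ : φ X = X ^ ε * u) {f : k⟦X⟧} (hf : f ≠ 0) :
    (φ f).order = (ε * f.order.toNat : ℕ) := by
  obtain ⟨n, v, hv, rfl⟩ := exists_eq_X_pow_mul_unit hf
  have h1 : φ (X ^ n * v) = X ^ (ε * n) * (u ^ n * φ v) := by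
    rw [map_mul, map_pow, hφ]; ring
  rw [h1, order_X_pow_mul_unit ((hu.pow n).mul (hv.map φ)), order_X_pow_mul_unit hv]
  simp

variable {k A B K L : Type*} [Field k] [CommRing A] [Algebra k A] [CommRing B] [Algebra k B]
  [Algebra A B] [IsDomain A] [IsNoetherianRing A] [UniqueFactorizationMonoid A]
  [IsDomain B] [UniqueFactorizationMonoid B]
  [Field K] [Algebra A K] [IsFractionRing A K] [Field L] [Algebra B L] [IsFractionRing B L]
  [Algebra K L] [Algebra A L] [IsScalarTower A K L] [IsScalarTower A B L]

/-- The order of `D = σ b - b` along a lifting of an arc is bounded by the intersection number of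
the arc with `R₀`. -/
theorem order_le_interDiv (hinj : Function.Injective (algebraMap A B)) {p n : ℕ} (hp : p.Prime)
    [CharP L p] (hpu : ∀ r : ℕ, ¬ p ∣ r → IsUnit (r : B)) {b : B}
    (hgen : ∀ y : B, ∃ q : Fin n → A, y = ∑ i, algebraMap A B (q i) * b ^ (i : ℕ))
    {σ : B ≃ₐ[A] B} (hσ : σ ^ p = 1)
    (hfix : ∀ y : B, σ y = y → y ∈ Set.range (algebraMap A B)) (hD : σ b - b ≠ 0)
    {a : K} {x : L} (hx : x ^ p - x = algebraMap K L a)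
    (hgenL : IntermediateField.adjoin K {x} = ⊤)
    (hfin : (branchComponents A B).Finite) (C : Arc k A) (C' : Arc k B)
    (hCR : ∀ P ∈ branchComponents A B, ∀ t, P.asIdeal = Ideal.span {t} → C.hom t ≠ 0)
    {φ : k⟦X⟧ →ₐ[k] k⟦X⟧} {ε : ℕ} {u : k⟦X⟧} (hu : IsUnit u) (hφ : φ X = X ^ ε * u) (hε : ε ≤ p)
    (hcomp : ∀ r, C'.hom (algebraMap A B r) = φ (C.hom r)) :
    C'.hom (σ b - b) ≠ 0 ∧
      ((C'.hom (σ b - b)).order.toNat : ℤ) ≤ C.interDiv (R₀ A B a) := by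
  classical
  have hd := dvd_sub_of_generators hgen σ
  have hσ1 : σ ≠ 1 := fun h => hD (by simp [h])
  have hmem := mem_branchComponents_iff hinj hp hgen hσ hfix hD
  choose! π hπ hπD hPπ using fun P (hP : P ∈ branchComponents A B) => (hmem P).1 hP
  choose! t e ht he1 hep hte hcomap using fun P (hP : P ∈ branchComponents A B) =>
    exists_prime_comap hinj hσ hp.one_le hfix (hπ P hP) (fun y => (hπD P hP).trans (hd y))
  choose! d D' hD' hDd using fun P (hP : P ∈ branchComponents A B) =>
    WfDvdMonoid.max_power_factor hD (hπ P hP).irreducible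
  have hPt : ∀ P ∈ branchComponents A B, P.asIdeal = Ideal.span {t P} := fun P hP =>
    (hPπ P hP).trans (hcomap P hP)
  have hphi0 : ∀ f : k⟦X⟧, f ≠ 0 → φ f ≠ 0 := fun f hf h => by
    have := order_map hu hφ hf
    rw [h, order_zero] at this
    exact ENat.top_ne_natCast _ this
  -- the orders of `π` and `t` along the two arcs
  have hord : ∀ P ∈ branchComponents A B, C'.hom (π P) ≠ 0 ∧
      e P * (C'.hom (π P)).order.toNat = ε * (C.inter P).toNat := by
    intro P hP
    have h1 : Associated (φ (C.hom (t P))) (C'.hom (π P) ^ e P) := by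
      rw [← hcomp, ← map_pow]
      exact (hte P hP).map C'.hom
    have h0 := hCR P hP (t P) (hPt P hP)
    have h2 : C'.hom (π P) ^ e P ≠ 0 := fun h => hphi0 _ h0 (h1.eq_zero_iff.2 h)
    have h3 : C'.hom (π P) ≠ 0 := fun h => h2 (by rw [h, zero_pow]; have := he1 P hP; omega)
    refine ⟨h3, ?_⟩
    have h4 : (φ (C.hom (t P))).order = (C'.hom (π P) ^ e P).order := by
      obtain ⟨v, hv⟩ := h1
      rw [← hv, order_mul, order_zero_of_unit v.isUnit, add_zero]
    rw [order_map hu hφ h0, order_pow, ← coe_toNat_order h3, nsmul_eq_mul] at h4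
    rw [C.inter_eq_order P (t P) (hPt P hP)]
    exact_mod_cast h4.symm
  -- the contribution of each component
  have hbound : ∀ P ∈ branchComponents A B, ((d P * (C'.hom (π P)).order.toNat : ℕ) : ℤ) ≤
      R₀ A B a P * ((C.inter P).toNat : ℤ) := by
    intro P hP
    have hd0 : d P ≠ 0 := by
      intro h
      have h1 := hDd P hP
      rw [h, pow_zero, one_mul] at h1
      exact hD' P hP (h1 ▸ hπD P hP)
    have h1 := mul_le_of_artinSchreier (K := K) (L := L) hp hpu hσ1 hx hgenL (hπ P hP) (he1 P hP)
      (hep P hP) (hte P hP) (hcomap P hP) hd0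
      (fun y => (Dvd.intro _ (hDd P hP).symm).trans (hd y))
      (fun ha => ordEq_primeVal (ht P hP) (hPt P hP) ha)
    have h2 := (hord P hP).2
    have hR : R₀ A B a P = - primeVal P a + 1 := by
      unfold R₀; rw [if_pos hP]
    rw [hR]
    have he : (0 : ℤ) < e P := by exact_mod_cast he1 P hP
    have hεp : (ε : ℤ) ≤ p := by exact_mod_cast hε
    zify at h2
    push_cast
    refine le_of_mul_le_mul_left ?_ he
    have h3 : (e P : ℤ) * (d P * (C'.hom (π P)).order.toNat) =
        d P * ε * (C.inter P).toNat := by linear_combination (d P : ℤ) * h2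
    rw [h3]
    have h4 : (d P : ℤ) * ε ≤ d P * p := mul_le_mul_of_nonneg_left hεp (by positivity)
    calc (d P : ℤ) * ε * (C.inter P).toNat
        ≤ (e P * (-primeVal P a + 1)) * (C.inter P).toNat :=
          mul_le_mul_of_nonneg_right (h4.trans h1) (by positivity)
      _ = _ := by ring
  -- `D` divides the product of the `π ^ d`
  have hdvd : σ b - b ∣ ∏ P ∈ hfin.toFinset, π P ^ d P := by
    rw [UniqueFactorizationMonoid.dvd_iff_emultiplicity_le hD]
    intro q hq
    refine emultiplicity_le_emultiplicity_iff.2 fun m hm => ?_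
    cases m with
    | zero => simp
    | succ m =>
      have hqD : q ∣ σ b - b := (dvd_pow_self q (Nat.succ_ne_zero m)).trans hm
      obtain ⟨t', e', ht', -, -, hte', hcomap'⟩ :=
        exists_prime_comap hinj hσ hp.one_le hfix hq (fun y => hqD.trans (hd y))
      have hq' : (Ideal.span {q}).IsPrime := (Ideal.span_singleton_prime hq.ne_zero).2 hq
      let P : PrimeSpectrum A := ⟨(Ideal.span {q}).comap (algebraMap A B),
        Ideal.comap_isPrime _ _⟩
      have hP : P ∈ branchComponents A B := (hmem P).2 ⟨q, hq, hqD, rfl⟩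
      -- both `q` and `π P` divide the generator of `P`
      have hassoc : Associated q (π P) := by
        have h1 : Ideal.span {t'} = Ideal.span {t P} := hcomap'.symm.trans (hPt P hP)
        have h2 : Associated t' (t P) := Ideal.span_singleton_eq_span_singleton.1 h1
        have h3 : q ∣ π P ^ e P := by
          have h4 : q ∣ algebraMap A B t' := by
            rw [← Ideal.mem_span_singleton, ← Ideal.mem_comap, hcomap']
            exact Ideal.mem_span_singleton_self _
          exact (h4.trans (h2.map (algebraMap A B)).dvd).trans (hte P hP).dvd
        exact hq.associated_of_dvd (hπ P hP) (hq.dvd_of_dvd_pow h3)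
      have hm' : π P ^ (m + 1) ∣ σ b - b := (hassoc.pow_pow).symm.dvd.trans hm
      have hle : m + 1 ≤ d P := by
        by_contra! hlt
        have h1 : π P ^ (d P + 1) ∣ π P ^ d P * D' P := by
          rw [← hDd P hP]
          exact (pow_dvd_pow _ (by omega)).trans hm'
        rw [pow_succ] at h1
        exact hD' P hP ((mul_dvd_mul_iff_left (pow_ne_zero _ (hπ P hP).ne_zero)).1 h1)
      exact (hassoc.pow_pow.dvd.trans (pow_dvd_pow _ hle)).trans
        (Finset.dvd_prod_of_mem (fun P => π P ^ d P) (hfin.mem_toFinset.2 hP))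
  have hdvd' := map_dvd C'.hom hdvd
  rw [map_prod] at hdvd'
  simp only [map_pow] at hdvd'
  have hprod0 : ∏ P ∈ hfin.toFinset, C'.hom (π P) ^ d P ≠ 0 :=
    Finset.prod_ne_zero_iff.2 fun P hP => pow_ne_zero _ (hord P (hfin.mem_toFinset.1 hP)).1
  have h0 : C'.hom (σ b - b) ≠ 0 := fun h => hprod0 (zero_dvd_iff.1 (h ▸ hdvd'))
  refine ⟨h0, ?_⟩
  have hle : (C'.hom (σ b - b)).order ≤
      ((∑ P ∈ hfin.toFinset, d P * (C'.hom (π P)).order.toNat : ℕ) : ℕ∞) := by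
    obtain ⟨g, hg⟩ := hdvd'
    have h1 : (C'.hom (σ b - b)).order ≤ (∏ P ∈ hfin.toFinset, C'.hom (π P) ^ d P).order := by
      rw [hg, order_mul]; exact le_self_add
    refine h1.trans (le_of_eq ?_)
    rw [order_prod, Nat.cast_sum]
    refine Finset.sum_congr rfl fun P hP => ?_
    rw [order_pow, nsmul_eq_mul, Nat.cast_mul, coe_toNat_order (hord P (hfin.mem_toFinset.1 hP)).1]
  have hsum : C.interDiv (R₀ A B a) =
      ∑ P ∈ hfin.toFinset, R₀ A B a P * ((C.inter P).toNat : ℤ) := by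
    refine finsum_eq_sum_of_support_subset _ fun P hP => ?_
    rw [Set.Finite.coe_toFinset]
    by_contra hnot
    exact hP (by simp only [R₀, if_neg hnot, zero_mul])
  rw [hsum]
  have h2 := ENat.toNat_le_of_le_natCast hle
  calc ((C'.hom (σ b - b)).order.toNat : ℤ)
      ≤ ((∑ P ∈ hfin.toFinset, d P * (C'.hom (π P)).order.toNat : ℕ) : ℤ) := by exact_mod_cast h2
    _ ≤ _ := by
      rw [Nat.cast_sum]
      exact Finset.sum_le_sum fun P hP => hbound P (hfin.mem_toFinset.1 hP)

end OrderBound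

/-! ### Conductor and different -/

section Different

open Polynomial

attribute [local instance] FractionRing.liftAlgebra FractionRing.isScalarTower_liftAlgebra

variable {O O' : Type*} [CommRing O] [IsDomain O] [CommRing O']

/-- An element that generates the fractions of `O'` over those of `O` generates the extension of
the fraction fields. -/
theorem adjoin_eq_top_of_fractions [IsDomain O'] [Algebra O O'] [Module.IsTorsionFree O O'] {τ : O'}
    (hfrac : ∀ y : O', ∃ b c : O[X], aeval τ c ≠ 0 ∧ y * aeval τ c = aeval τ b) :
    IntermediateField.adjoin (FractionRing O) {algebraMap O' (FractionRing O') τ} = ⊤ := by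
  set F := IntermediateField.adjoin (FractionRing O) {algebraMap O' (FractionRing O') τ}
  have h1 : ∀ g : O[X], algebraMap O' (FractionRing O') (aeval τ g) ∈ F := fun g => by
    have hτ : algebraMap O' (FractionRing O') τ ∈ F :=
      IntermediateField.mem_adjoin_simple_self _ _
    rw [← aeval_algebraMap_apply, aeval_eq_sum_range]
    refine sum_mem fun i _ => ?_
    rw [Algebra.smul_def, IsScalarTower.algebraMap_apply O (FractionRing O) (FractionRing O')]
    exact mul_mem (F.algebraMap_mem _) (pow_mem hτ i)
  have h2 : ∀ y : O', algebraMap O' (FractionRing O') y ∈ F := fun y => by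
    obtain ⟨b, c, hc, h⟩ := hfrac y
    have hc' : algebraMap O' (FractionRing O') (aeval τ c) ≠ 0 := by
      rwa [Ne, map_eq_zero_iff _ (IsFractionRing.injective O' (FractionRing O'))]
    rw [eq_div_of_mul_eq hc' ((map_mul _ y _).symm.trans (congrArg _ h))]
    exact div_mem (h1 b) (h1 c)
  rw [eq_top_iff]
  intro z _
  obtain ⟨y, s, -, rfl⟩ := IsFractionRing.div_surjective (A := O') z
  exact div_mem (h2 y) (h2 s)

/-- A family in `O'` linearly independent over `O` has at most `deg h` elements if the fractions of
`O'` are generated by a root of the monic polynomial `h`. -/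
theorem le_natDegree_of_linearIndependent [IsDomain O'] {φ : O →+* O'}
    (hφ : Function.Injective φ) {τ : O'} {h : O[X]} (hm : h.Monic) (h0 : h.eval₂ φ τ = 0)
    (hfrac : ∀ y : O', ∃ b c : O[X], c.eval₂ φ τ ≠ 0 ∧ y * c.eval₂ φ τ = b.eval₂ φ τ) {n : ℕ}
    (v : Fin n → O') (hv : ∀ c : Fin n → O, ∑ i, φ (c i) * v i = 0 → ∀ i, c i = 0) :
    n ≤ h.natDegree := by
  let _ : Algebra O O' := φ.toAlgebra
  have : FaithfulSMul O O' := (faithfulSMul_iff_algebraMap_injective O O').2 hφ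
  have : Module.IsTorsionFree O O' := inferInstance
  have htop := adjoin_eq_top_of_fractions (O := O) hfrac
  set K := FractionRing O
  set L := FractionRing O'
  have h1 : aeval (algebraMap O' L τ) (h.map (algebraMap O K)) = 0 := by
    rw [aeval_map_algebraMap, aeval_algebraMap_apply]
    change algebraMap O' L (h.eval₂ φ τ) = 0
    rw [h0, map_zero]
  have hint : IsIntegral K (algebraMap O' L τ) := ⟨_, hm.map _, h1⟩
  have hfr : Module.finrank K L ≤ h.natDegree := by
    rw [← IntermediateField.finrank_top', ← htop, IntermediateField.adjoin.finrank hint,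
      ← hm.natDegree_map (algebraMap O K)]
    exact natDegree_le_of_dvd (minpoly.dvd _ _ h1) (hm.map _).ne_zero
  have : FiniteDimensional K L := by
    have := IntermediateField.adjoin.finiteDimensional hint
    rw [htop] at this
    exact IntermediateField.topEquiv.toLinearEquiv.finiteDimensional
  have hli : LinearIndependent O v := Fintype.linearIndependent_iff.2 fun c hc i =>
    hv c (by simpa only [Algebra.smul_def] using hc :
      ∑ i, algebraMap O O' (c i) * v i = 0) i
  have hli' : LinearIndependent O (fun i => algebraMap O' L (v i)) :=
    hli.map_of_injective_injective (RingHom.id O) (algebraMap O' L : O' →+ L)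
      (fun r hr => hr) (fun m hm => (map_eq_zero_iff _ (IsFractionRing.injective O' L)).1 hm)
      (fun r m => by
        change algebraMap O' L (r • m) = r • algebraMap O' L m
        rw [Algebra.algebraMap_eq_smul_one, Algebra.algebraMap_eq_smul_one, smul_assoc])
  have := ((LinearIndependent.iff_fractionRing O K).1 hli').fintype_card_le_finrank
  rw [Fintype.card_fin] at this
  exact this.trans hfr

/-- The derivative of the minimal polynomial generates the product of the conductor and the
different. -/
theorem aeval_derivative_minpoly_mem_conductor (O K L : Type*) {O' : Type*} [CommRing O]
    [IsDomain O] [IsIntegrallyClosed O] [CommRing O'] [IsDedekindDomain O'] [Field K] [Field L]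
    [Algebra O K] [Algebra O' L] [Algebra O O'] [Algebra K L] [Algebra O L] [IsScalarTower O K L]
    [IsScalarTower O O' L] [IsFractionRing O K] [FiniteDimensional K L]
    [Algebra.IsSeparable K L] [IsIntegralClosure O' O L] [Module.IsTorsionFree O O'] {τ : O'}
    (h : Algebra.adjoin K {algebraMap O' L τ} = ⊤) :
    aeval τ (derivative (minpoly O τ)) ∈ conductor O τ := by
  have h2 : aeval τ (derivative (minpoly O τ)) ∈ conductor O τ * differentIdeal O O' := by
    rw [conductor_mul_differentIdeal O K L τ h]
    exact Ideal.mem_span_singleton_self _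
  exact (Ideal.mul_le_left : conductor O τ * differentIdeal O O' ≤ _) h2

/-- If the fractions of a Dedekind domain `O'` integral over `O` are generated by a root `τ` of
the monic polynomial `h`, then `h'(τ) O' ⊆ O[τ]`. -/
theorem exists_derivative_mul_eq_eval₂ [IsIntegrallyClosed O] [IsDedekindDomain O'] {φ : O →+* O'}
    (hφ : Function.Injective φ) (hint : φ.IsIntegral) {τ : O'}
    {h : O[X]} (h0 : h.eval₂ φ τ = 0) (h1 : (derivative h).eval₂ φ τ ≠ 0)
    (hfrac : ∀ y : O', ∃ b c : O[X], c.eval₂ φ τ ≠ 0 ∧ y * c.eval₂ φ τ = b.eval₂ φ τ) (y : O') :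
    ∃ g : O[X], (derivative h).eval₂ φ τ * y = g.eval₂ φ τ := by
  let _ : Algebra O O' := φ.toAlgebra
  have : FaithfulSMul O O' := (faithfulSMul_iff_algebraMap_injective O O').2 hφ
  have : Module.IsTorsionFree O O' := inferInstance
  have : Algebra.IsIntegral O O' := ⟨hint⟩
  have htop := adjoin_eq_top_of_fractions (O := O) hfrac
  set K := FractionRing O
  set L := FractionRing O'
  have h0' : aeval τ h = 0 := h0
  have h1' : aeval τ (derivative h) ≠ 0 := h1
  have hτ : IsIntegral O τ := hint τ
  -- the minimal polynomial divides `h`, so its derivative at `τ` divides `h'(τ)`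
  obtain ⟨g, hg⟩ := minpoly.isIntegrallyClosed_dvd hτ h0'
  have hd : aeval τ (derivative h) = aeval τ (derivative (minpoly O τ)) * aeval τ g := by
    conv_lhs => rw [hg]
    rw [derivative_mul]
    simp
  have hsep0 : aeval τ (derivative (minpoly O τ)) ≠ 0 := fun h => h1' (by rw [hd, h, zero_mul])
  have hintK : IsIntegral K (algebraMap O' L τ) := (hτ.algebraMap (B := L)).tower_top
  have hsep : IsSeparable K (algebraMap O' L τ) := by
    rw [IsSeparable, separable_iff_derivative_ne_zero (minpoly.irreducible hintK)]
    intro h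
    rw [minpoly.isIntegrallyClosed_eq_field_fractions K L hτ, derivative_map] at h
    have h2 := congrArg (aeval (algebraMap O' L τ)) h
    rw [aeval_map_algebraMap, aeval_algebraMap_apply, map_zero] at h2
    exact hsep0 ((map_eq_zero_iff _ (IsFractionRing.injective O' L)).1 h2)
  have : FiniteDimensional K L := by
    have := IntermediateField.adjoin.finiteDimensional hintK
    rw [htop] at this
    exact IntermediateField.topEquiv.toLinearEquiv.finiteDimensional
  have : Algebra.IsSeparable K L := by
    have := (IntermediateField.isSeparable_adjoin_simple_iff_isSeparable K L).2 hsep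
    rw [htop] at this
    exact Algebra.IsSeparable.of_algHom K _
      (IntermediateField.topEquiv (F := K) (E := L)).symm.toAlgHom
  have : IsIntegralClosure O' O L := IsIntegralClosure.of_isIntegrallyClosed O' O L
  have htop' : Algebra.adjoin K {algebraMap O' L τ} = ⊤ := by
    rw [← IntermediateField.adjoin_simple_toSubalgebra_of_isAlgebraic hintK.isAlgebraic, htop,
      IntermediateField.top_toSubalgebra]
  have hc := aeval_derivative_minpoly_mem_conductor O K L htop'
  have h2 := mem_conductor_iff.1 hc (aeval τ g * y)
  rw [← mul_assoc, ← hd, Algebra.adjoin_singleton_eq_range_aeval] at h2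
  obtain ⟨f, hf⟩ := h2
  exact ⟨f, hf.symm⟩

end Different

/-! ### Liftings of arcs -/

section Liftings

open PowerSeries

variable {k A B : Type*} [Field k] [CommRing A] [Algebra k A] [CommRing B] [Algebra k B]
  [Algebra A B]

/-- A lifting of an arc `C` comes with a homomorphism `φ` from the coordinate ring of the
parametrization of `C` to that of the lifting. If `b` generates `B` over `A`, then its image on the
lifting generates the fractions over the image of `φ`. -/
theorem Arc.IsLifting.exists_algHom [IsScalarTower k A B] {C : Arc k A} {C' : Arc k B}
    (h : C.IsLifting C') {n : ℕ} {b : B}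
    (hgen : ∀ y : B, ∃ q : Fin n → A, y = ∑ i, algebraMap A B (q i) * b ^ (i : ℕ)) :
    ∃ φ : k⟦X⟧ →ₐ[k] k⟦X⟧, (∀ r, C'.hom (algebraMap A B r) = φ (C.hom r)) ∧
      ∀ y : k⟦X⟧, ∃ f g : Polynomial k⟦X⟧, g.eval₂ (φ : k⟦X⟧ →+* k⟦X⟧) (C'.hom b) ≠ 0 ∧
        y * g.eval₂ (φ : k⟦X⟧ →+* k⟦X⟧) (C'.hom b) =
          f.eval₂ (φ : k⟦X⟧ →+* k⟦X⟧) (C'.hom b) := by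
  let _ : Algebra A k⟦X⟧ := C.hom.toRingHom.toAlgebra
  obtain ⟨ν, hν, -, -, hfrac⟩ := h
  have hA : ∀ r : A, ν (C.hom r ⊗ₜ[A] 1) = C'.hom (algebraMap A B r) := fun r => by
    have h1 : (C.hom r ⊗ₜ[A] (1 : B)) = (1 : k⟦X⟧) ⊗ₜ[A] algebraMap A B r := by
      have := TensorProduct.smul_tmul (R := A) r (1 : k⟦X⟧) (1 : B)
      rw [Algebra.smul_def, mul_one, Algebra.smul_def, mul_one] at this
      exact this
    rw [hν, h1]
  let φ : k⟦X⟧ →ₐ[k] k⟦X⟧ :=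
    { ν.comp (Algebra.TensorProduct.includeLeftRingHom (R := A) (A := k⟦X⟧) (B := B)) with
      commutes' := fun r => by
        change ν (algebraMap k k⟦X⟧ r ⊗ₜ[A] (1 : B)) = _
        rw [← C.hom.commutes, hA, ← IsScalarTower.algebraMap_apply, AlgHom.commutes,
          AlgHom.commutes] }
  have hφ : ∀ f, φ f = ν (f ⊗ₜ[A] (1 : B)) := fun f => rfl
  have hran : ∀ z, ∃ g : Polynomial k⟦X⟧, ν z = g.eval₂ (φ : k⟦X⟧ →+* k⟦X⟧) (C'.hom b) := by
    intro z
    induction z using TensorProduct.induction_on with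
    | zero => exact ⟨0, by simp⟩
    | add z w hz hw =>
      obtain ⟨g, hg⟩ := hz
      obtain ⟨g', hg'⟩ := hw
      exact ⟨g + g', by rw [map_add, hg, hg', Polynomial.eval₂_add]⟩
    | tmul f y =>
      obtain ⟨q, rfl⟩ := hgen y
      refine ⟨∑ i, Polynomial.C (f * C.hom (q i)) * Polynomial.X ^ (i : ℕ), ?_⟩
      have h1 : (f ⊗ₜ[A] (∑ i, algebraMap A B (q i) * b ^ (i : ℕ)) : k⟦X⟧ ⊗[A] B) =
          (f ⊗ₜ[A] 1) * (1 ⊗ₜ[A] (∑ i, algebraMap A B (q i) * b ^ (i : ℕ))) := by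
        rw [Algebra.TensorProduct.tmul_mul_tmul, mul_one, one_mul]
      rw [h1, map_mul, ← hν, ← hφ, map_sum, Finset.mul_sum, Polynomial.eval₂_finsetSum]
      refine Finset.sum_congr rfl fun i _ => ?_
      rw [Polynomial.eval₂_mul, Polynomial.eval₂_C, Polynomial.eval₂_X_pow, map_mul, map_pow,
        ← hA, RingHom.coe_coe, map_mul, hφ (C.hom (q i)), mul_assoc]
  refine ⟨φ, fun r => by rw [hφ, hA], fun y => ?_⟩
  obtain ⟨f, g, hg, hfg⟩ := hfrac y
  obtain ⟨F, hF⟩ := hran f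
  obtain ⟨G, hG⟩ := hran g
  exact ⟨F, G, hG ▸ hg, by rw [← hG, ← hF, hfg]⟩

/-- Homomorphisms of `k`-algebras from `k[[X]]` to itself are local: if `φ X` had a constant term
`r ≠ 0`, then the unit `X - r` would go to a non-unit. -/
theorem X_dvd_map_X (φ : k⟦X⟧ →ₐ[k] k⟦X⟧) : X ∣ φ X := by
  rw [X_dvd_iff]
  by_contra h
  have h1 : IsUnit (X - algebraMap k k⟦X⟧ (constantCoeff (φ X))) := by
    rw [PowerSeries.isUnit_iff_constantCoeff, PowerSeries.algebraMap_apply]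
    simpa using h
  have h2 := h1.map φ
  rw [map_sub, AlgHom.commutes, PowerSeries.isUnit_iff_constantCoeff,
    PowerSeries.algebraMap_apply] at h2
  simp at h2

/-- The homomorphism `φ` is not constant: otherwise `τ` would be algebraic over the algebraically
closed field `k`, hence constant, and all fractions would be constants. -/
theorem map_X_ne_zero [IsAlgClosed k] {φ : k⟦X⟧ →ₐ[k] k⟦X⟧} {τ : k⟦X⟧} {h : Polynomial k⟦X⟧}
    (hm : h.Monic) (h0 : h.eval₂ (φ : k⟦X⟧ →+* k⟦X⟧) τ = 0)
    (hfrac : ∀ y : k⟦X⟧, ∃ f g : Polynomial k⟦X⟧, g.eval₂ (φ : k⟦X⟧ →+* k⟦X⟧) τ ≠ 0 ∧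
      y * g.eval₂ (φ : k⟦X⟧ →+* k⟦X⟧) τ = f.eval₂ (φ : k⟦X⟧ →+* k⟦X⟧) τ) : φ X ≠ 0 := by
  intro hX
  have hφ : (φ : k⟦X⟧ →+* k⟦X⟧) = (algebraMap k k⟦X⟧).comp constantCoeff := by
    ext1 f
    obtain ⟨g, hg⟩ : X ∣ f - algebraMap k k⟦X⟧ (constantCoeff f) := by
      rw [X_dvd_iff, PowerSeries.algebraMap_apply]; simp
    have := congrArg φ hg
    rw [map_sub, map_mul, hX, zero_mul, AlgHom.commutes, sub_eq_zero] at this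
    exact this
  have hev : ∀ g : Polynomial k⟦X⟧, g.eval₂ (φ : k⟦X⟧ →+* k⟦X⟧) τ =
      Polynomial.aeval τ (g.map constantCoeff) := fun g => by
    rw [hφ, Polynomial.aeval_def, Polynomial.eval₂_map]
  have hτ : IsIntegral k τ := ⟨_, hm.map constantCoeff, by
    rw [← Polynomial.aeval_def, ← hev, h0]⟩
  obtain ⟨r, rfl⟩ := minpoly.mem_range_of_degree_eq_one k τ
    (IsAlgClosed.degree_eq_one_of_irreducible k (minpoly.irreducible hτ))
  obtain ⟨f, g, hg, hfg⟩ := hfrac X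
  rw [hev, Polynomial.aeval_algebraMap_apply] at hg hfg
  rw [hev, Polynomial.aeval_algebraMap_apply] at hfg
  have h1 := congrArg constantCoeff hfg
  rw [map_mul, constantCoeff_X, zero_mul, PowerSeries.algebraMap_apply, constantCoeff_C,
    Algebra.algebraMap_self_apply] at h1
  rw [← h1, map_zero] at hfg
  exact (mul_ne_zero X_ne_zero hg) hfg

/-- `1, X, …, X ^ (ε - 1)` are linearly independent over the image of `φ`, where `ε` is the order
of `φ X`. -/
theorem eq_zero_of_sum_map_mul_X_pow {φ : k⟦X⟧ →ₐ[k] k⟦X⟧} {ε : ℕ} {u : k⟦X⟧} (hu : IsUnit u)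
    (hφ : φ X = X ^ ε * u) (c : Fin ε → k⟦X⟧) (hc : ∑ i, φ (c i) * X ^ (i : ℕ) = 0) (i : Fin ε) :
    c i = 0 := by
  refine eq_zero_of_forall_X_pow_dvd fun n => ?_
  induction n generalizing c i with
  | zero => simp
  | succ n ih =>
    choose d hd using fun j => show ∃ d, c j = X * d + algebraMap k k⟦X⟧ (constantCoeff (c j)) by
      rw [PowerSeries.algebraMap_apply]; exact ⟨_, (c j).eq_X_mul_shift_add_const⟩
    have h1 : ∑ j, φ (c j) * X ^ (j : ℕ) = X ^ ε * (u * ∑ j, φ (d j) * X ^ (j : ℕ)) +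
        ∑ j, algebraMap k k⟦X⟧ (constantCoeff (c j)) * X ^ (j : ℕ) := by
      rw [Finset.mul_sum, Finset.mul_sum, ← Finset.sum_add_distrib]
      refine Finset.sum_congr rfl fun j _ => ?_
      conv_lhs => rw [hd j, map_add, map_mul, AlgHom.commutes, hφ]
      ring
    have h2 : ∀ j, constantCoeff (c j) = 0 := fun j => by
      have h3 := congrArg (coeff (j : ℕ)) (h1.symm.trans hc)
      rw [map_add, coeff_X_pow_mul', if_neg (by omega), zero_add, map_sum, map_zero,
        Finset.sum_eq_single j] at h3
      · rw [PowerSeries.algebraMap_apply, coeff_C_mul, coeff_X_pow_self, mul_one] at h3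
        exact h3
      · intro l _ hl
        rw [PowerSeries.algebraMap_apply, coeff_C_mul, coeff_X_pow,
          if_neg (fun h => hl (Fin.ext h.symm)), mul_zero]
      · simp
    have h3 : ∑ j, φ (d j) * X ^ (j : ℕ) = 0 := by
      rw [hc] at h1
      simp only [h2, map_zero, zero_mul, Finset.sum_const_zero, add_zero] at h1
      have := mul_eq_zero.1 h1.symm
      exact (mul_eq_zero.1 (this.resolve_left (pow_ne_zero _ X_ne_zero))).resolve_left hu.ne_zero
    rw [hd i, h2 i, map_zero, add_zero, pow_succ']
    exact mul_dvd_mul_left _ (ih d h3 i)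

theorem isIntegral_of_generators {R S : Type*} [CommRing R] [CommRing S] (f : R →+* S) {n : ℕ}
    (v : Fin n → S) (h : ∀ y, ∃ q : Fin n → R, y = ∑ i, f (q i) * v i) : f.IsIntegral := by
  classical
  refine RingHom.Finite.to_isIntegral ?_
  let _ : Algebra R S := f.toAlgebra
  refine ⟨⟨Finset.univ.image v, eq_top_iff.2 fun y _ => ?_⟩⟩
  obtain ⟨q, rfl⟩ := h y
  exact Submodule.sum_mem _ fun i _ => Submodule.smul_mem _ (q i)
    (Submodule.subset_span (by simp))

theorem injective_of_map_X {φ : k⟦X⟧ →ₐ[k] k⟦X⟧} {ε : ℕ} {u : k⟦X⟧} (hu : IsUnit u)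
    (hφ : φ X = X ^ ε * u) : Function.Injective φ := by
  rw [injective_iff_map_eq_zero]
  intro f hf
  by_contra h
  have := order_map hu hφ h
  rw [hf, order_zero] at this
  exact ENat.top_ne_natCast _ this

/-- The conductor of a lifting contains the conductor of the curve below times `h'(τ)`, where `τ`
is the image of `b`: every element of `h'(τ) k[[X]]` is a polynomial in `τ` with coefficients in
`φ (k[[X]])`, and `φ (X ^ c)` multiplies these coefficients into the curve. -/
theorem conductorLE_lifting {C : Arc k A} {C' : Arc k B} {φ : k⟦X⟧ →ₐ[k] k⟦X⟧} {ε : ℕ}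
    {u : k⟦X⟧} (hε : 1 ≤ ε) (hu : IsUnit u) (hφ : φ X = X ^ ε * u)
    (hcomp : ∀ r, C'.hom (algebraMap A B r) = φ (C.hom r)) {c : ℕ}
    (hc : ConductorLE C.hom.range c) {b : B} {h : Polynomial A}
    (h0 : Polynomial.aeval b h = 0)
    (h1 : C'.hom (Polynomial.aeval b (Polynomial.derivative h)) ≠ 0)
    (hfrac : ∀ y : k⟦X⟧, ∃ f g : Polynomial k⟦X⟧,
      g.eval₂ (φ : k⟦X⟧ →+* k⟦X⟧) (C'.hom b) ≠ 0 ∧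
        y * g.eval₂ (φ : k⟦X⟧ →+* k⟦X⟧) (C'.hom b) =
          f.eval₂ (φ : k⟦X⟧ →+* k⟦X⟧) (C'.hom b)) :
    ConductorLE C'.hom.range
      (ε * c + (C'.hom (Polynomial.aeval b (Polynomial.derivative h))).order.toNat) := by
  obtain ⟨d, v, hv, hd⟩ := exists_eq_X_pow_mul_unit h1
  have hev : ∀ g : Polynomial A, (g.map (C.hom : A →+* k⟦X⟧)).eval₂ (φ : k⟦X⟧ →+* k⟦X⟧)
      (C'.hom b) = C'.hom (Polynomial.aeval b g) := fun g => by
    have : ((φ : k⟦X⟧ →+* k⟦X⟧).comp (C.hom : A →+* k⟦X⟧)) =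
        (C'.hom : B →+* k⟦X⟧).comp (algebraMap A B) := RingHom.ext fun r => (hcomp r).symm
    rw [Polynomial.eval₂_map, this, Polynomial.aeval_def]
    exact (Polynomial.hom_eval₂ g (algebraMap A B) (C'.hom : B →+* k⟦X⟧) b).symm
  rw [hd, order_X_pow_mul_unit hv, ENat.toNat_natCast]
  rintro _ ⟨f, rfl⟩
  obtain ⟨w, hw⟩ := ((hu.pow c).mul hv).exists_right_inv
  obtain ⟨g, hg⟩ := exists_derivative_mul_eq_eval₂ (O := k⟦X⟧) (O' := k⟦X⟧)
    (φ := (φ : k⟦X⟧ →+* k⟦X⟧)) (injective_of_map_X hu hφ)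
    (isIntegral_of_generators _ _ (exists_eq_sum_map_mul_X_pow φ hε hu hφ))
    (h := h.map (C.hom : A →+* k⟦X⟧)) (by rw [hev, h0, map_zero])
    (by rwa [Polynomial.derivative_map, hev]) hfrac (w * f)
  rw [Polynomial.derivative_map, hev, hd, Polynomial.eval₂_eq_sum_range] at hg
  have h2 : X ^ (ε * c + d) * f =
      ∑ i ∈ Finset.range (g.natDegree + 1), φ (X ^ c * g.coeff i) * C'.hom b ^ i := by
    have h3 : X ^ (ε * c + d) * f = φ (X ^ c) * (X ^ d * v * (w * f)) := by
      rw [map_pow, hφ]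
      linear_combination (-X ^ (ε * c + d) * f) * hw
    rw [h3, hg, Finset.mul_sum]
    refine Finset.sum_congr rfl fun i _ => ?_
    rw [map_mul, RingHom.coe_coe]; ring
  rw [h2]
  refine Subalgebra.sum_mem _ fun i _ => Subalgebra.mul_mem _ ?_
    (Subalgebra.pow_mem _ (AlgHom.mem_range_self C'.hom b) i)
  obtain ⟨r, hr⟩ := hc _ (dvd_mul_right (X ^ c) (g.coeff i))
  exact ⟨algebraMap A B r, (hcomp r).trans (congrArg φ hr)⟩

end Liftings

/-! ### The bound -/

open PowerSeries in
/-- A local equation of a prime divisor other than the support of an arc does not vanish along the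
arc. -/
theorem Arc.hom_ne_zero {k A : Type*} [Field k] [CommRing A] [Algebra k A]
    (θ : k⟦X⟧⟦X⟧ ≃ₐ[k] A) [IsDomain A] [IsLocalRing A] (C : Arc k A) {P : PrimeSpectrum A}
    (hP : P.asIdeal.height = 1) (hne : C.supportIdeal ≠ P.asIdeal) {t : A}
    (ht : P.asIdeal = Ideal.span {t}) : C.hom t ≠ 0 := by
  intro h0
  have hker : (RingHom.ker C.hom).IsPrime := RingHom.ker_isPrime _
  have hm : RingHom.ker C.hom ≠ IsLocalRing.maximalIdeal A := fun h =>
    C.nonconstant (h.trans (IsLocalRing.eq_maximalIdeal C.closed).symm)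
  obtain ⟨g, hg⟩ := exists_eq_span_singleton θ _ hm
  have ht0 : t ≠ 0 := by
    rintro rfl
    rw [ht, Ideal.span_singleton_zero, Ideal.height_bot] at hP
    exact zero_ne_one hP
  have htp : Prime t := (Ideal.span_singleton_prime ht0).1 (ht ▸ P.isPrime)
  have hgt : g ∣ t := by
    rw [← Ideal.mem_span_singleton, ← hg]
    exact h0
  have hgu : ¬ IsUnit g := fun h => hker.ne_top (by rw [hg, Ideal.span_singleton_eq_top.2 h])
  refine hne ?_
  rw [ht, Arc.supportIdeal, hg, Ideal.span_singleton_eq_span_singleton]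
  exact ((htp.irreducible.dvd_iff.1 hgt).resolve_left hgu).symm

end Algebroid

theorem proposition6p3
    {k : Type*} [Field k] [IsAlgClosed k] (p : ℕ) [Fact p.Prime] [CharP k p]
    -- `A = k[[T, U]]`, where `T = e (X 0)` and `U = e (X 1)`
    {A : Type*} [CommRing A] [Algebra k A] (e : MvPowerSeries (Fin 2) k ≃ₐ[k] A)
    -- `A₁ = k[[T₁, U]]`, where `T₁ = e₁ (X 0)` and `U = e₁ (X 1)`
    {A₁ : Type*} [CommRing A₁] [Algebra k A₁] (e₁ : MvPowerSeries (Fin 2) k ≃ₐ[k] A₁)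
    -- the embedding of `A` into `A₁`
    [Algebra A A₁] [IsScalarTower k A A₁]
    (hinj : Function.Injective (algebraMap A A₁))
    (hU : algebraMap A A₁ (e (MvPowerSeries.X 1)) = e₁ (MvPowerSeries.X 1))
    (hT : algebraMap A A₁ (e (MvPowerSeries.X 0)) - e₁ (MvPowerSeries.X 0) ^ p ∈
      Ideal.span {e₁ (MvPowerSeries.X 0) ^ (p + 1),
        e₁ (MvPowerSeries.X 0) * e₁ (MvPowerSeries.X 1)})
    (σ : A₁ ≃ₐ[A] A₁) (hσ : σ ^ p = 1)
    (hfix : ∀ y : A₁, σ y = y → y ∈ Set.range (algebraMap A A₁))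
    -- `K` and `L` are the fields of fractions of `A` and `A₁`
    {K L : Type*} [Field K] [Algebra A K] [IsFractionRing A K]
    [Field L] [Algebra A₁ L] [IsFractionRing A₁ L]
    [Algebra K L] [Algebra A L] [IsScalarTower A K L] [IsScalarTower A A₁ L]
    -- `L = K(x)` with `x ^ p - x = a`
    (a : K) (x : L) (hx : x ^ p - x = algebraMap K L a)
    (hgen : IntermediateField.adjoin K {x} = ⊤)
    -- the branch divisor is a simply normal crossing divisor
    (hsnc : Algebroid.IsSNC (Algebroid.branchComponents A A₁))
    -- `C` is a primitive arc, `[C] ≠ F_T`, and `(C . R₀)` is defined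
    (C : Algebroid.Arc k A) (hC : C.IsPrimitive)
    (hCT : C.supportIdeal ≠ Ideal.span {e (MvPowerSeries.X 0)})
    (hCR : ∀ P ∈ Algebroid.branchComponents A A₁, C.supportIdeal ≠ P.asIdeal)
    -- `C'` is a lifting of `C`
    (C' : Algebroid.Arc k A₁) (hC' : C.IsLifting C') :
    (C'.M : ℝ) < (p : ℝ) / 2 * (C.interDiv (Algebroid.R₀ A A₁ a) : ℝ) * (C.E : ℝ) +
      (p : ℝ) / 2 * (C.M : ℝ) * (C.E : ℝ) ^ 2 := by
  open Algebroid in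
  have hp : p.Prime := Fact.out
  obtain ⟨θ, hθX, hθC⟩ := exists_algEquiv e
  obtain ⟨θ₁, hθ₁X, hθ₁C⟩ := exists_algEquiv e₁
  have := isDomain_of_equiv θ
  have := isLocalRing_of_equiv θ
  have := isNoetherianRing_of_equiv θ
  have := ufd_of_equiv θ
  have := isDomain_of_equiv θ₁
  have := isLocalRing_of_equiv θ₁
  have := ufd_of_equiv θ₁
  have : CharP L p := charP_of_injective_ringHom
    (f := (algebraMap A₁ L).comp (algebraMap k A₁)) (RingHom.injective _) p
  have hpu : ∀ r : ℕ, ¬ p ∣ r → IsUnit (r : A₁) := fun r hr => by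
    have h1 : IsUnit (r : k) := isUnit_iff_ne_zero.2 (by rwa [Ne, CharP.cast_eq_zero_iff k p])
    simpa using h1.map (algebraMap k A₁)
  rw [← hθX, ← hθ₁X] at hU
  rw [← hθC, ← hθ₁C, ← hθ₁X] at hT
  set b := θ₁ (PowerSeries.C PowerSeries.X) with hb
  have hgenb := exists_eq_sum_algebraMap_mul_pow θ θ₁ hp.one_le hU hT
  have hD : σ b - b ≠ 0 := fun h =>
    not_mem_range_algebraMap θ θ₁ hp.two_le hU hT (hfix _ (sub_eq_zero.1 h))
  obtain ⟨φ, hcomp, hfrac⟩ := hC'.exists_algHom hgenb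
  obtain ⟨h, hm, hdeg, h0, hdvd⟩ := exists_monic_polynomial hp hgenb hσ hfix
  -- the ramification index `ε` of the lifting over the arc
  have hev : (h.map (C.hom : A →+* PowerSeries k)).eval₂
      (φ : PowerSeries k →+* PowerSeries k) (C'.hom b) = 0 := by
    have h1 : ((φ : PowerSeries k →+* PowerSeries k).comp (C.hom : A →+* PowerSeries k)) =
        (C'.hom : A₁ →+* PowerSeries k).comp (algebraMap A A₁) :=
      RingHom.ext fun r => (hcomp r).symm
    rw [Polynomial.eval₂_map, h1]
    refine (Polynomial.hom_eval₂ h (algebraMap A A₁) (C'.hom : A₁ →+* PowerSeries k) b).symm.trans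
      ?_
    rw [← Polynomial.aeval_def, h0, map_zero]
  obtain ⟨ε, u, hu, hφ⟩ := exists_eq_X_pow_mul_unit (map_X_ne_zero (hm.map _) hev hfrac)
  have hε1 : 1 ≤ ε := by
    have := X_dvd_map_X φ
    rw [hφ, ← pow_one PowerSeries.X, ← pow_mul, one_mul, X_pow_dvd_X_pow_mul_unit hu] at this
    exact this
  have hεp : ε ≤ p := by
    rw [← hdeg, ← hm.natDegree_map (C.hom : A →+* PowerSeries k)]
    exact le_natDegree_of_linearIndependent (injective_of_map_X hu hφ) (hm.map _) hev hfrac _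
      (eq_zero_of_sum_map_mul_X_pow hu hφ)
  have hfin : (branchComponents A A₁).Finite := by
    obtain ⟨t, s, -, hts⟩ := hsnc
    refine Set.Finite.of_finite_image (f := PrimeSpectrum.asIdeal)
      ((Set.toFinite {Ideal.span {t}, Ideal.span {s}}).subset ?_)
      (fun P _ Q _ h => PrimeSpectrum.ext h)
    rintro _ ⟨P, hP, rfl⟩
    exact hts P hP
  obtain ⟨hD0, hDle⟩ := order_le_interDiv hinj hp hpu hgenb hσ hfix hD hx hgen hfin C C'
    (fun P hP t ht => C.hom_ne_zero θ hP.1 (hCR P hP) ht) hu hφ hεp hcomp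
  set d := (C'.hom (σ b - b)).order.toNat
  -- `T₁` and `σ T₁` lie in the maximal ideal, so `ord D ≥ 1`
  have hd1 : 1 ≤ d := by
    have h1 : b ∈ IsLocalRing.maximalIdeal A₁ := by
      rw [maximalIdeal_eq_span θ₁]; exact Ideal.subset_span (by simp [hb])
    have h2 : σ b ∈ IsLocalRing.maximalIdeal A₁ := by
      rw [IsLocalRing.mem_maximalIdeal, mem_nonunits_iff] at h1 ⊢
      rwa [MulEquiv.isUnit_map σ]
    have h3 := C'.X_dvd_of_mem_maximalIdeal (Ideal.sub_mem _ h2 h1)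
    obtain ⟨n, v, hv, hn⟩ := exists_eq_X_pow_mul_unit hD0
    have h4 : d = n := by
      change (C'.hom (σ b - b)).order.toNat = n
      rw [hn, order_X_pow_mul_unit hv, ENat.toNat_natCast]
    rw [hn, ← pow_one PowerSeries.X, ← pow_mul, one_mul, X_pow_dvd_X_pow_mul_unit hv] at h3
    omega
  -- the order of the different
  obtain ⟨y, hy⟩ := hdvd
  have hy' : C'.hom (σ b - b) ^ (p - 1) =
      C'.hom (Polynomial.aeval b (Polynomial.derivative h)) * C'.hom y := by
    rw [← map_pow, hy, map_mul]
  have hne : C'.hom (Polynomial.aeval b (Polynomial.derivative h)) ≠ 0 := fun h' =>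
    pow_ne_zero (p - 1) hD0 (by rw [hy', h', zero_mul])
  have hdiff : (C'.hom (Polynomial.aeval b (Polynomial.derivative h))).order.toNat ≤
      (p - 1) * d := by
    refine ENat.toNat_le_of_le_natCast ?_
    rw [Nat.cast_mul, PowerSeries.coe_toNat_order hD0, ← nsmul_eq_mul, ← PowerSeries.order_pow, hy',
      PowerSeries.order_mul]
    exact le_self_add
  -- twice the number of transforms is at most the conductor exponent of the lifting
  have hM := two_mul_numTransforms_le
    (conductorLE_lifting hε1 hu hφ hcomp (hC.conductorLE e) h0 hne hfrac)
  rw [← C'.curve_eq] at hM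
  have hE := hC.one_le_E e
  obtain ⟨E, hE'⟩ : ∃ E, C.E = E + 1 := ⟨C.E - 1, by omega⟩
  have hM1 : 2 * C'.M ≤ p * (C.M * (C.E * (C.E - 1))) + (p - 1) * d :=
    hM.trans (Nat.add_le_add (Nat.mul_le_mul_right _ hεp) hdiff)
  rw [hE', Nat.add_sub_cancel] at hM1
  rw [hE']
  -- `ord D ≤ (C . R₀)` and `1 ≤ ord D` turn `p M E (E - 1) + (p - 1) ord D` into the bound
  obtain ⟨q, rfl⟩ : ∃ q, p = q + 1 := ⟨p - 1, by have := hp.two_le; omega⟩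
  rw [Nat.add_sub_cancel] at hM1
  have hM2 : (2 : ℝ) * C'.M ≤ (q + 1) * (C.M * ((E + 1) * E)) + q * d := by exact_mod_cast hM1
  have hI : (d : ℝ) ≤ (C.interDiv (R₀ A A₁ a) : ℝ) := by exact_mod_cast hDle
  have hd1' : (1 : ℝ) ≤ d := by exact_mod_cast hd1
  set I : ℝ := (C.interDiv (R₀ A A₁ a) : ℝ)
  push_cast
  have hq : (0 : ℝ) ≤ q := Nat.cast_nonneg _
  have hE0 : (0 : ℝ) ≤ E := Nat.cast_nonneg _
  have hM0 : (0 : ℝ) ≤ C.M := Nat.cast_nonneg _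
  have h1 : (q : ℝ) * d < (q + 1) * I * (E + 1) := by
    have h2 : (q : ℝ) * d ≤ q * I := mul_le_mul_of_nonneg_left hI hq
    have h3 : 0 ≤ (q + 1) * I * E := by
      have : 0 ≤ I := by linarith
      positivity
    linarith
  have h4 : (0 : ℝ) ≤ (q + 1) * C.M * (E + 1) := by positivity
  linarith
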